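/- **Setting.** Let $(M,\rho)$ be a metric space in which all closed bounded sets are compact (so $M$ is locally compact, separable and complete), with its Borel $\sigma$-field. For $n\in\mathbb N$ let $(\mathsf P^{(n)}_t)_{t\ge 0}$ be a Feller transition function on $M^n$ (a semigroup of Markov kernels that maps $C_0(M^n)$ to itself and is strongly continuous at time $0$ on $C_0(M^n)$) such that: * (TF1) for distinct $i_1,\dots,i_k\in\{1,\dots,n\}$, $t\ge 0$, $x\in M^n$ and $B\in\mathcal B(M^k)$: $\mathsf P^{(n)}_t(x,\{y:(y_{i_1},\dots,y_{i_k})\in B\})=\mathsf P^{(k)}_t((x_{i_1},\dots,x_{i_k}),B)$; * (TF2) $\mathsf P^{(2)}_t((x,x),\{(y,y):y\in M\})=1$ for all $x\in M$, $t\ge 0$; * (TF3) $\lim_{t\downarrow 0}t^{-1}\sup_{x\in K}\mathsf P^{(1)}_t(x,\{y:\rho(x,y)>r\})=0$ for all compact $K\subset M$ and $r>0$. Let $\psi^0=(\psi^0_{s,t})_{s\le t}$ be an associated stochastic flow of measurable mappings on a probability space $(\Omega,\mathcal A,\mathbb P)$: a family of random elements of the space $\mathcal M$ of measurable maps $M\to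 M$ with its cylindrical $\sigma$-field, such that * $\mathbb E f(\psi^0_{s,t}(x_1),\dots,\psi^0_{s,t}(x_n))=\mathsf P^{(n)}_{t-s}f(x)$ for $s\le t$, $x\in M^n$, $f\in C_0(M^n)$; * there are measurable $\mathcal J_t:\mathcal M\times M\to M$, $t\ge 0$, such that for all $s\le t\le u$ and $x\in M$, a.s. $\mathcal J_{t-s}(\psi^0_{s,t})(x)=\psi^0_{s,t}(x)$, $\psi^0_{s,u}(x)=\mathcal J_{u-t}(\psi^0_{t,u})(\psi^0_{s,t}(x))$ and $\psi^0_{s,s}(x)=x$; * for $t_1\le\dots\le t_n$ the random maps $\psi^0_{t_i,t_{i+1}}$, $1\le i\le n-1$, are independent; * for $f\in C_0(M)$, $s\le t$ and $x\in M$: $\sup_{z\in M}\mathbb E[(f(\psi^0_{u,v}(z))-f(\psi^0_{s,t}(z)))^2]\to 0$ as $(u,v)\to(s,t)$, $u\le v$; $\mathbb E[(f(\psi^0_{s,t}(y))-f(\psi^0_{s,t}(x)))^2]\to 0$ as $y\to x$; and $\mathbb E[f(\psi^0_{s,t}(y))^2]\to 0$ as $y\to\infty$. **Paths and skeletons.**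 Let $X=\bigcup_{s\in\mathbb R}C([s,\infty):M)$. For $f:[s,\infty)\to M$ in $X$ put $i(f)=s$ and $e(f)(t)=f(s\vee t)$, $t\in\mathbb R$; $X$ carries the topology induced by $f\mapsto(i(f),e(f))\in\mathbb R\times C(\mathbb R:M)$ (uniform convergence on compacts in the second factor) and its Borel $\sigma$-field. Write $f[s,\infty)$ and $f[s,t]$ for restrictions of $e(f)$. For $\varphi=(\varphi_n)_{n\in\mathbb N}\in X^{\mathbb N}$ let $s_n=i(\varphi_n)$ and $I^s=\{n:s_n\le s\}$. $\varphi$ is a *skeleton* if: $m,n\in I^s$ and $\varphi_m(s)=\varphi_n(s)$ imply $\varphi_m=\varphi_n$ on $[s,\infty)$; the set of points $(s_n,\varphi_n(s_n))$ is dense in $\mathbb R\times M$; and for every compact $L\subset\mathbb R\times M$ the set $\{\varphi_n[s,\infty):n\in I^s,\ (s,\varphi_n(s))\in L\}$ is relatively compact in $X$. Let $((s_n,x_n))_{n\in\mathbb N}$ be dense in $\mathbb R\times M$ and let $\Phi=(\Phi_n)_{n\in\mathbb N}$ be a random element of $X^{\mathbb N}$ such that $\Phi_n$ is a continuous modification of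 $\psi^0_{s_n,\cdot}(x_n)$ with $i(\Phi_n)=s_n$ and $\Phi_n(s_n)=x_n$. Assume * (TF4) almost surely $\Phi$ is a skeleton. **The family $\theta$.** Fix a measurable $\ell:X^{\mathbb N}\to X$ such that $\ell((f_n))$ is a limit point of $(f_n)$ for every relatively compact sequence $(f_n)$, and a distance $\delta$ on $C(\mathbb R:M)$ inducing uniform convergence on compacts. Let $d_0(f,g)=\delta(e(f),e(g))$ for $f,g\in C([0,\infty):M)$, let $\mathbb P^{(2)}_{(x,y)}$ be the law on $C([0,\infty):M^2)$ of the Markov process $(X,Y)$ with transition function $\mathsf P^{(2)}$ started from $(x,y)$, and $$\varepsilon_k(x)=2^{-k}\wedge\inf\Big\{r>0:\sup_{y\in\overline B(x,r)}\mathbb P^{(2)}_{(x,y)}[d_0(X,Y)\ge 2^{-k}]>2^{-k}\Big\},\qquad \inf\emptyset=\infty .$$ Let $n^{s,x}_k=\inf\{n\in I^s:\rho(\Phi_n(s),x)<\varepsilon_k(x)\}$ and $\theta_{s,\cdot}(x)=\ell\big((\Phi_{n^{s,x}_k}[s,\infty))_{k\in\mathbb N}\big)$; this is well defined whenever $\Phi$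 is a skeleton, hence almost surely. **Bifurcation points.** For $s<t$ let $\mathcal K^{s,t}_x=\bigcap_{\varepsilon>0}\overline{\{\varphi_n[s,t]:n\in I^s,\ \varphi_n(s)\in B(x,\varepsilon)\}}$ (closure in $C([s,t]:M)$), $\tau^s_x=\inf\{t>s:\#\mathcal K^{s,t}_x\ge 2\}$ and $B(\varphi)=\{(s,x):\tau^s_x=s\}$. Let $F\subset\mathbb R\times M$ be a *closed shell* of the bifurcation set of $\Phi$, i.e. $F$ is a (deterministic) closed set with $B(\Phi)\subset F$ almost surely. **The family $\psi$.** Put $\sigma^s_x(0)=s$, $z^s_x(0)=x$ and, for $k\ge 0$, $$\sigma^s_x(k+1)=\inf\{t>\sigma^s_x(k):(t,\theta_{\sigma^s_x(k),t}(z^s_x(k)))\in F\}$$ if $\sigma^s_x(k)<\infty$, and $\sigma^s_x(k+1)=\infty$ otherwise; $z^s_x(k+1)=\theta_{\sigma^s_x(k),\sigma^s_x(k+1)}(z^s_x(k))$ if $\sigma^s_x(k+1)<\infty$, and $z^s_x(k+1)=x$ otherwise. Let $k^s_x=\inf\{k\ge 0:\sigma^s_x(k)=\sigma^s_x(k+1)\}$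 and $\sigma^s_x(\infty)=\lim_k\sigma^s_x(k)$. For $t\ge s$ let $\psi_{s,t}(x)=\theta_{\sigma^s_x(k),t}(z^s_x(k))$ if $t\in[\sigma^s_x(k),\sigma^s_x(k+1))$ for some $k$; $\psi_{s,t}(x)=\theta_{\sigma^s_x(k^s_x),t}(z^s_x(k^s_x))$ if $t\ge\sigma^s_x(\infty)$ and $k^s_x<\infty$; and $\psi_{s,t}(x)=x$ if $t\ge\sigma^s_x(\infty)$ and $k^s_x=\infty$. **Theorem.** Assume that almost surely * $k^s_x<\infty$ for all $(s,x)\in\mathbb R\times M$; and * for all $(s,x)\in\mathbb R\times M$ with $k^s_x=0$ and all $t>s$ there is $n\in I^t$ with $\theta_{s,\cdot}(x)[t,\infty)=\Phi_n[t,\infty)$. Then $\psi$ is, up to a null event, a strong measurable continuous modification of $\psi^0$. That is, there is an event $\Omega_0$ with $\mathbb P[\Omega_0]=1$ such that, after redefining $\psi_{s,t}(\omega,x):=x$ for all $\omega\notin\Omega_0$, 1. $(s,t,x,\omega)\mapsto\psi_{s,t}(\omega,x)$ is measurable on $\{s\le t\}\times M\times\Omega$; 2. $\psi_{s,s}(\omega,x)=x$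 for all $s,x,\omega$; 3. $\mathbb P[\psi_{s,t}(x)=\psi^0_{s,t}(x)]=1$ for all $s\le t$ and $x\in M$; 4. $t\mapsto\psi_{s,t}(\omega,x)$ is continuous on $[s,\infty)$ for all $s,x,\omega$; 5. $\psi_{s,u}(\omega,\cdot)=\psi_{t,u}(\omega,\cdot)\circ\psi_{s,t}(\omega,\cdot)$ for all $s\le t\le u$ and all $\omega\in\Omega$. -/

import Mathlib

open MeasureTheory ProbabilityTheory Filter Topology Set
open scoped NNReal ENNReal ZeroAtInfty

namespace StrongFlow

/-! ### Transition functions -/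

/-- A (conservative) Feller transition function on `E`: a semigroup of Markov kernels which acts on
`C₀(E)` and is strongly continuous at time `0` there. -/
structure IsFellerTransition {E : Type*} [TopologicalSpace E] [MeasurableSpace E]
    (P : ℝ≥0 → Kernel E E) : Prop where
  markov : ∀ t, IsMarkovKernel (P t)
  zero : P 0 = Kernel.id
  comp : ∀ s t, P (s + t) = P t ∘ₖ P s
  map_zeroAtInfty : ∀ (t : ℝ≥0) (f : C₀(E, ℝ)), ∃ g : C₀(E, ℝ), ∀ x, ∫ y, f y ∂(P t x) = g x
  tendsto_zero : ∀ f : C₀(E, ℝ),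
    TendstoUniformly (fun (t : ℝ≥0) (x : E) => ∫ y, f y ∂(P t x)) f (𝓝 0)

/-- A consistent sequence of coalescing Feller transition functions: `P n` is a Feller transition
function on `M ^ n`. -/
structure IsConsistentCoalescing {M : Type*} [TopologicalSpace M] [MeasurableSpace M]
    (P : (n : ℕ) → ℝ≥0 → Kernel (Fin n → M) (Fin n → M)) : Prop where
  feller : ∀ n, IsFellerTransition (P n)
  consistent : ∀ (n k : ℕ) (i : Fin k → Fin n), Function.Injective i →
    ∀ (t : ℝ≥0) (x : Fin n → M) (B : Set (Fin k → M)), MeasurableSet B →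
      P n t x {y | (fun j => y (i j)) ∈ B} = P k t (fun j => x (i j)) B
  coalescing : ∀ (x : M) (t : ℝ≥0), P 2 t ![x, x] {y | y 0 = y 1} = 1

/-- For all compact `K` and `r > 0`, `t⁻¹ sup_{x ∈ K} P⁽¹⁾_t(x, {y : ρ(x,y) > r}) → 0` as
`t ↓ 0`. -/
def HasContinuousTrajectories {M : Type*} [MetricSpace M] [MeasurableSpace M]
    (P : (n : ℕ) → ℝ≥0 → Kernel (Fin n → M) (Fin n → M)) : Prop :=
  ∀ (K : Set M) (r : ℝ), IsCompact K → 0 < r →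
    Tendsto (fun t : ℝ≥0 => (⨆ x ∈ K, P 1 t (fun _ => x) {y | r < dist x (y 0)}) / (t : ℝ≥0∞))
      (𝓝[>] 0) (𝓝 0)

/-! ### Stochastic flows of measurable mappings -/

/-- The space of measurable mappings `M → M`. The σ-field it carries, as a subtype of the product
`M → M`, is the cylindrical one. -/
abbrev MeasMap (M : Type*) [MeasurableSpace M] : Type _ := {f : M → M // Measurable f}

/-- `ψ = (ψ_{s,t} : s ≤ t)` is a stochastic flow of measurable mappings on `M` associated to the
sequence `P` of `n`-point transition functions. The values `ψ s t` with `t < s` play no role. -/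
structure IsStochasticFlow {M Ω : Type*} [TopologicalSpace M] [MeasurableSpace M]
    [MeasurableSpace Ω] (P : (n : ℕ) → ℝ≥0 → Kernel (Fin n → M) (Fin n → M)) (μ : Measure Ω)
    (ψ : ℝ → ℝ → Ω → MeasMap M) : Prop where
  measurable : ∀ s t, s ≤ t → Measurable (ψ s t)
  law : ∀ (s t : ℝ), s ≤ t → ∀ (n : ℕ) (x : Fin n → M) (f : C₀(Fin n → M, ℝ)),
    ∫ ω, f (fun i => (ψ s t ω).1 (x i)) ∂μ = ∫ y, f y ∂(P n (t - s).toNNReal x)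
  flow : ∃ J : ℝ≥0 → MeasMap M × M → M, (∀ t, Measurable (J t)) ∧
    (∀ (s t : ℝ), s ≤ t → ∀ x : M, ∀ᵐ ω ∂μ, J (t - s).toNNReal (ψ s t ω, x) = (ψ s t ω).1 x) ∧
    (∀ (s t u : ℝ), s ≤ t → t ≤ u → ∀ x : M,
      ∀ᵐ ω ∂μ, (ψ s u ω).1 x = J (u - t).toNNReal (ψ t u ω, (ψ s t ω).1 x)) ∧
    (∀ (s : ℝ) (x : M), ∀ᵐ ω ∂μ, (ψ s s ω).1 x = x)
  indep : ∀ (n : ℕ) (t : Fin (n + 1) → ℝ), Monotone t →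
    iIndepFun (fun i : Fin n => ψ (t i.castSucc) (t i.succ)) μ
  time_continuity : ∀ (f : C₀(M, ℝ)) (s t : ℝ), s ≤ t →
    Tendsto (fun p : ℝ × ℝ =>
        ⨆ x : M, ∫⁻ ω, ENNReal.ofReal ((f ((ψ p.1 p.2 ω).1 x) - f ((ψ s t ω).1 x)) ^ 2) ∂μ)
      (𝓝[{p : ℝ × ℝ | p.1 ≤ p.2}] (s, t)) (𝓝 0)
  space_continuity : ∀ (f : C₀(M, ℝ)) (x : M) (s t : ℝ), s ≤ t →
    Tendsto (fun y : M => ∫⁻ ω, ENNReal.ofReal ((f ((ψ s t ω).1 y) - f ((ψ s t ω).1 x)) ^ 2) ∂μ)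
      (𝓝 x) (𝓝 0)
  space_infinity : ∀ (f : C₀(M, ℝ)) (s t : ℝ), s ≤ t →
    Tendsto (fun y : M => ∫⁻ ω, ENNReal.ofReal (f ((ψ s t ω).1 y) ^ 2) ∂μ) (cocompact M) (𝓝 0)

/-- `ψ'` is a strong measurable continuous modification of `ψ`. Joint measurability on
`{s ≤ t} × M × Ω` contains the statement that each `ψ'_{s,t}` is a random measurable mapping. -/
structure IsStrongMeasurableContinuousModification {M Ω : Type*} [TopologicalSpace M]
    [MeasurableSpace M] [MeasurableSpace Ω] (μ : Measure Ω) (ψ' : ℝ → ℝ → Ω → M → M)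
    (ψ : ℝ → ℝ → Ω → MeasMap M) : Prop where
  measurable : Measurable
    (fun q : {p : ℝ × ℝ // p.1 ≤ p.2} × M × Ω => ψ' q.1.1.1 q.1.1.2 q.2.2 q.2.1)
  self : ∀ s ω x, ψ' s s ω x = x
  modification : ∀ s t, s ≤ t → ∀ x, ∀ᵐ ω ∂μ, ψ' s t ω x = (ψ s t ω).1 x
  continuous : ∀ s ω x, ContinuousOn (fun t => ψ' s t ω x) (Ici s)
  flow : ∀ s t u, s ≤ t → t ≤ u → ∀ ω x, ψ' s u ω x = ψ' t u ω (ψ' s t ω x)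

/-! ### The space of continuous paths and skeletons -/

/-- The space `X = ⋃_s C([s,∞) : M)` of continuous paths. A path `f : [s,∞) → M` is encoded by the
pair `(i(f), e(f))` of its starting time `s` and of its extension `t ↦ f (s ∨ t)` to `ℝ`. The
topology is inherited from `ℝ × C(ℝ, M)`, where `C(ℝ, M)` carries the topology of uniform
convergence on compact sets. -/
abbrev PathSpace (M : Type*) [TopologicalSpace M] : Type _ :=
  {p : ℝ × C(ℝ, M) // ∀ t ≤ p.1, p.2 t = p.2 p.1}

/-- The Borel σ-field of `PathSpace M`. -/
instance instMeasurableSpacePathSpace (M : Type*) [TopologicalSpace M] :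
    MeasurableSpace (PathSpace M) := borel (PathSpace M)

section Paths

variable {M : Type*} [TopologicalSpace M]

/-- The starting time `i(f)`. -/
def start (f : PathSpace M) : ℝ := f.1.1

/-- The value at time `t` of (the extension of) the path `f`. -/
def val (f : PathSpace M) (t : ℝ) : M := f.1.2 t

/-- The restriction `f[s,∞)`, an element of `C([s,∞) : M)`. -/
def restrictFrom (f : PathSpace M) (s : ℝ) : PathSpace M :=
  ⟨(s, f.1.2.comp ⟨fun t => max s t, by fun_prop⟩), fun t ht => by simp [max_eq_left ht]⟩

/-- The restriction `f[s,t]`, an element of `C([s,t] : M)`. -/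
def restrictIcc (f : PathSpace M) (s t : ℝ) : C(Icc s t, M) := f.1.2.restrict (Icc s t)

/-- A skeleton: a coalescing sequence of paths with dense starting points, such that, for every
compact `L ⊆ ℝ × M`, the set of the paths `φ_n[s,∞)` with `s_n ≤ s` and `(s, φ_n(s)) ∈ L` is
relatively compact. -/
structure IsSkeleton (φ : ℕ → PathSpace M) : Prop where
  coalescence : ∀ (s : ℝ) (m n : ℕ), start (φ m) ≤ s → start (φ n) ≤ s →
    val (φ m) s = val (φ n) s → ∀ t, s ≤ t → val (φ m) t = val (φ n) t
  dense : DenseRange (fun n => (start (φ n), val (φ n) (start (φ n))))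
  relCompact : ∀ L : Set (ℝ × M), IsCompact L →
    IsCompact (closure {g : PathSpace M | ∃ (n : ℕ) (s : ℝ),
      start (φ n) ≤ s ∧ (s, val (φ n) s) ∈ L ∧ g = restrictFrom (φ n) s})

/-- `ℓ` is a measurable map which selects a limit point of every relatively compact sequence of
paths. -/
structure IsLimitSelector (ℓ : (ℕ → PathSpace M) → PathSpace M) : Prop where
  measurable : Measurable ℓ
  mapClusterPt : ∀ f : ℕ → PathSpace M, IsCompact (closure (range f)) →
    MapClusterPt (ℓ f) atTop f

end Paths

/-! ### The extension `θ` of a skeleton -/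

section Extension

variable {M : Type*} [MetricSpace M]

/-- The index `n^{s,x}_k`: the least `n` with `s_n ≤ s` and `ρ(φ_n(s), x) < ε_k(x)`. -/
noncomputable def approxIndex (ε : ℕ → M → ℝ) (s : ℝ) (x : M) (φ : ℕ → PathSpace M) (k : ℕ) : ℕ :=
  sInf {n : ℕ | start (φ n) ≤ s ∧ dist (val (φ n) s) x < ε k x}

/-- `Θ(s, x, φ)`, the selected limit point of the sequence of the paths `φ_{n^{s,x}_k}[s,∞)`. -/
noncomputable def bigTheta (ℓ : (ℕ → PathSpace M) → PathSpace M) (ε : ℕ → M → ℝ) (s : ℝ) (x : M)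
    (φ : ℕ → PathSpace M) : PathSpace M :=
  ℓ (fun k => restrictFrom (φ (approxIndex ε s x φ k)) s)

/-- `θ_{s,t}(x) = Θ(s, x, φ)(t)`. -/
noncomputable def theta (ℓ : (ℕ → PathSpace M) → PathSpace M) (ε : ℕ → M → ℝ)
    (φ : ℕ → PathSpace M) (s t : ℝ) (x : M) : M :=
  val (bigTheta ℓ ε s x φ) t

/-! ### Bifurcation points -/

/-- `𝒦^{s,t}_x`, the intersection over `δ > 0` of the closures in `C([s,t] : M)` of the sets
`{φ_n[s,t] : s_n ≤ s, φ_n(s) ∈ B(x, δ)}`. -/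
def limitPaths (φ : ℕ → PathSpace M) (s t : ℝ) (x : M) : Set C(Icc s t, M) :=
  ⋂ (δ : ℝ) (_ : 0 < δ), closure {g : C(Icc s t, M) | ∃ n : ℕ,
    start (φ n) ≤ s ∧ val (φ n) s ∈ Metric.ball x δ ∧ g = restrictIcc (φ n) s t}

/-- `τ^s_x`, the infimum of the times `t > s` such that `𝒦^{s,t}_x` has at least two elements
(`⊤` if there are none). -/
noncomputable def bifurcationTime (φ : ℕ → PathSpace M) (s : ℝ) (x : M) : EReal :=
  sInf {r : EReal | ∃ t : ℝ, r = t ∧ s < t ∧ 2 ≤ (limitPaths φ s t x).encard}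

/-- The set `B(φ)` of bifurcation points. -/
def bifurcationSet (φ : ℕ → PathSpace M) : Set (ℝ × M) :=
  {p | bifurcationTime φ p.1 p.2 = (p.1 : EReal)}

end Extension

/-! ### Restarting at the hitting times of `F` -/

section Restart

variable {M : Type*}

/-- The sequence `(σ^s_x(k), z^s_x(k))`, with values in `[s,∞] × M`. -/
noncomputable def hit (θ : ℝ → ℝ → M → M) (F : Set (ℝ × M)) (s : ℝ) (x : M) : ℕ → EReal × M
  | 0 => ((s : EReal), x)
  | k + 1 =>
    open Classical in
    let p := hit θ F s x k
    let σ : EReal := if p.1 = ⊤ then ⊤ else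
      sInf {r : EReal | ∃ t : ℝ, r = t ∧ p.1 < t ∧ (t, θ p.1.toReal t p.2) ∈ F}
    (σ, if σ = ⊤ then x else θ p.1.toReal σ.toReal p.2)

/-- `σ^s_x(k)`. -/
noncomputable def hitTime (θ : ℝ → ℝ → M → M) (F : Set (ℝ × M)) (s : ℝ) (x : M) (k : ℕ) : EReal :=
  (hit θ F s x k).1

/-- `z^s_x(k)`. -/
noncomputable def hitPoint (θ : ℝ → ℝ → M → M) (F : Set (ℝ × M)) (s : ℝ) (x : M) (k : ℕ) : M :=
  (hit θ F s x k).2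

/-- `k^s_x = inf {k : σ^s_x(k) = σ^s_x(k+1)}`, in `{0, 1, …, ∞}`. -/
noncomputable def hitCount (θ : ℝ → ℝ → M → M) (F : Set (ℝ × M)) (s : ℝ) (x : M) : ℕ∞ :=
  sInf {j : ℕ∞ | ∃ k : ℕ, j = k ∧ hitTime θ F s x k = hitTime θ F s x (k + 1)}

/-- `σ^s_x(∞)`, the limit of the non-decreasing sequence `σ^s_x(k)`. -/
noncomputable def hitTimeLimit (θ : ℝ → ℝ → M → M) (F : Set (ℝ × M)) (s : ℝ) (x : M) : EReal :=
  ⨆ k : ℕ, hitTime θ F s x k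

open Classical in
/-- The family `ψ` obtained from `θ` by restarting it at the hitting times of `F`. For
`s ≤ t < σ^s_x(∞)` there is exactly one `k` with `σ^s_x(k) ≤ t < σ^s_x(k+1)`, and the infimum in
the first case is this `k`. -/
noncomputable def restart (θ : ℝ → ℝ → M → M) (F : Set (ℝ × M)) (s t : ℝ) (x : M) : M :=
  if (t : EReal) < hitTimeLimit θ F s x then
    let k := sInf {k : ℕ | hitTime θ F s x k ≤ (t : EReal) ∧ (t : EReal) < hitTime θ F s x (k + 1)}
    θ (hitTime θ F s x k).toReal t (hitPoint θ F s x k)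
  else if hitCount θ F s x < ⊤ then
    let k := (hitCount θ F s x).toNat
    θ (hitTime θ F s x k).toReal t (hitPoint θ F s x k)
  else x

end Restart

/-! ### The functions `ε_k` -/

/-- The Borel σ-field of `C([0,∞), M ^ n)`. -/
instance instMeasurableSpaceContinuousMapNNReal (M : Type*) [TopologicalSpace M] (n : ℕ) :
    MeasurableSpace C(ℝ≥0, Fin n → M) := borel C(ℝ≥0, Fin n → M)

/-- Under `Q`, the canonical process on `C([0,∞), M ^ n)` is a Markov process (with respect to its
natural filtration) with transition function `P` and starting point `x`. -/
structure IsMarkovLaw {M : Type*} [TopologicalSpace M] [MeasurableSpace M] {n : ℕ}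
    (P : ℝ≥0 → Kernel (Fin n → M) (Fin n → M)) (x : Fin n → M)
    (Q : Measure C(ℝ≥0, Fin n → M)) : Prop where
  prob : IsProbabilityMeasure Q
  init : ∀ᵐ w ∂Q, w 0 = x
  markov : ∀ (s t : ℝ≥0) (A : Set (Fin n → M)) (B : Set C(ℝ≥0, Fin n → M)), MeasurableSet A →
    MeasurableSet[⨆ u : Iic s,
      MeasurableSpace.comap (fun w : C(ℝ≥0, Fin n → M) => w (u : ℝ≥0)) inferInstance] B →
    Q (B ∩ {w | w (s + t) ∈ A}) = ∫⁻ w in B, P t (w s) A ∂Q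

open Classical in
/-- The law `P⁽ⁿ⁾_x` on `C([0,∞), M ^ n)` of the Markov process with transition function `P` and
starting point `x`: the unique measure which satisfies `IsMarkovLaw P x` (and the zero measure if
there is none). -/
noncomputable def markovLaw {M : Type*} [TopologicalSpace M] [MeasurableSpace M] {n : ℕ}
    (P : ℝ≥0 → Kernel (Fin n → M) (Fin n → M)) (x : Fin n → M) : Measure C(ℝ≥0, Fin n → M) :=
  if h : ∃ Q, IsMarkovLaw P x Q then h.choose else 0

/-- `d` is a distance on `C(ℝ, M)` which induces the topology of uniform convergence on compact
sets. -/
def MetrizesPaths {M : Type*} [TopologicalSpace M] (d : C(ℝ, M) → C(ℝ, M) → ℝ) : Prop :=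
  ∃ m : MetricSpace C(ℝ, M),
    m.toUniformSpace.toTopologicalSpace = ContinuousMap.compactOpen ∧ ∀ f g, m.dist f g = d f g

/-- The extension to `ℝ` of the `j`-th coordinate of a path `w : [0,∞) → M ^ n`. -/
def coordExt {M : Type*} [TopologicalSpace M] {n : ℕ} (j : Fin n) (w : C(ℝ≥0, Fin n → M)) :
    C(ℝ, M) :=
  ⟨fun t => w t.toNNReal j, by fun_prop⟩

/-- `ε_k(x) = 2⁻ᵏ ∧ inf {r > 0 : sup_{y ∈ B̄(x,r)} P⁽²⁾_{(x,y)}[d₀(X,Y) ≥ 2⁻ᵏ] > 2⁻ᵏ}`, where the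
infimum of the empty set is `∞` and `d₀` is the distance induced by `d` on `C([0,∞), M)`. -/
noncomputable def eps {M : Type*} [MetricSpace M] [MeasurableSpace M]
    (P : (n : ℕ) → ℝ≥0 → Kernel (Fin n → M) (Fin n → M)) (d : C(ℝ, M) → C(ℝ, M) → ℝ)
    (k : ℕ) (x : M) : ℝ :=
  (min ((2 : ℝ≥0∞)⁻¹ ^ k)
    (sInf {a : ℝ≥0∞ | ∃ r : ℝ, a = ENNReal.ofReal r ∧ 0 < r ∧
      (2 : ℝ≥0∞)⁻¹ ^ k < ⨆ y ∈ Metric.closedBall x r,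
        markovLaw (P 2) ![x, y] {w | (2 : ℝ)⁻¹ ^ k ≤ d (coordExt 0 w) (coordExt 1 w)}})).toReal

/-! ### The random sequence `Φ` -/

/-- `Φ n` is a continuous modification of `ψ_{s_n,·}(x_n)` with `Φ n (s_n) = x_n`, where
`(s_n, x_n) = D n`. -/
structure IsContinuousVersion {M Ω : Type*} [TopologicalSpace M] [MeasurableSpace M]
    [MeasurableSpace Ω] (μ : Measure Ω) (ψ : ℝ → ℝ → Ω → MeasMap M) (D : ℕ → ℝ × M)
    (Φ : ℕ → Ω → PathSpace M) : Prop where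
  measurable : ∀ n, Measurable (Φ n)
  start_eq : ∀ n ω, start (Φ n ω) = (D n).1
  val_start : ∀ n ω, val (Φ n ω) (D n).1 = (D n).2
  modification : ∀ n t, (D n).1 ≤ t → ∀ᵐ ω ∂μ, val (Φ n ω) t = (ψ (D n).1 t ω).1 (D n).2

end StrongFlow

open StrongFlow

/-!
The restarted family `ψ` is a flow for pathwise reasons and a modification of `ψ₀` for probabilistic
reasons; the two parts only share the extension `θ` of the skeleton.

*Flow property and continuity* (`IsRestartable`). Fix a realization of the skeleton. Any path
`θ_{s,·}(x)` is, from each later time `t` on, one of the limit paths in `limitPaths φ t r z` which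
emanate from its position `z` at time `t`. If `(t, z)` is not a bifurcation point, then for `r` close
to `t` there is only one such limit path, so that two paths of `θ` which meet outside of `F` stay
together for a positive time, hence up to the next visit to `F`. Thus `θ` has the flow property
between consecutive hitting times of `F`, and `restart` concatenates these pieces. After finitely
many pieces either the hitting times exceed any given time, or two consecutive ones coincide. In the
second case the hypothesis on points with `hitCount = 0` says that the path of `θ` immediately joins
a path of the skeleton. Along the latter `θ` follows the skeleton (`IsSkeleton.theta_val`), and
therefore so does every restart of `θ`.

*Modification* (`ae_restart_eq`). The skeleton property provides enough compactness to construct a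
continuous version `Z` of `ψ₀_{s,·}(x)` for every `(s, x)`, as an almost sure limit of paths of the
skeleton (`exists_version`). Since the increments of `ψ₀` are independent, pairs of such versions are
Markov processes with transition function `P 2`, and their laws are the measures `markovLaw (P 2)` in
the definition of `ε_k`; this yields positivity and measurability of `ε_k`. The Markov property
passes to optional times `T` by approximation with discrete times. Conditionally on the past at `T`,
the path of the skeleton with index `n^{T,Z(T)}_k` is at distance at least `2⁻ᵏ` from `Z` after time
`T` with probability at most `2⁻ᵏ`, by the choice of `ε_k`. By the Borel–Cantelli lemma these paths
converge to `Z`, so that `θ` follows `Z` after time `T` almost surely (`ae_theta_eq_of_optional`).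
Applied to the successive hitting times of `F` by `Z`, this identifies `restart` along `Z` with `Z`
itself.

*Measurability*. Hitting times of a closed set by a path depend measurably on the path, since meeting
a closed set during a compact interval can be tested at rational times (`exists_mem_Icc_iff`).
-/


namespace StrongFlow

/-! ### Functions vanishing at infinity -/

section ZeroAtInfty

variable {E : Type*} [MetricSpace E] [ProperSpace E]

/-- A continuous function which vanishes outside a ball, as an element of `C₀`. -/
def zeroAtInftyOfBounded (f : E → ℝ) (hf : Continuous f) (z : E) (R : ℝ)
    (h : ∀ x, R < dist x z → f x = 0) : C₀(E, ℝ) where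
  toFun := f
  continuous_toFun := hf
  zero_at_infty' := by
    refine tendsto_const_nhds.congr' ?_
    filter_upwards [(isCompact_closedBall z R).compl_mem_cocompact] with x hx
    exact (h x (by simpa using hx)).symm

/-- The product of an element of `C₀` with a bounded continuous function. -/
def zeroAtInftyMul (f : C₀(E, ℝ)) (g : E → ℝ) (hg : Continuous g) (C : ℝ) (hC : ∀ x, |g x| ≤ C) :
    C₀(E, ℝ) where
  toFun x := f x * g x
  continuous_toFun := f.continuous.mul hg
  zero_at_infty' := by
    have h := f.zero_at_infty'.zero_mul_isBoundedUnder_le (g := g)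
      ⟨C, by simpa using Eventually.of_forall hC⟩
    exact h

lemma abs_zeroAtInfty_le {E : Type*} [TopologicalSpace E] (f : C₀(E, ℝ)) (x : E) :
    |f x| ≤ ‖f.toBCF‖ :=
  f.toBCF.norm_coe_le_norm x

/-- A bump function at `x`, supported in the ball of radius `r`. -/
lemma exists_bump (x : E) {r : ℝ} (hr : 0 < r) :
    ∃ f : C₀(E, ℝ), f x = 1 ∧ (∀ y, 0 ≤ f y ∧ f y ≤ 1) ∧ ∀ y, r ≤ dist y x → f y = 0 := by
  refine ⟨zeroAtInftyOfBounded (fun y => max 0 (1 - dist y x / r)) (by fun_prop) x r ?_,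
    ?_, ?_, ?_⟩
  · intro y hy
    have : 1 < dist y x / r := (one_lt_div hr).2 hy
    exact max_eq_left (by linarith)
  · simp [zeroAtInftyOfBounded]
  · intro y
    have : 0 ≤ dist y x / r := by positivity
    exact ⟨le_max_left _ _, max_le zero_le_one (by linarith)⟩
  · intro y hy
    have : 1 ≤ dist y x / r := (one_le_div hr).2 hy
    exact max_eq_left (by linarith)

/-- A plateau function: equal to `1` on the ball of radius `R`, supported in that of radius
`R + 1`. -/
lemma exists_plateau (z : E) (R : ℝ) :
    ∃ f : C₀(E, ℝ), (∀ y, 0 ≤ f y ∧ f y ≤ 1) ∧ (∀ y, dist y z ≤ R → f y = 1) ∧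
      ∀ y, R + 1 < dist y z → f y = 0 := by
  refine ⟨zeroAtInftyOfBounded (fun y => max 0 (min 1 (R + 1 - dist y z))) (by fun_prop) z (R + 1)
    ?_, ?_, ?_, ?_⟩
  · intro y hy
    exact max_eq_left ((min_le_right _ _).trans (by linarith))
  · intro y
    exact ⟨le_max_left _ _, max_le zero_le_one (min_le_left _ _)⟩
  · intro y hy
    change max 0 (min 1 (R + 1 - dist y z)) = 1
    rw [min_eq_left (by linarith), max_eq_right zero_le_one]
  · intro y hy
    exact max_eq_left ((min_le_right _ _).trans (by linarith))

/-- The indicator of a closed set is a pointwise limit of functions in `C₀` with values in `[0,1]`: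
approximations from outside are cut off by plateau functions. -/
lemma exists_zeroAtInfty_tendsto_indicator {C : Set E} (hC : IsClosed C) :
    ∃ f : ℕ → C₀(E, ℝ), (∀ m z, 0 ≤ f m z ∧ f m z ≤ 1) ∧
      ∀ z, Tendsto (fun m => f m z) atTop (𝓝 (C.indicator (fun _ => (1 : ℝ)) z)) := by
  rcases isEmpty_or_nonempty E with hE | ⟨⟨z₀⟩⟩
  · exact ⟨fun _ => 0, fun _ z => (hE.false z).elim, fun z => (hE.false z).elim⟩
  choose p hp01 hp1 hp0 using fun m : ℕ => exists_plateau z₀ (m : ℝ)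
  have ha1 : ∀ m z, ((hC.apprSeq m z : ℝ≥0) : ℝ) ≤ 1 := fun m z => by
    exact_mod_cast HasOuterApproxClosed.apprSeq_apply_le_one hC m z
  refine ⟨fun m => zeroAtInftyMul (p m) (fun z => (hC.apprSeq m z : ℝ)) (by fun_prop) 1
    (fun z => ?_), fun m z => ?_, fun z => ?_⟩
  · rw [abs_of_nonneg (by positivity)]; exact ha1 m z
  · exact ⟨mul_nonneg (hp01 m z).1 (by positivity),
      mul_le_one₀ (hp01 m z).2 (by positivity) (ha1 m z)⟩
  · have h1 : Tendsto (fun m => ((hC.apprSeq m z : ℝ≥0) : ℝ)) atTop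
        (𝓝 (C.indicator (fun _ => (1 : ℝ)) z)) := by
      have := tendsto_pi_nhds.1 (HasOuterApproxClosed.tendsto_apprSeq hC) z
      have h2 := (NNReal.continuous_coe.tendsto _).comp this
      have h3 : C.indicator (fun _ => (1 : ℝ)) z =
          ((C.indicator (fun _ => (1 : ℝ≥0)) z : ℝ≥0) : ℝ) := by
        by_cases hz : z ∈ C
        · rw [indicator_of_mem hz, indicator_of_mem hz]; rfl
        · rw [indicator_of_notMem hz, indicator_of_notMem hz]; rfl
      rw [h3]
      exact h2
    refine h1.congr' ?_
    filter_upwards [eventually_ge_atTop ⌈dist z z₀⌉₊] with m hm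
    change _ = p m z * _
    rw [hp1 m z (Nat.ceil_le.1 hm), one_mul]

lemma measure_ext_zeroAtInfty [MeasurableSpace E] [BorelSpace E] {μ ν : Measure E}
    [IsFiniteMeasure μ] [IsFiniteMeasure ν] (h : ∀ f : C₀(E, ℝ), ∫ x, f x ∂μ = ∫ x, f x ∂ν) :
    μ = ν := by
  refine Measure.ext_of_integral_eq_on_compactlySupported fun f => ?_
  exact h ⟨f.toContinuousMap, f.hasCompactSupport.is_zero_at_infty⟩

lemma integrable_zeroAtInfty {E : Type*} [TopologicalSpace E] [MeasurableSpace E]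
    [OpensMeasurableSpace E] {μ : Measure E} [IsFiniteMeasure μ] (f : C₀(E, ℝ)) : Integrable f μ :=
  f.toBCF.integrable μ

end ZeroAtInfty

/-! ### Spaces of continuous maps -/

section ContinuousMaps

/-- The Borel σ-field of the compact-open topology is generated by the evaluations. A continuous
function maps the compact set `K` into the open set `U` if and only if its values on a countable dense
subset of `K` stay away from the complement of `U`. -/
lemma borel_continuousMap_eq_iSup {X Y : Type*} [TopologicalSpace X] [SecondCountableTopology X]
    [LocallyCompactSpace X] [T2Space X] [MetricSpace Y] [SecondCountableTopology Y]
    [MeasurableSpace Y] [BorelSpace Y] :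
    borel C(X, Y) = ⨆ x : X, MeasurableSpace.comap (fun f : C(X, Y) => f x) inferInstance := by
  apply le_antisymm
  · rw [borel_eq_generateFrom_of_subbasis (ContinuousMap.compactOpen_eq (X := X) (Y := Y))]
    refine MeasurableSpace.generateFrom_le ?_
    rintro _ ⟨K, hK, U, hU, rfl⟩
    have hev : ∀ x : X, Measurable[⨆ x : X,
        MeasurableSpace.comap (fun f : C(X, Y) => f x) inferInstance] fun f : C(X, Y) => f x :=
      fun x => (comap_measurable _).mono (le_iSup (fun x : X =>
        MeasurableSpace.comap (fun f : C(X, Y) => f x) inferInstance) x) le_rfl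
    rcases K.eq_empty_or_nonempty with rfl | hKne
    · simp [MapsTo]
    by_cases hUu : U = univ
    · subst hUu; simp [MapsTo]
    have hUc : (Uᶜ).Nonempty := by rwa [nonempty_compl]
    have : Nonempty K := hKne.to_subtype
    have hpos : ∀ y ∈ U, 0 < Metric.infDist y Uᶜ := fun y hy =>
      ((IsOpen.isClosed_compl hU).notMem_iff_infDist_pos hUc).1 (by simpa using hy)
    have hset : {f : C(X, Y) | MapsTo f K U} = ⋃ n : ℕ, ⋂ i : ℕ,
        {f : C(X, Y) | 1 / ((n : ℝ) + 1) ≤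
          Metric.infDist (f (TopologicalSpace.denseSeq K i : X)) Uᶜ} := by
      ext f
      simp only [mem_iUnion, mem_iInter]
      constructor
      · intro hf
        obtain ⟨x, hxK, hx⟩ := IsCompact.exists_isMinOn hK hKne
          (f := fun x => Metric.infDist (f x) Uᶜ) (by fun_prop)
        obtain ⟨n, hn⟩ := exists_nat_one_div_lt (hpos _ (hf hxK))
        exact ⟨n, fun i => hn.le.trans (hx (TopologicalSpace.denseSeq K i).2)⟩
      · rintro ⟨n, hn⟩ x hx
        by_contra hxU
        have hcl : IsClosed {y : K | 1 / ((n : ℝ) + 1) ≤ Metric.infDist (f y) Uᶜ} :=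
          isClosed_le continuous_const (by fun_prop)
        have := hcl.closure_subset_iff.2 (range_subset_iff.2 hn)
          ((TopologicalSpace.denseRange_denseSeq K) ⟨x, hx⟩)
        have h0 : Metric.infDist (f x) Uᶜ = 0 := Metric.infDist_zero_of_mem hxU
        have h1 : 1 / ((n : ℝ) + 1) ≤ Metric.infDist (f x) Uᶜ := this
        have : 0 < 1 / ((n : ℝ) + 1) := by positivity
        linarith
    change MeasurableSet[⨆ x : X, MeasurableSpace.comap (fun f : C(X, Y) => f x) inferInstance]
      {f : C(X, Y) | MapsTo f K U}
    rw [hset]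
    refine MeasurableSet.iUnion fun n => MeasurableSet.iInter fun i => ?_
    exact hev _ (isClosed_le continuous_const (Metric.continuous_infDist_pt Uᶜ)).measurableSet
  · refine iSup_le fun x => ?_
    rintro _ ⟨s, hs, rfl⟩
    have hc : Continuous fun f : C(X, Y) => f x := by fun_prop
    let : MeasurableSpace C(X, Y) := borel _
    have : BorelSpace C(X, Y) := ⟨rfl⟩
    exact hc.measurable hs

variable {M : Type*} [MetricSpace M] [ProperSpace M] [MeasurableSpace M] [BorelSpace M]

instance (n : ℕ) : BorelSpace C(ℝ≥0, Fin n → M) := ⟨rfl⟩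

lemma measurable_continuousMap_iff {n : ℕ} {Ω : Type*} {m : MeasurableSpace Ω}
    {f : Ω → C(ℝ≥0, Fin n → M)} : Measurable f ↔ ∀ t, Measurable fun ω => f ω t := by
  have h : instMeasurableSpaceContinuousMapNNReal M n = ⨆ t : ℝ≥0,
      MeasurableSpace.comap (fun f : C(ℝ≥0, Fin n → M) => f t) inferInstance :=
    borel_continuousMap_eq_iSup
  rw [measurable_iff_comap_le, h, MeasurableSpace.comap_iSup, iSup_le_iff]
  refine forall_congr' fun t => ?_
  rw [MeasurableSpace.comap_comp, measurable_iff_comap_le]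
  rfl

lemma measurable_eval_path {n : ℕ} (t : ℝ≥0) : Measurable fun w : C(ℝ≥0, Fin n → M) => w t :=
  measurable_continuousMap_iff.1 measurable_id t

/-- The closed cylinders in `C([0,∞), M ^ n)`. -/
def closedCylinders (M : Type*) [TopologicalSpace M] (n : ℕ) : Set (Set C(ℝ≥0, Fin n → M)) :=
  {S | ∃ (I : Finset ℝ≥0) (C : ℝ≥0 → Set (Fin n → M)), (∀ t, IsClosed (C t)) ∧
    S = {w | ∀ t ∈ I, w t ∈ C t}}

lemma isPiSystem_closedCylinders (M : Type*) [TopologicalSpace M] (n : ℕ) :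
    IsPiSystem (closedCylinders M n) := by
  classical
  rintro _ ⟨I, C, hC, rfl⟩ _ ⟨J, D, hD, rfl⟩ -
  refine ⟨I ∪ J, fun t => (if t ∈ I then C t else univ) ∩ (if t ∈ J then D t else univ),
    fun t => ?_, ?_⟩
  · refine IsClosed.inter ?_ ?_ <;> split_ifs <;> simp [hC, hD]
  · ext w
    simp only [mem_inter_iff, mem_ofPred_eq, Finset.mem_union]
    constructor
    · rintro ⟨h1, h2⟩ t -
      constructor <;> split_ifs with ht <;> simp_all
    · intro h
      constructor
      · intro t ht
        simpa [ht] using (h t (Or.inl ht)).1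
      · intro t ht
        simpa [ht] using (h t (Or.inr ht)).2

lemma generateFrom_closedCylinders (n : ℕ) :
    instMeasurableSpaceContinuousMapNNReal M n =
      MeasurableSpace.generateFrom (closedCylinders M n) := by
  apply le_antisymm
  · have h : instMeasurableSpaceContinuousMapNNReal M n = ⨆ t : ℝ≥0,
      MeasurableSpace.comap (fun f : C(ℝ≥0, Fin n → M) => f t) inferInstance :=
      borel_continuousMap_eq_iSup
    rw [h, iSup_le_iff]
    intro t
    have : (inferInstance : MeasurableSpace (Fin n → M)) =
        MeasurableSpace.generateFrom {s | IsClosed s} := by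
      rw [← borel_eq_generateFrom_isClosed]; exact BorelSpace.measurable_eq
    rw [this, MeasurableSpace.comap_generateFrom]
    refine MeasurableSpace.generateFrom_mono ?_
    rintro _ ⟨C, hC, rfl⟩
    exact ⟨{t}, fun _ => C, fun _ => hC, by ext; simp⟩
  · refine MeasurableSpace.generateFrom_le ?_
    rintro _ ⟨I, C, hC, rfl⟩
    have : {w : C(ℝ≥0, Fin n → M) | ∀ t ∈ I, w t ∈ C t} = ⋂ t ∈ I, (fun w => w t) ⁻¹' C t := by
      ext; simp
    rw [this]
    exact Finset.measurableSet_biInter _ fun t _ => measurable_eval_path t (hC t).measurableSet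

/-- The indicator of a closed cylinder is a bounded pointwise limit of products of functions in
`C₀`. -/
lemma exists_tendsto_prod_indicator {M : Type*} [MetricSpace M] [ProperSpace M] {n : ℕ}
    (I : Finset ℝ≥0) {C : ℝ≥0 → Set (Fin n → M)} (hC : ∀ t, IsClosed (C t)) :
    ∃ f : ℕ → ℝ≥0 → C₀(Fin n → M, ℝ), (∀ m (w : C(ℝ≥0, Fin n → M)), |∏ t ∈ I, f m t (w t)| ≤ 1) ∧
      ∀ w : C(ℝ≥0, Fin n → M), Tendsto (fun m => ∏ t ∈ I, f m t (w t)) atTop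
        (𝓝 ({w : C(ℝ≥0, Fin n → M) | ∀ t ∈ I, w t ∈ C t}.indicator (fun _ => (1 : ℝ)) w)) := by
  choose f hf01 hf using fun t => exists_zeroAtInfty_tendsto_indicator (hC t)
  refine ⟨fun m t => f t m, fun m w => ?_, fun w => ?_⟩
  · rw [Finset.abs_prod]
    refine Finset.prod_le_one (fun _ _ => abs_nonneg _) fun t _ => ?_
    rw [abs_of_nonneg (hf01 t m _).1]
    exact (hf01 t m _).2
  · have h := tendsto_finsetProd I fun t _ => hf t (w t)
    convert h using 2
    by_cases hw : ∀ t ∈ I, w t ∈ C t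
    · rw [indicator_of_mem (by exact hw)]
      exact (Finset.prod_eq_one fun t ht => indicator_of_mem (hw t ht) _).symm
    · rw [indicator_of_notMem (by exact hw)]
      push Not at hw
      obtain ⟨t, ht, hwt⟩ := hw
      exact (Finset.prod_eq_zero ht (indicator_of_notMem hwt _)).symm

end ContinuousMaps

/-! ### Finite-dimensional distributions of Markov measures -/

/-- An equality of integrals over all sets of a σ-field extends to bounded measurable weights. -/
lemma integral_mul_eq_of_forall_setIntegral_eq {Ω : Type*} {m m₀ : MeasurableSpace Ω}
    {μ : Measure[m₀] Ω} [IsFiniteMeasure μ] (hm : m ≤ m₀) {X Y g : Ω → ℝ} (hX : Integrable X μ)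
    (hY : Integrable Y μ) (hYm : StronglyMeasurable[m] Y)
    (h : ∀ B, MeasurableSet[m] B → ∫ ω in B, X ω ∂μ = ∫ ω in B, Y ω ∂μ)
    (hg : StronglyMeasurable[m] g) {C : ℝ} (hgC : ∀ ω, |g ω| ≤ C) :
    ∫ ω, g ω * X ω ∂μ = ∫ ω, g ω * Y ω ∂μ := by
  have h1 : Y =ᵐ[μ] μ[X | m] := ae_eq_condExp_of_forall_setIntegral_eq hm hX
    (fun _ _ _ => hY.integrableOn) (fun B hB _ => (h B hB).symm) hYm.aestronglyMeasurable
  have h2 : μ[g * X | m] =ᵐ[μ] g * μ[X | m] :=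
    condExp_stronglyMeasurable_mul_of_bound hm hg hX C (Eventually.of_forall hgC)
  calc ∫ ω, g ω * X ω ∂μ = ∫ ω, (μ[g * X | m]) ω ∂μ := (integral_condExp hm).symm
    _ = ∫ ω, g ω * Y ω ∂μ := by
      refine integral_congr_ae ?_
      filter_upwards [h1, h2] with ω e1 e2
      rw [e2, Pi.mul_apply, e1]

section FDD

variable {M : Type*} [MetricSpace M] [ProperSpace M] [MeasurableSpace M] [BorelSpace M] {n : ℕ}
  {P : ℝ≥0 → Kernel (Fin n → M) (Fin n → M)}

/-- The σ-field generated by the evaluations at the times `v ≤ u`. -/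
abbrev canonicalSigma (M : Type*) [TopologicalSpace M] [MeasurableSpace M] (n : ℕ) (u : ℝ≥0) :
    MeasurableSpace C(ℝ≥0, Fin n → M) :=
  ⨆ v : Iic u, MeasurableSpace.comap (fun w : C(ℝ≥0, Fin n → M) => w (v : ℝ≥0)) inferInstance

lemma canonicalSigma_le (u : ℝ≥0) :
    canonicalSigma M n u ≤ instMeasurableSpaceContinuousMapNNReal M n :=
  iSup_le fun v => (measurable_eval_path (v : ℝ≥0)).comap_le

lemma measurable_eval_canonicalSigma {M : Type*} [MetricSpace M] [MeasurableSpace M] {n : ℕ}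
    {u v : ℝ≥0} (h : v ≤ u) :
    Measurable[canonicalSigma M n u] fun w : C(ℝ≥0, Fin n → M) => w v :=
  (comap_measurable _).mono (le_iSup (fun v : Iic u =>
    MeasurableSpace.comap (fun w : C(ℝ≥0, Fin n → M) => w (v : ℝ≥0)) inferInstance) ⟨v, h⟩) le_rfl

lemma measurable_canonicalSigma_iff {M : Type*} [MetricSpace M] [MeasurableSpace M] {n : ℕ}
    {Ω : Type*} {m : MeasurableSpace Ω} {u : ℝ≥0}
    {f : Ω → C(ℝ≥0, Fin n → M)} :
    Measurable[m, canonicalSigma M n u] f ↔ ∀ v ≤ u, Measurable fun ω => f ω v := by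
  rw [measurable_iff_comap_le, canonicalSigma, MeasurableSpace.comap_iSup, iSup_le_iff]
  simp only [MeasurableSpace.comap_comp, Subtype.forall, mem_Iic, measurable_iff_comap_le]
  rfl

/-- The Markov property with transition function `P`, for a measure on the canonical space, tested
on functions in `C₀`. The initial distribution and the total mass are arbitrary. -/
def IsMarkovMeasure (P : ℝ≥0 → Kernel (Fin n → M) (Fin n → M))
    (ν : Measure C(ℝ≥0, Fin n → M)) : Prop :=
  ∀ (u h : ℝ≥0) (F : C₀(Fin n → M, ℝ)) (B : Set C(ℝ≥0, Fin n → M)),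
    MeasurableSet[canonicalSigma M n u] B →
      ∫ w in B, F (w (u + h)) ∂ν = ∫ w in B, ∫ z, F z ∂(P h (w u)) ∂ν

lemma integrable_zeroAtInfty_comp {Ω E : Type*} [MeasurableSpace Ω] {μ : Measure Ω}
    [IsFiniteMeasure μ] [TopologicalSpace E] [MeasurableSpace E] [BorelSpace E]
    (F : C₀(E, ℝ)) {X : Ω → E} (hX : Measurable X) : Integrable (fun ω => F (X ω)) μ :=
  Integrable.of_bound (F.continuous.measurable.comp hX).aestronglyMeasurable ‖F.toBCF‖
    (Eventually.of_forall fun ω => by simpa using abs_zeroAtInfty_le F (X ω))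

/-- For a Feller transition function, the expectation of `∏ f_t(w t)` under a Markov measure is the
integral of a bounded continuous function, depending on `f` only, against the initial law. -/
lemma exists_fdd (hP : IsFellerTransition P) (I : Finset ℝ≥0) :
    ∀ f : ℝ≥0 → C₀(Fin n → M, ℝ), ∃ g : (Fin n → M) → ℝ, Continuous g ∧
      (∃ C, ∀ z, |g z| ≤ C) ∧ ∀ ν : Measure C(ℝ≥0, Fin n → M), IsFiniteMeasure ν →
        IsMarkovMeasure P ν → ∫ w, ∏ t ∈ I, f t (w t) ∂ν = ∫ w, g (w 0) ∂ν := by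
  induction I using Finset.induction_on_max with
  | empty =>
    exact fun f => ⟨fun _ => 1, continuous_const, ⟨1, by simp⟩, fun ν _ _ => by simp⟩
  | insert a s has ih =>
    intro f
    rcases s.eq_empty_or_nonempty with rfl | hs
    · obtain ⟨G, hG⟩ := hP.map_zeroAtInfty a (f a)
      refine ⟨G, G.continuous, ⟨_, abs_zeroAtInfty_le G⟩, fun ν _ hν => ?_⟩
      have := hν 0 a (f a) univ MeasurableSet.univ
      simpa [hG] using this
    -- by the Markov property at the last time of `s`, the factor at the time `a` may be replaced by a
    -- function of the position at that time
    · obtain ⟨G, hG⟩ := hP.map_zeroAtInfty (a - s.max' hs) (f a)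
      obtain ⟨g, hgc, hgb, hg⟩ := ih (Function.update f (s.max' hs) (f (s.max' hs) * G))
      refine ⟨g, hgc, hgb, fun ν hνf hν => ?_⟩
      rw [← hg ν hνf hν]
      have ha : a ∉ s := fun h => (has a h).false
      have hma : s.max' hs + (a - s.max' hs) = a :=
        add_tsub_cancel_of_le (has _ (s.max'_mem hs)).le
      have hw : StronglyMeasurable[canonicalSigma M n (s.max' hs)]
          fun w : C(ℝ≥0, Fin n → M) => ∏ t ∈ s, f t (w t) :=
        (Finset.measurable_fun_prod _ fun t ht => (f t).continuous.measurable.comp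
          (measurable_eval_canonicalSigma (s.le_max' t ht))).stronglyMeasurable
      have hb : ∀ w : C(ℝ≥0, Fin n → M), |∏ t ∈ s, f t (w t)| ≤ ∏ t ∈ s, ‖(f t).toBCF‖ :=
        fun w => by
          rw [Finset.abs_prod]
          exact Finset.prod_le_prod (fun _ _ => abs_nonneg _) fun t _ => abs_zeroAtInfty_le _ _
      have key := integral_mul_eq_of_forall_setIntegral_eq (canonicalSigma_le (s.max' hs))
        (X := fun w : C(ℝ≥0, Fin n → M) => f a (w a)) (Y := fun w => G (w (s.max' hs)))
        (integrable_zeroAtInfty_comp (μ := ν) _ (measurable_eval_path _))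
        (integrable_zeroAtInfty_comp (μ := ν) _ (measurable_eval_path _))
        (G.continuous.measurable.comp (measurable_eval_canonicalSigma le_rfl)).stronglyMeasurable
        (fun B hB => by
          have := hν (s.max' hs) (a - s.max' hs) (f a) B hB
          simpa only [hma, hG] using this) hw hb
      calc ∫ w, ∏ t ∈ insert a s, f t (w t) ∂ν = ∫ w, (∏ t ∈ s, f t (w t)) * f a (w a) ∂ν := by
            simp only [Finset.prod_insert ha, mul_comm]
        _ = ∫ w, (∏ t ∈ s, f t (w t)) * G (w (s.max' hs)) ∂ν := key
        _ = _ := by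
          congr 1 with w
          rw [← Finset.mul_prod_erase s _ (s.max'_mem hs), ← Finset.mul_prod_erase s
            (fun t => (Function.update f (s.max' hs) (f (s.max' hs) * G)) t (w t)) (s.max'_mem hs)]
          have : ∏ t ∈ s.erase (s.max' hs),
              (Function.update f (s.max' hs) (f (s.max' hs) * G)) t (w t) =
              ∏ t ∈ s.erase (s.max' hs), f t (w t) :=
            Finset.prod_congr rfl fun t ht => by
              rw [Function.update_of_ne (Finset.ne_of_mem_erase ht)]
          rw [this, Function.update_self, ZeroAtInftyContinuousMap.mul_apply]
          ring

/-- The function of the starting point which gives the expectation of `∏ f_t(w t)` under the Markov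
measures with transition function `P`. -/
noncomputable def fdd (hP : IsFellerTransition P) (I : Finset ℝ≥0)
    (f : ℝ≥0 → C₀(Fin n → M, ℝ)) : (Fin n → M) → ℝ :=
  (exists_fdd hP I f).choose

lemma continuous_fdd (hP : IsFellerTransition P) (I : Finset ℝ≥0)
    (f : ℝ≥0 → C₀(Fin n → M, ℝ)) : Continuous (fdd hP I f) :=
  (exists_fdd hP I f).choose_spec.1

lemma exists_abs_fdd_le (hP : IsFellerTransition P) (I : Finset ℝ≥0)
    (f : ℝ≥0 → C₀(Fin n → M, ℝ)) : ∃ C, ∀ z, |fdd hP I f z| ≤ C :=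
  (exists_fdd hP I f).choose_spec.2.1

/-- `ν` has the finite-dimensional distributions of a Markov measure with transition function
`P`. In contrast to the Markov property, this is evidently stable under limits. -/
def HasFDD (hP : IsFellerTransition P) (ν : Measure C(ℝ≥0, Fin n → M)) : Prop :=
  ∀ (I : Finset ℝ≥0) (f : ℝ≥0 → C₀(Fin n → M, ℝ)),
    ∫ w, ∏ t ∈ I, f t (w t) ∂ν = ∫ w, fdd hP I f (w 0) ∂ν

lemma IsMarkovMeasure.hasFDD {ν : Measure C(ℝ≥0, Fin n → M)} [IsFiniteMeasure ν]
    (hP : IsFellerTransition P) (hν : IsMarkovMeasure P ν) : HasFDD hP ν :=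
  fun I f => (exists_fdd hP I f).choose_spec.2.2 ν inferInstance hν

lemma measurableSet_closedCylinder (I : Finset ℝ≥0) {C : ℝ≥0 → Set (Fin n → M)}
    (hC : ∀ t, IsClosed (C t)) : MeasurableSet {w : C(ℝ≥0, Fin n → M) | ∀ t ∈ I, w t ∈ C t} := by
  rw [generateFrom_closedCylinders n]
  exact MeasurableSpace.measurableSet_generateFrom ⟨I, C, hC, rfl⟩

lemma tendsto_integral_prod {I : Finset ℝ≥0} {C : ℝ≥0 → Set (Fin n → M)}
    (hC : ∀ t, IsClosed (C t)) {f : ℕ → ℝ≥0 → C₀(Fin n → M, ℝ)}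
    (hf1 : ∀ m (w : C(ℝ≥0, Fin n → M)), |∏ t ∈ I, f m t (w t)| ≤ 1)
    (hf : ∀ w : C(ℝ≥0, Fin n → M), Tendsto (fun m => ∏ t ∈ I, f m t (w t)) atTop
        (𝓝 ({w : C(ℝ≥0, Fin n → M) | ∀ t ∈ I, w t ∈ C t}.indicator (fun _ => (1 : ℝ)) w)))
    (ν : Measure C(ℝ≥0, Fin n → M)) [IsFiniteMeasure ν] :
    Tendsto (fun m => ∫ w, ∏ t ∈ I, f m t (w t) ∂ν) atTop
      (𝓝 (ν.real {w : C(ℝ≥0, Fin n → M) | ∀ t ∈ I, w t ∈ C t})) := by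
  have h := tendsto_integral_of_dominated_convergence (μ := ν) (fun _ => (1 : ℝ))
    (F := fun m (w : C(ℝ≥0, Fin n → M)) => ∏ t ∈ I, f m t (w t))
    (fun m => (Finset.measurable_fun_prod _ fun t _ =>
      (f m t).continuous.measurable.comp (measurable_eval_path t)).aestronglyMeasurable)
    (integrable_const _)
    (fun m => Eventually.of_forall fun w => (Real.norm_eq_abs _).trans_le (hf1 m w))
    (Eventually.of_forall hf)
  rwa [integral_indicator_const _ (measurableSet_closedCylinder I hC), smul_eq_mul, mul_one] at h

/-- Measures on the canonical space with the same initial law and Markovian finite-dimensional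
distributions coincide. -/
lemma HasFDD.ext {hP : IsFellerTransition P} {ν ν' : Measure C(ℝ≥0, Fin n → M)}
    [IsProbabilityMeasure ν] [IsProbabilityMeasure ν'] (hν : HasFDD hP ν) (hν' : HasFDD hP ν')
    {z : Fin n → M} (h0 : ∀ᵐ w ∂ν, w 0 = z) (h0' : ∀ᵐ w ∂ν', w 0 = z) : ν = ν' := by
  refine ext_of_generate_finite _ (generateFrom_closedCylinders n)
    (isPiSystem_closedCylinders M n) ?_ (by simp)
  rintro _ ⟨I, C, hC, rfl⟩
  obtain ⟨f, hf1, hf⟩ := exists_tendsto_prod_indicator I hC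
  have h1 := tendsto_integral_prod hC hf1 hf ν
  have h2 := tendsto_integral_prod hC hf1 hf ν'
  have e : ∀ (ρ : Measure C(ℝ≥0, Fin n → M)) [IsProbabilityMeasure ρ], HasFDD hP ρ →
      (∀ᵐ w ∂ρ, w 0 = z) → ∀ m, ∫ w, ∏ t ∈ I, f m t (w t) ∂ρ = fdd hP I (f m) z := by
    intro ρ _ hρ hz m
    rw [hρ I (f m), integral_congr_ae (g := fun _ => fdd hP I (f m) z)
      (hz.mono fun w hw => by simp only [hw])]
    simp
  simp only [e ν hν h0] at h1
  simp only [e ν' hν' h0'] at h2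
  have := tendsto_nhds_unique h1 h2
  exact (measureReal_eq_measureReal_iff).1 this

variable {Q : (Fin n → M) → Measure C(ℝ≥0, Fin n → M)}

/-- The laws of the Markov processes with a Feller transition function depend measurably on the
starting point. -/
lemma measurable_of_hasFDD {hP : IsFellerTransition P} (hQp : ∀ z, IsProbabilityMeasure (Q z))
    (hQ : ∀ z, HasFDD hP (Q z)) (hQ0 : ∀ z, ∀ᵐ w ∂(Q z), w 0 = z) : Measurable Q := by
  refine Measurable.measure_of_isPiSystem_of_isProbabilityMeasure (generateFrom_closedCylinders n)
    (isPiSystem_closedCylinders M n) ?_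
  rintro _ ⟨I, C, hC, rfl⟩
  obtain ⟨f, hf1, hf⟩ := exists_tendsto_prod_indicator I hC
  have hlim : Measurable fun z => (Q z).real {w | ∀ t ∈ I, w t ∈ C t} := by
    refine measurable_of_tendsto_metrizable (f := fun m => fdd hP I (f m))
      (fun m => (continuous_fdd hP I (f m)).measurable) (tendsto_pi_nhds.2 fun z => ?_)
    have h1 := tendsto_integral_prod hC hf1 hf (Q z)
    refine h1.congr fun m => ?_
    rw [hQ z I (f m), integral_congr_ae (g := fun _ => fdd hP I (f m) z)
      ((hQ0 z).mono fun w hw => by simp only [hw])]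
    simp
  have : (fun z => Q z {w | ∀ t ∈ I, w t ∈ C t}) =
      fun z => ENNReal.ofReal ((Q z).real {w | ∀ t ∈ I, w t ∈ C t}) := by
    ext z; simp
  rw [this]
  exact hlim.ennreal_ofReal

/-- Disintegration of a measure with Markovian finite-dimensional distributions with respect to
its initial law. -/
lemma HasFDD.measure_eq_lintegral {hP : IsFellerTransition P}
    (hQp : ∀ z, IsProbabilityMeasure (Q z))
    (hQ : ∀ z, HasFDD hP (Q z)) (hQ0 : ∀ z, ∀ᵐ w ∂(Q z), w 0 = z)
    {ν : Measure C(ℝ≥0, Fin n → M)} [IsFiniteMeasure ν] (hν : HasFDD hP ν)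
    {S : Set C(ℝ≥0, Fin n → M)} (hS : MeasurableSet S) :
    ν S = ∫⁻ w, Q (w 0) S ∂ν := by
  have hQm := measurable_of_hasFDD hQp hQ hQ0
  have hQw : Measurable fun w : C(ℝ≥0, Fin n → M) => Q (w 0) := hQm.comp (measurable_eval_path 0)
  have hb : ∀ S, MeasurableSet S → (ν.bind fun w => Q (w 0)) S = ∫⁻ w, Q (w 0) S ∂ν :=
    fun S hS => Measure.bind_apply hS hQw.aemeasurable
  rw [← hb S hS]
  have huniv : ν univ = (ν.bind fun w => Q (w 0)) univ := by simp [hb univ MeasurableSet.univ]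
  have : IsFiniteMeasure (ν.bind fun w => Q (w 0)) := ⟨by rw [← huniv]; exact measure_lt_top _ _⟩
  congr 1
  refine ext_of_generate_finite _ (generateFrom_closedCylinders n)
    (isPiSystem_closedCylinders M n) ?_ huniv
  rintro _ ⟨I, C, hC, rfl⟩
  rw [hb _ (measurableSet_closedCylinder I hC)]
  obtain ⟨f, hf1, hf⟩ := exists_tendsto_prod_indicator I hC
  have h1 := tendsto_integral_prod hC hf1 hf ν
  simp only [hν I] at h1
  have e : ∀ m z, fdd hP I (f m) z = ∫ w, ∏ t ∈ I, f m t (w t) ∂(Q z) := by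
    intro m z
    rw [hQ z I (f m), integral_congr_ae (g := fun _ => fdd hP I (f m) z)
      ((hQ0 z).mono fun w hw => by simp only [hw])]
    simp
  have h2 : Tendsto (fun m => ∫ w, fdd hP I (f m) (w 0) ∂ν) atTop
      (𝓝 (∫ w, (Q (w 0)).real {w | ∀ t ∈ I, w t ∈ C t} ∂ν)) := by
    refine tendsto_integral_of_dominated_convergence (fun _ => (1 : ℝ)) (fun m =>
      ((continuous_fdd hP I (f m)).measurable.comp (measurable_eval_path 0)).aestronglyMeasurable)
      (integrable_const _) (fun m => Eventually.of_forall fun w => ?_)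
      (Eventually.of_forall fun w => ?_)
    · rw [e, Real.norm_eq_abs]
      refine (abs_integral_le_integral_abs).trans ?_
      refine (integral_mono_of_nonneg (Eventually.of_forall fun _ => abs_nonneg _)
        (integrable_const (1 : ℝ)) (Eventually.of_forall (hf1 m))).trans ?_
      simp
    · simp only [e]
      exact tendsto_integral_prod hC hf1 hf (Q (w 0))
  have h3 := tendsto_nhds_unique h1 h2
  rw [← ENNReal.ofReal_toReal (measure_ne_top ν _)]
  change ENNReal.ofReal (ν.real _) = _
  rw [h3, ofReal_integral_eq_lintegral_ofReal]
  · simp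
  · refine Integrable.of_bound (C := 1) ?_ (Eventually.of_forall fun w => ?_)
    · exact (((Measure.measurable_coe (measurableSet_closedCylinder I hC)).comp
        hQw).ennreal_toReal).aestronglyMeasurable
    · rw [Real.norm_eq_abs, abs_of_nonneg measureReal_nonneg]
      exact measureReal_le_one
  · exact Eventually.of_forall fun _ => measureReal_nonneg

end FDD

/-! ### The path space -/

section PathSpace

variable {M : Type*} [TopologicalSpace M]

instance : BorelSpace (PathSpace M) := ⟨rfl⟩

lemma continuous_start : Continuous (start : PathSpace M → ℝ) :=
  continuous_fst.comp continuous_subtype_val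

lemma continuous_val_uncurry : Continuous fun q : PathSpace M × ℝ => val q.1 q.2 := by
  unfold val
  fun_prop

lemma continuous_val_left (t : ℝ) : Continuous fun f : PathSpace M => val f t :=
  continuous_val_uncurry.comp (by fun_prop : Continuous fun f : PathSpace M => (f, t))

lemma continuous_val_right (f : PathSpace M) : Continuous fun t => val f t :=
  f.1.2.continuous

end PathSpace

/-! ### The Markov property of versions of a flow -/

/-- The past at time `v` of a family of trajectories: the σ-field generated by their positions at
the times at which they are alive, up to time `v`. -/
abbrev pastSigma {M Ω ι : Type*} [TopologicalSpace M] [MeasurableSpace M] (D : ι → ℝ × M)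
    (Y : ι → Ω → PathSpace M) (v : ℝ) : MeasurableSpace Ω :=
  ⨆ q : {q : ι × ℝ // (D q.1).1 ≤ q.2 ∧ q.2 ≤ v},
    MeasurableSpace.comap (fun ω => val (Y q.1.1 ω) q.1.2) inferInstance

lemma measurable_val_pastSigma {M Ω ι : Type*} [TopologicalSpace M] [MeasurableSpace M]
    {D : ι → ℝ × M} {Y : ι → Ω → PathSpace M} {a : ι} {u v : ℝ} (hu : (D a).1 ≤ u) (huv : u ≤ v) :
    Measurable[pastSigma D Y v] fun ω => val (Y a ω) u :=
  (comap_measurable _).mono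
    (le_iSup (fun q : {q : ι × ℝ // (D q.1).1 ≤ q.2 ∧ q.2 ≤ v} =>
      MeasurableSpace.comap (fun ω => val (Y q.1.1 ω) q.1.2) inferInstance) ⟨(a, u), hu, huv⟩)
    le_rfl

lemma pastSigma_mono {M Ω ι : Type*} [TopologicalSpace M] [MeasurableSpace M]
    {D : ι → ℝ × M} {Y : ι → Ω → PathSpace M} {v w : ℝ} (h : v ≤ w) :
    pastSigma D Y v ≤ pastSigma D Y w :=
  iSup_le fun q => (measurable_val_pastSigma q.2.1 (q.2.2.trans h)).comap_le

/-- The σ-field generated by the first `N` increments of `ψ` along the grid `t`. -/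
abbrev incrementSigma {M Ω : Type*} [MeasurableSpace M] (ψ : ℝ → ℝ → Ω → MeasMap M) (t : ℕ → ℝ)
    (N : ℕ) : MeasurableSpace Ω :=
  ⨆ i : Fin N, MeasurableSpace.comap (ψ (t i) (t (i + 1))) inferInstance

lemma measurable_incrementSigma {M Ω : Type*} [MeasurableSpace M] {ψ : ℝ → ℝ → Ω → MeasMap M}
    {t : ℕ → ℝ} {N i : ℕ} (hi : i < N) :
    Measurable[incrementSigma ψ t N] (ψ (t i) (t (i + 1))) :=
  (comap_measurable _).mono (le_iSup (fun i : Fin N =>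
    MeasurableSpace.comap (ψ (t i) (t (i + 1))) inferInstance) ⟨i, hi⟩) le_rfl

section Version

variable {M Ω : Type*} [MetricSpace M] [ProperSpace M] [MeasurableSpace M] [BorelSpace M]
  [MeasurableSpace Ω] {μ : Measure Ω} {P : (n : ℕ) → ℝ≥0 → Kernel (Fin n → M) (Fin n → M)}
  {ψ : ℝ → ℝ → Ω → MeasMap M}

/-- `Y` is a continuous modification of the trajectory of the flow `ψ` which starts in the
space-time point `p`. -/
structure IsVersion (μ : Measure Ω) (ψ : ℝ → ℝ → Ω → MeasMap M) (p : ℝ × M)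
    (Y : Ω → PathSpace M) : Prop where
  measurable : Measurable Y
  start_eq : ∀ ω, start (Y ω) = p.1
  val_start : ∀ ω, val (Y ω) p.1 = p.2
  modification : ∀ t, p.1 ≤ t → ∀ᵐ ω ∂μ, val (Y ω) t = (ψ p.1 t ω).1 p.2

omit [ProperSpace M] in
lemma IsVersion.measurable_val {p : ℝ × M} {Y : Ω → PathSpace M} (hY : IsVersion μ ψ p Y) (t : ℝ) :
    Measurable fun ω => val (Y ω) t :=
  (continuous_val_left t).measurable.comp hY.measurable

variable {ι : Type*} {D : ι → ℝ × M} {Y : ι → Ω → PathSpace M}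

omit [ProperSpace M] in
lemma pastSigma_le (hY : ∀ a, IsVersion μ ψ (D a) (Y a)) (v : ℝ) :
    pastSigma D Y v ≤ ‹MeasurableSpace Ω› :=
  iSup_le fun q => ((hY q.1.1).measurable_val q.1.2).comap_le

/-- A finite set of times with last element `v`, completed to a non-decreasing sequence which
continues with `w`. -/
lemma exists_monotone_grid (S : Finset ℝ) {v w : ℝ} (hv : v ∈ S) (hS : ∀ x ∈ S, x ≤ v)
    (hvw : v ≤ w) : ∃ (N : ℕ) (t : ℕ → ℝ), Monotone t ∧ t N = v ∧ t (N + 1) = w ∧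
      ∀ x ∈ S, ∃ i ≤ N, t i = x := by
  obtain ⟨N, hN⟩ : ∃ N, S.card = N + 1 := ⟨S.card - 1, by
    have := Finset.card_pos.2 ⟨v, hv⟩; omega⟩
  let e := S.orderEmbOfFin hN
  let t : ℕ → ℝ := fun i => if h : i < N + 1 then e ⟨i, h⟩ else w
  have hmem : ∀ i, e i ∈ S := fun i => S.orderEmbOfFin_mem hN i
  have ht : ∀ x ∈ S, ∃ i ≤ N, t i = x := by
    intro x hx
    have : x ∈ Set.range e := by rw [S.range_orderEmbOfFin hN]; exact hx
    obtain ⟨i, hi⟩ := this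
    exact ⟨i, by omega, by simp only [t, dif_pos i.2]; exact hi⟩
  have hmono : Monotone t := by
    intro i j hij
    simp only [t]
    split_ifs with h1 h2 h2
    · exact e.monotone hij
    · exact (hS _ (hmem _)).trans hvw
    · omega
    · exact le_rfl
  refine ⟨N, t, hmono, ?_, by simp [t], ht⟩
  obtain ⟨i, hi, hiv⟩ := ht v hv
  refine le_antisymm ?_ (hiv ▸ hmono hi)
  simp only [t, Nat.lt_succ_self, dif_pos]
  exact hS _ (hmem _)

omit [ProperSpace M] [BorelSpace M] in
/-- The positions, at times of a grid, of the trajectories which start at times of the grid are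
almost surely functions of the increments of the flow along the grid. -/
lemma exists_measurable_ae_eq_flow (hψ : IsStochasticFlow P μ ψ) {t : ℕ → ℝ} (ht : Monotone t)
    {N i j : ℕ} (hij : i ≤ j) (hj : j ≤ N) (x : M) :
    ∃ g : Ω → M, Measurable[incrementSigma ψ t N] g ∧ (fun ω => (ψ (t i) (t j) ω).1 x) =ᵐ[μ] g := by
  obtain ⟨J, hJm, -, hJ2, hJ3⟩ := hψ.flow
  induction j, hij using Nat.le_induction with
  | base => exact ⟨fun _ => x, measurable_const, hJ3 (t i) x⟩
  | succ j hij ih =>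
    obtain ⟨g, hgm, hg⟩ := ih (by omega)
    refine ⟨fun ω => J (t (j + 1) - t j).toNNReal (ψ (t j) (t (j + 1)) ω, g ω),
      (hJm _).comp ((measurable_incrementSigma (by omega)).prodMk hgm), ?_⟩
    filter_upwards [hJ2 (t i) (t j) (t (j + 1)) (ht hij) (ht (Nat.le_succ j)) x, hg] with ω h1 h2
    rw [h1, h2]

omit [ProperSpace M] in
/-- The past of a family of trajectories is independent of the later increments of the flow. -/
lemma indep_pastSigma [IsProbabilityMeasure μ] (hψ : IsStochasticFlow P μ ψ)
    (hY : ∀ a, IsVersion μ ψ (D a) (Y a)) {v w : ℝ} (hvw : v ≤ w) :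
    Indep (pastSigma D Y v) (MeasurableSpace.comap (ψ v w) inferInstance) μ := by
  classical
  rw [pastSigma, iSup_eq_iSup_finset]
  have hle : ∀ T : Finset {q : ι × ℝ // (D q.1).1 ≤ q.2 ∧ q.2 ≤ v},
      (⨆ q ∈ T, MeasurableSpace.comap (fun ω => val (Y q.1.1 ω) q.1.2) inferInstance) ≤
        ‹MeasurableSpace Ω› := fun T =>
    iSup₂_le fun q _ => ((hY q.1.1).measurable_val q.1.2).comap_le
  have hmono : Monotone fun T : Finset {q : ι × ℝ // (D q.1).1 ≤ q.2 ∧ q.2 ≤ v} =>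
      (⨆ q ∈ T, MeasurableSpace.comap (fun ω => val (Y q.1.1 ω) q.1.2) inferInstance :
        MeasurableSpace Ω) := fun T T' hTT' =>
    biSup_mono fun q hq => hTT' hq
  refine indep_iSup_of_monotone (fun T => ?_) hle (hψ.measurable v w hvw).comap_le hmono
  -- a grid which contains all the times that occur in finitely many evaluations, and then `v` and `w`
  let S : Finset ℝ := insert v (T.image (fun q => (D q.1.1).1) ∪ T.image (fun q => q.1.2))
  obtain ⟨N, t, ht, htN, htN1, htS⟩ := exists_monotone_grid S (v := v) (w := w)
    (Finset.mem_insert_self _ _) (by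
      intro x hx
      simp only [S, Finset.mem_insert, Finset.mem_union, Finset.mem_image] at hx
      rcases hx with rfl | ⟨q, -, rfl⟩ | ⟨q, -, rfl⟩
      · exact le_rfl
      · exact q.2.1.trans q.2.2
      · exact q.2.2) hvw
  have hind := hψ.indep (N + 1) (fun i => t i) fun i j hij => ht hij
  have hX : ∀ i : Fin (N + 1), Measurable (ψ (t i.castSucc) (t i.succ)) := fun i =>
    hψ.measurable _ _ (ht (by simp))
  have hind' : Indep (incrementSigma ψ t N) (MeasurableSpace.comap (ψ v w) inferInstance) μ := by
    have h := indep_iSup_of_disjoint (fun i => (hX i).comap_le) hind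
      (S := {i : Fin (N + 1) | i ≠ Fin.last N}) (T := {Fin.last N}) (by simp)
    refine indep_of_indep_of_le_left (indep_of_indep_of_le_right h ?_) ?_
    · refine le_trans (le_of_eq ?_) (le_iSup₂ (Fin.last N) (mem_singleton _))
      simp [htN, htN1]
    · refine iSup_le fun i => ?_
      exact le_iSup₂ (f := fun (i : Fin (N + 1)) (_ : i ∈ {i : Fin (N + 1) | i ≠ Fin.last N}) =>
        MeasurableSpace.comap (ψ (t i.castSucc) (t i.succ)) inferInstance) i.castSucc
        (Fin.castSucc_lt_last i).ne
  -- up to null sets, the evaluations are functions of the increments along the grid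
  have hev : (⨆ q ∈ T, MeasurableSpace.comap (fun ω => val (Y q.1.1 ω) q.1.2) inferInstance :
      MeasurableSpace Ω) ≤ eventuallyMeasurableSpace (incrementSigma ψ t N) (ae μ) := by
    refine iSup₂_le fun q hq => ?_
    obtain ⟨i, hi, hi'⟩ := htS (D q.1.1).1 (by
      simp only [S, Finset.mem_insert, Finset.mem_union, Finset.mem_image]
      exact Or.inr (Or.inl ⟨q, hq, rfl⟩))
    obtain ⟨j, hj, hj'⟩ := htS q.1.2 (by
      simp only [S, Finset.mem_insert, Finset.mem_union, Finset.mem_image]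
      exact Or.inr (Or.inr ⟨q, hq, rfl⟩))
    obtain ⟨g, hgm, hg⟩ : ∃ g : Ω → M, Measurable[incrementSigma ψ t N] g ∧
        (fun ω => (ψ (D q.1.1).1 q.1.2 ω).1 (D q.1.1).2) =ᵐ[μ] g := by
      rcases le_total i j with hij | hij
      · have := exists_measurable_ae_eq_flow hψ ht hij hj (D q.1.1).2
        rwa [hi', hj'] at this
      · have heq : (D q.1.1).1 = q.1.2 := le_antisymm q.2.1 (by
          rw [← hi', ← hj']; exact ht hij)
        have := exists_measurable_ae_eq_flow hψ ht le_rfl hi (D q.1.1).2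
        rw [hi'] at this
        rwa [← heq]
    rintro _ ⟨A, hA, rfl⟩
    refine ⟨g ⁻¹' A, hgm hA, ?_⟩
    filter_upwards [(hY q.1.1).modification q.1.2 q.2.1, hg] with ω h1 h2
    apply propext
    change val (Y q.1.1 ω) q.1.2 ∈ A ↔ g ω ∈ A
    rw [h1, ← h2]
  rw [Indep_iff]
  intro A B hA hB
  obtain ⟨A', hA', hAA'⟩ := hev A hA
  rw [measure_congr hAA', measure_congr (hAA'.inter (ae_eq_refl B))]
  exact (Indep_iff _ _ _).1 hind' A' B hA' hB

/-- The increment of a flow after time `v` acts on the past at time `v` by the transition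
function. -/
lemma setIntegral_flow_eq {Ω : Type*} {m m₀ : MeasurableSpace Ω} {μ : Measure[m₀] Ω}
    [IsProbabilityMeasure μ] {ψ : ℝ → ℝ → Ω → MeasMap M} (hψ : IsStochasticFlow P μ ψ)
    {J : ℝ≥0 → MeasMap M × M → M} (hJm : ∀ t, Measurable (J t))
    (hJ : ∀ (s t : ℝ), s ≤ t → ∀ x : M,
      ∀ᵐ ω ∂μ, J (t - s).toNNReal (ψ s t ω, x) = (ψ s t ω).1 x)
    {v w : ℝ} (hvw : v ≤ w) (hm : m ≤ m₀)
    (hind : Indep m (MeasurableSpace.comap (ψ v w) inferInstance) μ) {n : ℕ}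
    {X : Ω → Fin n → M} (hX : Measurable[m] X) {B : Set Ω} (hB : MeasurableSet[m] B)
    (F : C₀(Fin n → M, ℝ)) :
    ∫ ω in B, F (fun i => J (w - v).toNNReal (ψ v w ω, X ω i)) ∂μ =
      ∫ ω in B, ∫ y, F y ∂(P n (w - v).toNNReal (X ω)) ∂μ := by
  set h := (w - v).toNNReal
  have hXm : Measurable X := hX.mono hm le_rfl
  have hBm : MeasurableSet B := hm B hB
  have hψm := hψ.measurable v w hvw
  -- the indicator of `B` is joined to `X`, so that the pair is independent of the increment `ψ v w`
  let U : Ω → ℝ × (Fin n → M) := fun ω => (B.indicator (fun _ => (1 : ℝ)) ω, X ω)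
  have hU : Measurable[m] U := (measurable_const.indicator hB).prodMk hX
  have hUm : Measurable U := hU.mono hm le_rfl
  have hind2 : IndepFun U (ψ v w) μ := by
    rw [IndepFun_iff_Indep]
    exact indep_of_indep_of_le_left hind hU.comap_le
  have hprod := (indepFun_iff_map_prod_eq_prod_map_map hUm.aemeasurable hψm.aemeasurable).1 hind2
  let φ : (ℝ × (Fin n → M)) × MeasMap M → ℝ := fun q => F (fun i => J h (q.2, q.1.2 i))
  have hφ : Measurable φ := F.continuous.measurable.comp
    (measurable_pi_lambda _ fun i => (hJm h).comp (measurable_snd.prodMk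
      ((measurable_pi_apply i).comp (measurable_snd.comp measurable_fst))))
  have hlaw : ∀ x : Fin n → M, ∫ p, φ ((1, x), p) ∂(μ.map (ψ v w)) = ∫ y, F y ∂(P n h x) := by
    intro x
    have hφx : Measurable fun p : MeasMap M => φ ((1, x), p) := hφ.comp measurable_prodMk_left
    rw [integral_map hψm.aemeasurable hφx.aestronglyMeasurable, ← hψ.law v w hvw n x F]
    refine integral_congr_ae ?_
    filter_upwards [ae_all_iff.2 fun i => hJ v w hvw (x i)] with ω hω
    simp only [φ, h, hω]
  have e : ∀ G : Ω → ℝ, ∫ ω in B, G ω ∂μ = ∫ ω, B.indicator (fun _ => (1 : ℝ)) ω * G ω ∂μ := by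
    intro G
    rw [← integral_indicator hBm]
    congr 1 with ω
    by_cases hω : ω ∈ B <;> simp [hω]
  have hint : Integrable (fun q : (ℝ × (Fin n → M)) × MeasMap M => q.1.1 * φ q)
      ((μ.map U).prod (μ.map (ψ v w))) := by
    rw [← hprod]
    rw [integrable_map_measure (by fun_prop) (by fun_prop)]
    refine Integrable.of_bound (C := ‖F.toBCF‖) (by
      exact ((measurable_fst.comp measurable_fst).mul hφ |>.comp
        (hUm.prodMk hψm)).aestronglyMeasurable) (Eventually.of_forall fun ω => ?_)
    simp only [Function.comp, U, norm_mul, Real.norm_eq_abs]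
    by_cases hω : ω ∈ B
    · simpa [hω] using abs_zeroAtInfty_le F _
    · simp [hω]
  calc ∫ ω in B, F (fun i => J h (ψ v w ω, X ω i)) ∂μ
      = ∫ ω, (fun q : (ℝ × (Fin n → M)) × MeasMap M => q.1.1 * φ q) (U ω, ψ v w ω) ∂μ := e _
    _ = ∫ q, q.1.1 * φ q ∂((μ.map U).prod (μ.map (ψ v w))) := by
      rw [← hprod, integral_map (hUm.prodMk hψm).aemeasurable]
      exact ((measurable_fst.comp measurable_fst).mul hφ).aestronglyMeasurable
    _ = ∫ u, u.1 * ∫ p, φ (u, p) ∂(μ.map (ψ v w)) ∂(μ.map U) := by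
      rw [integral_prod _ hint]
      simp only [integral_const_mul]
    _ = ∫ u, u.1 * ∫ y, F y ∂(P n h u.2) ∂(μ.map U) := by
      congr 1 with u
      rw [← hlaw u.2]
    _ = _ := by
      rw [e, integral_map hUm.aemeasurable]
      refine (measurable_fst.mul ?_).aestronglyMeasurable
      have hS : StronglyMeasurable fun x : Fin n → M => ∫ y, F y ∂(P n h x) :=
        F.continuous.stronglyMeasurable.integral_kernel
      exact hS.measurable.comp measurable_snd

/-- The Markov property of finitely many trajectories of a flow. -/
lemma setIntegral_version_eq [IsProbabilityMeasure μ] (hψ : IsStochasticFlow P μ ψ)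
    (hY : ∀ a, IsVersion μ ψ (D a) (Y a)) {n : ℕ} (a : Fin n → ι) {v : ℝ} (h : ℝ≥0)
    (hv : ∀ i, (D (a i)).1 ≤ v) {B : Set Ω} (hB : MeasurableSet[pastSigma D Y v] B)
    (F : C₀(Fin n → M, ℝ)) :
    ∫ ω in B, F (fun i => val (Y (a i) ω) (v + h)) ∂μ =
      ∫ ω in B, ∫ y, F y ∂(P n h (fun i => val (Y (a i) ω) v)) ∂μ := by
  obtain ⟨J, hJm, hJ1, hJ2, hJ3⟩ := hψ.flow
  have hvh : v ≤ v + h := by simp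
  have key := setIntegral_flow_eq hψ hJm hJ1 hvh (pastSigma_le hY v)
    (indep_pastSigma hψ hY hvh) (X := fun ω i => val (Y (a i) ω) v)
    (@measurable_pi_lambda Ω (Fin n) (fun _ => M) (pastSigma D Y v) _ _
      fun i => measurable_val_pastSigma (hv i) le_rfl) hB F
  have hh : (v + h - v).toNNReal = h := by simp
  rw [hh] at key
  rw [← key]
  refine setIntegral_congr_ae (pastSigma_le hY v B hB) ?_
  have h1 := ae_all_iff.2 fun i => (hY (a i)).modification (v + h) ((hv i).trans hvh)
  have h2 := ae_all_iff.2 fun i => (hY (a i)).modification v (hv i)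
  have h3 := ae_all_iff.2 fun i => hJ2 (D (a i)).1 v (v + h) (hv i) hvh (D (a i)).2
  filter_upwards [h1, h2, h3] with ω e1 e2 e3 _
  congr 1
  ext i
  rw [e1, e3, e2, hh]

end Version

/-! ### Restrictions of paths and dense times -/

section PathSpace

variable {M : Type*} [MetricSpace M]

instance [SecondCountableTopology M] : SecondCountableTopology (PathSpace M) :=
  TopologicalSpace.Subtype.secondCountableTopology _

instance : TopologicalSpace.PseudoMetrizableSpace (PathSpace M) :=
  IsInducing.subtypeVal.pseudoMetrizableSpace

/-- The constant path which starts at `(s, x)`. -/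
def constPath (s : ℝ) (x : M) : PathSpace M := ⟨(s, ContinuousMap.const ℝ x), fun _ _ => rfl⟩

lemma val_of_le_start (f : PathSpace M) {t : ℝ} (h : t ≤ start f) : val f t = val f (start f) :=
  f.2 t h

lemma path_ext {f g : PathSpace M} (h : start f = start g) (h' : ∀ t, start f ≤ t →
    val f t = val g t) : f = g := by
  refine Subtype.ext (Prod.ext h (ContinuousMap.ext fun t => ?_))
  rcases le_total (start f) t with ht | ht
  · exact h' t ht
  · change val f t = val g t
    rw [val_of_le_start f ht, val_of_le_start g (ht.trans_eq h), ← h]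
    exact h' _ le_rfl

lemma val_restrictFrom (f : PathSpace M) (s t : ℝ) : val (restrictFrom f s) t = val f (max s t) :=
  rfl

lemma continuous_restrictFrom_uncurry :
    Continuous fun q : PathSpace M × ℝ => restrictFrom q.1 q.2 := by
  refine Continuous.subtype_mk (continuous_snd.prodMk ?_) _
  refine ContinuousMap.continuous_comp'.comp (Continuous.prodMk ?_ (by fun_prop) :
    Continuous fun q : PathSpace M × ℝ =>
      ((⟨fun t => max q.2 t, by fun_prop⟩ : C(ℝ, ℝ)), q.1.1.2))
  exact ContinuousMap.continuous_of_continuous_uncurry _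
    (by fun_prop : Continuous fun p : (PathSpace M × ℝ) × ℝ => max p.1.2 p.2)

/-- A dense sequence of times in `[s, ∞)`, with `s` as its first term. -/
noncomputable def denseTimes (s : ℝ) : ℕ → ℝ
  | 0 => s
  | i + 1 => s + |TopologicalSpace.denseSeq ℝ i|

lemma le_denseTimes (s : ℝ) (i : ℕ) : s ≤ denseTimes s i := by
  cases i with
  | zero => exact le_rfl
  | succ i => simp [denseTimes]

lemma eq_of_denseTimes {s : ℝ} {f g : ℝ → M} (hf : Continuous f) (hg : Continuous g)
    (h : ∀ i, f (denseTimes s i) = g (denseTimes s i)) {t : ℝ} (ht : s ≤ t) : f t = g t := by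
  have h2 : (fun q : ℝ => f (s + |q|)) = fun q => g (s + |q|) :=
    (TopologicalSpace.denseRange_denseSeq ℝ).equalizer (by fun_prop) (by fun_prop)
      (funext fun i => h (i + 1))
  have := congrFun h2 (t - s)
  simpa [abs_of_nonneg (sub_nonneg.2 ht)] using this

end PathSpace

/-! ### Small-time and coalescence estimates -/

section Estimates

variable {M Ω : Type*} [MetricSpace M] [ProperSpace M] [MeasurableSpace M] [BorelSpace M]
  [MeasurableSpace Ω] {μ : Measure Ω} [IsProbabilityMeasure μ]
  {P : (n : ℕ) → ℝ≥0 → Kernel (Fin n → M) (Fin n → M)} {ψ : ℝ → ℝ → Ω → MeasMap M}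

/-- If `0 ≤ f ≤ 1` vanishes on `A`, then the probability of `A` is at most `1 - E f`. -/
lemma measureReal_le_one_sub_integral {A : Set Ω} (hA : MeasurableSet A) {f : Ω → ℝ}
    (hf : Measurable f) (h01 : ∀ ω, 0 ≤ f ω ∧ f ω ≤ 1) (h0 : ∀ ω ∈ A, f ω = 0) :
    μ.real A ≤ 1 - ∫ ω, f ω ∂μ := by
  have hint : Integrable f μ := Integrable.of_bound hf.aestronglyMeasurable 1
    (Eventually.of_forall fun ω => by
      rw [Real.norm_eq_abs, abs_of_nonneg (h01 ω).1]; exact (h01 ω).2)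
  have h1 : ∫ ω, (1 - f ω) ∂μ = 1 - ∫ ω, f ω ∂μ := by
    rw [integral_sub (integrable_const _) hint]; simp
  rw [← h1, ← integral_indicator_one hA]
  refine integral_mono ((integrable_const (1 : ℝ)).indicator hA)
    ((integrable_const _).sub hint) fun ω => ?_
  by_cases hω : ω ∈ A
  · simp [hω, h0 ω hω]
  · simp [hω, (h01 ω).2]

/-- A trajectory stays near its starting point during a short time, uniformly with respect to the
starting point near `x`. -/
lemma exists_measureReal_dist_le (hP : IsConsistentCoalescing P) (hψ : IsStochasticFlow P μ ψ)
    (s : ℝ) (x : M) {r η : ℝ} (hr : 0 < r) (hη : 0 < η) :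
    ∃ δ > 0, ∀ s' ≤ s, ∀ y, s - s' < δ → dist y x < δ →
      μ.real {ω | r ≤ dist ((ψ s' s ω).1 y) x} ≤ η := by
  obtain ⟨f, hfx, hf01, hf0⟩ := exists_bump (fun _ : Fin 1 => x) hr
  have hη2 : 0 < η / 2 := by positivity
  have h1 := Metric.tendstoUniformly_iff.1 ((hP.feller 1).tendsto_zero f) (η / 2) hη2
  obtain ⟨δ₁, hδ₁, h1'⟩ := Metric.eventually_nhds_iff.1 h1
  have hc : Continuous fun y : M => f fun _ => y := by fun_prop
  obtain ⟨δ₂, hδ₂, h2⟩ := Metric.continuous_iff.1 hc x (η / 2) hη2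
  refine ⟨min δ₁ δ₂, lt_min hδ₁ hδ₂, fun s' hs' y hs hy => ?_⟩
  have hm : Measurable fun ω => (ψ s' s ω).1 y :=
    (measurable_pi_apply y).comp (measurable_subtype_coe.comp (hψ.measurable s' s hs'))
  have h3 := h1' (y := (s - s').toNNReal) (by
    rw [NNReal.dist_eq]
    simpa [abs_of_nonneg, hs'] using hs.trans_le (min_le_left _ _)) (fun _ => y)
  have h4 := h2 y (hy.trans_le (min_le_right _ _))
  have h5 := hψ.law s' s hs' 1 (fun _ => y) f
  have hm' : Measurable fun ω => f (fun _ : Fin 1 => (ψ s' s ω).1 y) :=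
    f.continuous.measurable.comp (measurable_pi_lambda _ fun _ => hm)
  refine (measureReal_le_one_sub_integral (f := fun ω => f (fun _ : Fin 1 => (ψ s' s ω).1 y))
    (measurableSet_le measurable_const (hm.dist measurable_const)) hm' (fun ω => hf01 _)
    fun ω hω => hf0 _ ?_).trans ?_
  · exact le_trans (by exact hω) (dist_le_pi_dist (fun _ : Fin 1 => (ψ s' s ω).1 y) (fun _ => x) 0)
  · rw [h5]
    rw [Real.dist_eq, abs_lt] at h3 h4
    rw [hfx] at h4
    linarith [h3.2, h4.1]

/-- At a later time `t`, a trajectory which is near `x` at time `s` is near the trajectory which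
starts at `(s, x)`: two-point motions from nearby points coalesce with large probability. -/
lemma exists_measureReal_dist_flow_le (hP : IsConsistentCoalescing P)
    (hψ : IsStochasticFlow P μ ψ) {s t : ℝ} (hst : s ≤ t) (x : M) {r η : ℝ} (hr : 0 < r)
    (hη : 0 < η) : ∃ δ > 0, ∀ (p : ℝ × M) (Y : Ω → PathSpace M), IsVersion μ ψ p Y → p.1 ≤ s →
      μ.real {ω | r ≤ dist (val (Y ω) t) ((ψ s t ω).1 x)} ≤
        η + μ.real {ω | δ ≤ dist (val (Y ω) s) x} := by
  set h := (t - s).toNNReal with hh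
  have := (hP.feller 2).markov h
  -- a function which is large near most of the diagonal and vanishes away from the diagonal
  choose q hq01 hq1 hq0 using fun R : ℕ => exists_plateau x (R : ℝ)
  let F : ℕ → C₀(Fin 2 → M, ℝ) := fun R => zeroAtInftyOfBounded
    (fun z => max 0 (1 - dist (z 0) (z 1) / r) * q R (z 0)) (by fun_prop) (fun _ => x) (R + 1 + r)
    (fun z hz => by
      by_cases h1 : R + 1 < dist (z 0) x
      · rw [hq0 R _ h1, mul_zero]
      · have h2 : r < dist (z 0) (z 1) := by
          by_contra h3
          push Not at h1 h3
          refine hz.not_ge ((dist_pi_le_iff (by positivity)).2 fun i => ?_)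
          fin_cases i
          · change dist (z 0) x ≤ _
            linarith
          · change dist (z 1) x ≤ _
            linarith [dist_triangle (z 1) (z 0) x, dist_comm (z 0) (z 1)]
        have h4 : 1 < dist (z 0) (z 1) / r := (one_lt_div hr).2 h2
        rw [max_eq_left (by linarith), zero_mul])
  have hF : ∀ R z, F R z = max 0 (1 - dist (z 0) (z 1) / r) * q R (z 0) := fun R z => rfl
  have hF01 : ∀ R z, 0 ≤ F R z ∧ F R z ≤ 1 := by
    intro R z
    rw [hF]
    have h1 : 0 ≤ dist (z 0) (z 1) / r := by positivity
    have h2 : max 0 (1 - dist (z 0) (z 1) / r) ≤ 1 := max_le zero_le_one (by linarith)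
    exact ⟨mul_nonneg (le_max_left _ _) (hq01 R _).1,
      mul_le_one₀ h2 (hq01 R _).1 (hq01 R _).2⟩
  have hF0 : ∀ R z, r ≤ dist (z 0) (z 1) → F R z = 0 := by
    intro R z hz
    have h4 : 1 ≤ dist (z 0) (z 1) / r := (one_le_div hr).2 hz
    rw [hF, max_eq_left (by linarith), zero_mul]
  have hdiag : ∀ᵐ z ∂(P 2 h ![x, x]), z 0 = z 1 :=
    (mem_ae_iff_prob_eq_one (measurableSet_eq_fun (measurable_pi_apply 0)
      (measurable_pi_apply 1))).2 (hP.coalescing x h)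
  have hlim : Tendsto (fun R => ∫ z, F R z ∂(P 2 h ![x, x])) atTop (𝓝 1) := by
    have h1 : Tendsto (fun R => ∫ z, F R z ∂(P 2 h ![x, x])) atTop
        (𝓝 (∫ _, (1 : ℝ) ∂(P 2 h ![x, x]))) := by
      refine tendsto_integral_of_dominated_convergence (fun _ => (1 : ℝ))
        (fun R => (F R).continuous.measurable.aestronglyMeasurable) (integrable_const _)
        (fun R => Eventually.of_forall fun z => ?_) ?_
      · rw [Real.norm_eq_abs, abs_of_nonneg (hF01 R z).1]; exact (hF01 R z).2
      · filter_upwards [hdiag] with z hz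
        refine tendsto_const_nhds.congr' ?_
        filter_upwards [eventually_ge_atTop ⌈dist (z 0) x⌉₊] with R hR
        rw [hF, hz, dist_self, ← hz, hq1 R _ (Nat.ceil_le.1 hR)]
        simp
    simpa using h1
  obtain ⟨R, hR⟩ := (hlim.eventually (lt_mem_nhds (show 1 - η / 2 < 1 by linarith))).exists
  obtain ⟨G, hG⟩ := (hP.feller 2).map_zeroAtInfty h (F R)
  rw [hG] at hR
  have hG0 : ∀ z, 0 ≤ G z := fun z => by
    rw [← hG]; exact integral_nonneg fun y => (hF01 R y).1
  have hc : Continuous fun y : M => G ![y, x] := by fun_prop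
  obtain ⟨δ, hδ, h2⟩ := Metric.continuous_iff.1 hc x (η / 2) (by positivity)
  refine ⟨δ, hδ, fun p Y hY hp => ?_⟩
  obtain ⟨J, hJm, hJ1, hJ2, hJ3⟩ := hψ.flow
  have hYa : ∀ a : Unit, IsVersion μ ψ ((fun _ : Unit => p) a) ((fun _ : Unit => Y) a) :=
    fun _ => hY
  have key := setIntegral_flow_eq hψ hJm hJ1 hst (pastSigma_le hYa s)
    (indep_pastSigma hψ hYa hst) (X := fun ω => ![val (Y ω) s, x])
    (@measurable_pi_lambda Ω (Fin 2) (fun _ => M) (pastSigma _ _ s) _ _ fun i => by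
      fin_cases i
      · exact measurable_val_pastSigma (a := ()) hp le_rfl
      · exact measurable_const) MeasurableSet.univ (F R)
  rw [Measure.restrict_univ] at key
  have e : (fun ω => F R (fun i => J h (ψ s t ω, ![val (Y ω) s, x] i))) =ᵐ[μ]
      fun ω => F R ![val (Y ω) t, (ψ s t ω).1 x] := by
    filter_upwards [hY.modification t (hp.trans hst), hY.modification s hp,
      hJ2 p.1 s t hp hst p.2, hJ1 s t hst x] with ω e1 e2 e3 e4
    congr 1
    ext i
    fin_cases i
    · change J h (ψ s t ω, val (Y ω) s) = val (Y ω) t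
      rw [e1, e3, e2]
    · exact e4
  rw [integral_congr_ae e] at key
  have hmx : Measurable fun ω => (ψ s t ω).1 x :=
    (measurable_pi_apply x).comp (measurable_subtype_coe.comp (hψ.measurable s t hst))
  have hmF : Measurable fun ω => F R ![val (Y ω) t, (ψ s t ω).1 x] := by
    refine (F R).continuous.measurable.comp (measurable_pi_lambda _ fun i => ?_)
    fin_cases i
    · exact hY.measurable_val t
    · exact hmx
  refine (measureReal_le_one_sub_integral (f := fun ω => F R ![val (Y ω) t, (ψ s t ω).1 x])
    (measurableSet_le measurable_const ((hY.measurable_val t).dist hmx)) hmF (fun ω => hF01 _ _)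
    fun ω hω => hF0 _ _ hω).trans ?_
  rw [key]
  simp only [← hh, hG]
  have hA : MeasurableSet {ω | δ ≤ dist (val (Y ω) s) x} :=
    measurableSet_le measurable_const ((hY.measurable_val s).dist measurable_const)
  have hmono : ∫ ω, ((1 - η) - {ω | δ ≤ dist (val (Y ω) s) x}.indicator (fun _ => (1 : ℝ)) ω) ∂μ ≤
      ∫ ω, G ![val (Y ω) s, x] ∂μ := by
    refine integral_mono ((integrable_const _).sub ((integrable_const (1 : ℝ)).indicator hA))
      (integrable_zeroAtInfty_comp G (measurable_pi_lambda _ fun i => ?_)) fun ω => ?_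
    · fin_cases i
      · exact hY.measurable_val s
      · exact measurable_const
    · by_cases hω : δ ≤ dist (val (Y ω) s) x
      · rw [indicator_of_mem (by exact hω)]
        linarith [hG0 ![val (Y ω) s, x]]
      · rw [indicator_of_notMem (by exact hω)]
        have := h2 (val (Y ω) s) (not_le.1 hω)
        rw [Real.dist_eq, abs_lt] at this
        linarith [this.1]
  rw [integral_sub (integrable_const _) ((integrable_const (1 : ℝ)).indicator hA),
    integral_indicator_const _ hA] at hmono
  simp at hmono
  linarith

end Estimates

/-! ### Continuous versions for all starting points -/

section Existence

/-- A sequence in a compact set of paths which start at time `s` converges as soon as it converges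
pointwise at the times `denseTimes s`. -/
lemma exists_tendsto_of_denseTimes {M : Type*} [MetricSpace M] {s : ℝ} {u : ℕ → PathSpace M}
    {K : Set (PathSpace M)} (hK : IsCompact K) (hu : ∀ᶠ k in atTop, u k ∈ K)
    (hs : ∀ k, start (u k) = s) {y : ℕ → M}
    (hy : ∀ i, Tendsto (fun k => val (u k) (denseTimes s i)) atTop (𝓝 (y i))) :
    ∃ f, Tendsto u atTop (𝓝 f) := by
  have hcl : ∀ f, MapClusterPt f atTop u → start f = s ∧ ∀ i, val f (denseTimes s i) = y i := by
    intro f hf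
    obtain ⟨U, hU, hUf⟩ := mapClusterPt_iff_ultrafilter.1 hf
    refine ⟨?_, fun i => ?_⟩
    · have h1 := (continuous_start.tendsto f).comp hUf
      refine tendsto_nhds_unique h1 ?_
      simp only [Function.comp_def, hs]
      exact tendsto_const_nhds
    · exact tendsto_nhds_unique (((continuous_val_left _).tendsto f).comp hUf) ((hy i).mono_left hU)
  obtain ⟨f, -, hf⟩ := hK.exists_mapClusterPt (f := atTop) (u := u) (le_principal_iff.2 hu)
  refine ⟨f, hK.tendsto_nhds_of_unique_mapClusterPt hu fun g _ hg => ?_⟩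
  refine path_ext ((hcl g hg).1.trans (hcl f hf).1.symm) fun t ht => ?_
  refine eq_of_denseTimes (continuous_val_right g) (continuous_val_right f) (fun i => ?_)
    ((hcl g hg).1 ▸ ht)
  rw [(hcl g hg).2, (hcl f hf).2]

variable {M Ω : Type*} [MetricSpace M] [ProperSpace M] [MeasurableSpace M] [BorelSpace M]
  [MeasurableSpace Ω] {μ : Measure Ω} [IsProbabilityMeasure μ]
  {P : (n : ℕ) → ℝ≥0 → Kernel (Fin n → M) (Fin n → M)} {ψ : ℝ → ℝ → Ω → MeasMap M}
  {D : ℕ → ℝ × M} {Y : ℕ → Ω → PathSpace M}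

/-- Trajectories which are near `x` at time `s` converge in probability, at each later time, to the
trajectory of `(s, x)`. -/
lemma tendstoInMeasure_version (hP : IsConsistentCoalescing P) (hψ : IsStochasticFlow P μ ψ)
    (hY : ∀ n, IsVersion μ ψ (D n) (Y n)) {s : ℝ} {x : M} {n : ℕ → ℕ} (hn : ∀ j, (D (n j)).1 ≤ s)
    (hx : TendstoInMeasure μ (fun j ω => val (Y (n j) ω) s) atTop fun _ => x)
    {t : ℝ} (ht : s ≤ t) :
    TendstoInMeasure μ (fun j ω => val (Y (n j) ω) t) atTop fun ω => (ψ s t ω).1 x := by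
  rw [tendstoInMeasure_iff_measureReal_dist] at hx ⊢
  intro r hr
  rw [Metric.tendsto_atTop]
  intro η hη
  obtain ⟨δ, hδ, h⟩ := exists_measureReal_dist_flow_le hP hψ ht x hr (half_pos hη)
  obtain ⟨N, hN⟩ := Metric.tendsto_atTop.1 (hx δ hδ) (η / 2) (half_pos hη)
  refine ⟨N, fun j hj => ?_⟩
  have h1 := hN j hj
  have h2 := h (D (n j)) (Y (n j)) (hY _) (hn j)
  rw [Real.dist_0_eq_abs, abs_of_nonneg measureReal_nonneg] at h1 ⊢
  linarith

/-- If the trajectories `Y (n j)` converge to `x` at time `s` in probability, then a subsequence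
converges almost surely, as a sequence of paths, to a continuous version of the trajectory which
starts at `(s, x)`. Tightness is provided by the skeleton property. -/
lemma exists_subseq_tendsto_version (hP : IsConsistentCoalescing P) (hψ : IsStochasticFlow P μ ψ)
    (hY : ∀ n, IsVersion μ ψ (D n) (Y n)) (hsk : ∀ᵐ ω ∂μ, IsSkeleton fun n => Y n ω)
    {s : ℝ} {x : M} {n : ℕ → ℕ} (hn : ∀ j, (D (n j)).1 ≤ s)
    (hx : TendstoInMeasure μ (fun j ω => val (Y (n j) ω) s) atTop fun _ => x) :
    ∃ φ : ℕ → ℕ, StrictMono φ ∧ ∃ Z, IsVersion μ ψ (s, x) Z ∧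
      ∀ᵐ ω ∂μ, Tendsto (fun j => restrictFrom (Y (n (φ j)) ω) s) atTop (𝓝 (Z ω)) := by
  have hT : ∀ i, TendstoInMeasure μ (fun j ω => val (Y (n j) ω) (denseTimes s i)) atTop
      fun ω => (ψ s (denseTimes s i) ω).1 x := fun i =>
    tendstoInMeasure_version hP hψ hY hn hx (le_denseTimes s i)
  -- a subsequence along which the first `k` times are controlled at the `k`-th step
  obtain ⟨φ, hφ, hφ'⟩ := extraction_forall_of_eventually
    (P := fun k j => μ (⋃ i ∈ Finset.range (k + 1), {ω | (2 : ℝ)⁻¹ ^ k ≤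
      dist (val (Y (n j) ω) (denseTimes s i)) ((ψ s (denseTimes s i) ω).1 x)}) ≤ (2 : ℝ≥0∞)⁻¹ ^ k)
    (fun k => by
      have h1 : Tendsto (fun j => ∑ i ∈ Finset.range (k + 1), μ {ω | (2 : ℝ)⁻¹ ^ k ≤
          dist (val (Y (n j) ω) (denseTimes s i)) ((ψ s (denseTimes s i) ω).1 x)}) atTop
          (𝓝 (∑ i ∈ Finset.range (k + 1), 0)) :=
        tendsto_finsetSum _ fun i _ => tendstoInMeasure_iff_dist.1 (hT i) _ (by positivity)
      rw [Finset.sum_const_zero] at h1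
      have h2 : (0 : ℝ≥0∞) < (2 : ℝ≥0∞)⁻¹ ^ k := by
        exact pos_iff_ne_zero.2 (pow_ne_zero _ (by simp))
      filter_upwards [h1.eventually (gt_mem_nhds h2)] with j hj
      exact (measure_biUnion_finset_le _ _).trans hj.le)
  refine ⟨φ, hφ, ?_⟩
  have hsum : (∑' k, (2 : ℝ≥0∞)⁻¹ ^ k) ≠ ⊤ := by
    rw [ENNReal.tsum_geometric]; simp
  have hae := ae_eventually_notMem (ne_top_of_le_ne_top hsum (ENNReal.tsum_le_tsum hφ'))
  have hlim : ∀ᵐ ω ∂μ, ∃ f, Tendsto (fun j => restrictFrom (Y (n (φ j)) ω) s) atTop (𝓝 f) := by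
    filter_upwards [hae, hsk, hψ.flow.choose_spec.2.2.2 s x] with ω hω hsω hsx
    have hpt : ∀ i, Tendsto (fun k => val (Y (n (φ k)) ω) (denseTimes s i)) atTop
        (𝓝 ((ψ s (denseTimes s i) ω).1 x)) := by
      intro i
      rw [tendsto_iff_dist_tendsto_zero]
      refine squeeze_zero' (Eventually.of_forall fun _ => dist_nonneg) ?_
        (tendsto_pow_atTop_nhds_zero_of_lt_one (r := (2 : ℝ)⁻¹) (by norm_num) (by norm_num))
      filter_upwards [hω, eventually_ge_atTop i] with k hk hik
      simp only [mem_iUnion, not_exists] at hk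
      exact (not_le.1 (hk i (by simp; omega))).le
    have hK := hsω.relCompact ({s} ×ˢ Metric.closedBall x 1)
      (isCompact_singleton.prod (isCompact_closedBall x 1))
    have h0 := hpt 0
    simp only [denseTimes, hsx] at h0
    refine exists_tendsto_of_denseTimes (s := s) hK ?_ (fun k => rfl)
      (y := fun i => (ψ s (denseTimes s i) ω).1 x) fun i => ?_
    · filter_upwards [h0.eventually (Metric.closedBall_mem_nhds x one_pos)] with k hk
      exact subset_closure ⟨n (φ k), s, ((hY _).start_eq ω).trans_le (hn _), ⟨rfl, hk⟩, rfl⟩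
    · simpa only [val_restrictFrom, max_eq_right (le_denseTimes s i)] using hpt i
  have hmeas : ∀ j, Measurable fun ω => restrictFrom (Y (n (φ j)) ω) s := fun j =>
    (continuous_restrictFrom_uncurry.comp (by fun_prop : Continuous fun f : PathSpace M =>
      (f, s))).measurable.comp (hY _).measurable
  obtain ⟨Z₀, hZ₀m, hZ₀⟩ := measurable_limit_of_tendsto_metrizable_ae
    (fun j => (hmeas j).aemeasurable) hlim
  classical
  -- on the exceptional event, the constant path is used
  let A : Set (PathSpace M) := {f | start f = s ∧ val f s = x}
  have hA : MeasurableSet A := ((isClosed_eq continuous_start continuous_const).inter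
    (isClosed_eq (continuous_val_left s) continuous_const)).measurableSet
  let g : PathSpace M → PathSpace M := fun f => if f ∈ A then f else constPath s x
  have hg : Measurable g := Measurable.ite hA measurable_id measurable_const
  have hgA : ∀ f, start (g f) = s ∧ val (g f) s = x := by
    intro f
    by_cases hf : f ∈ A
    · simp only [g, if_pos hf]; exact hf
    · simp only [g, if_neg hf]; exact ⟨rfl, rfl⟩
  have hval : ∀ t, s ≤ t → (fun ω => val (Z₀ ω) t) =ᵐ[μ] fun ω => (ψ s t ω).1 x := by
    intro t ht
    refine tendstoInMeasure_ae_unique (u := atTop) (tendstoInMeasure_of_tendsto_ae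
      (f := fun j ω => val (Y (n (φ j)) ω) t) (fun j =>
        ((hY _).measurable_val t).aestronglyMeasurable) ?_)
      (tendstoInMeasure_version hP hψ hY (n := n ∘ φ) (fun j => hn _)
        (hx.comp hφ.tendsto_atTop) ht)
    filter_upwards [hZ₀] with ω hω
    have := ((continuous_val_left t).tendsto _).comp hω
    simpa only [Function.comp_def, val_restrictFrom, max_eq_right ht] using this
  have hgZ : ∀ᵐ ω ∂μ, g (Z₀ ω) = Z₀ ω := by
    filter_upwards [hZ₀, hval s le_rfl, hψ.flow.choose_spec.2.2.2 s x] with ω h1 h2 h3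
    refine if_pos ⟨?_, h2.trans h3⟩
    exact tendsto_nhds_unique ((continuous_start.tendsto _).comp h1) tendsto_const_nhds
  refine ⟨fun ω => g (Z₀ ω), ⟨hg.comp hZ₀m, fun ω => (hgA _).1, fun ω => (hgA _).2, ?_⟩, ?_⟩
  · intro t ht
    filter_upwards [hgZ, hval t ht] with ω h1 h2
    rw [h1, h2]
  · filter_upwards [hgZ, hZ₀] with ω h1 h2
    rwa [h1]

/-- Indices whose starting points approach `(s, x)` from the past. -/
lemma exists_index_seq (hP : IsConsistentCoalescing P) (hψ : IsStochasticFlow P μ ψ)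
    (hD : DenseRange D) (hY : ∀ n, IsVersion μ ψ (D n) (Y n)) (s : ℝ) (x : M) :
    ∃ n : ℕ → ℕ, (∀ j, (D (n j)).1 ≤ s) ∧
      TendstoInMeasure μ (fun j ω => val (Y (n j) ω) s) atTop fun _ => x := by
  have hex : ∀ δ > 0, ∃ n, (D n).1 ≤ s ∧ s - (D n).1 < δ ∧ dist (D n).2 x < δ := by
    intro δ hδ
    have ho : IsOpen (Ioo (s - δ) s ×ˢ Metric.ball x δ) := isOpen_Ioo.prod Metric.isOpen_ball
    obtain ⟨n, hn⟩ := hD.exists_mem_open ho ⟨(s - δ / 2, x),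
      ⟨by linarith, by linarith⟩, Metric.mem_ball_self hδ⟩
    exact ⟨n, hn.1.2.le, by linarith [hn.1.1], hn.2⟩
  choose n hn1 hn2 hn3 using fun j : ℕ => hex (1 / ((j : ℝ) + 1)) (by positivity)
  refine ⟨n, hn1, ?_⟩
  rw [tendstoInMeasure_iff_measureReal_dist]
  intro r hr
  rw [Metric.tendsto_atTop]
  intro η hη
  obtain ⟨δ, hδ, h⟩ := exists_measureReal_dist_le hP hψ s x hr (half_pos hη)
  obtain ⟨N, hN⟩ := exists_nat_one_div_lt hδ
  refine ⟨N, fun j hj => ?_⟩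
  have hNj : 1 / ((j : ℝ) + 1) ≤ 1 / ((N : ℝ) + 1) := by gcongr
  have h1 := h (D (n j)).1 (hn1 j) (D (n j)).2 ((hn2 j).trans_le (hNj.trans hN.le))
    ((hn3 j).trans_le (hNj.trans hN.le))
  have h2 : μ.real {ω | r ≤ dist (val (Y (n j) ω) s) x} =
      μ.real {ω | r ≤ dist ((ψ (D (n j)).1 s ω).1 (D (n j)).2) x} := by
    refine measureReal_congr ?_
    filter_upwards [(hY (n j)).modification s (hn1 j)] with ω hω
    apply propext
    change r ≤ dist (val (Y (n j) ω) s) x ↔ r ≤ dist ((ψ (D (n j)).1 s ω).1 (D (n j)).2) x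
    rw [hω]
  rw [Real.dist_0_eq_abs, abs_of_nonneg measureReal_nonneg, h2]
  linarith

omit [ProperSpace M] [BorelSpace M] [IsProbabilityMeasure μ] in
/-- Two continuous versions of the same trajectory are indistinguishable. -/
lemma IsVersion.ae_eq {p : ℝ × M} {Z Z' : Ω → PathSpace M} (h : IsVersion μ ψ p Z)
    (h' : IsVersion μ ψ p Z') : Z =ᵐ[μ] Z' := by
  filter_upwards [ae_all_iff.2 fun i => h.modification _ (le_denseTimes p.1 i),
    ae_all_iff.2 fun i => h'.modification _ (le_denseTimes p.1 i)] with ω h1 h2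
  refine path_ext ((h.start_eq ω).trans (h'.start_eq ω).symm) fun t ht => ?_
  refine eq_of_denseTimes (continuous_val_right _) (continuous_val_right _) (fun i => ?_)
    ((h.start_eq ω) ▸ ht)
  rw [h1, h2]

/-- Every space-time point is the starting point of a continuous version, which is an almost sure
limit of paths of the family `Y`. -/
lemma exists_version (hP : IsConsistentCoalescing P) (hψ : IsStochasticFlow P μ ψ)
    (hD : DenseRange D) (hY : ∀ n, IsVersion μ ψ (D n) (Y n))
    (hsk : ∀ᵐ ω ∂μ, IsSkeleton fun n => Y n ω) (s : ℝ) (x : M) :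
    ∃ Z, IsVersion μ ψ (s, x) Z ∧ ∃ n : ℕ → ℕ, (∀ j, (D (n j)).1 ≤ s) ∧
      ∀ᵐ ω ∂μ, Tendsto (fun j => restrictFrom (Y (n j) ω) s) atTop (𝓝 (Z ω)) := by
  obtain ⟨n, hn, hx⟩ := exists_index_seq hP hψ hD hY s x
  obtain ⟨φ, -, Z, hZ, hZ'⟩ := exists_subseq_tendsto_version hP hψ hY hsk hn hx
  exact ⟨Z, hZ, n ∘ φ, fun j => hn _, hZ'⟩

end Existence

/-! ### Laws of pairs of trajectories -/

section Laws

variable {M : Type*} [MetricSpace M] [ProperSpace M] [MeasurableSpace M] [BorelSpace M]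

lemma integral_bind_kernel {α β : Type*} [MeasurableSpace α] [MeasurableSpace β] {ν : Measure α}
    {κ : Kernel α β} {f : β → ℝ} (hf : Integrable f (ν.bind κ)) :
    ∫ y, f y ∂(ν.bind κ) = ∫ x, ∫ y, f y ∂(κ x) ∂ν := by
  have h : ν.bind κ = (κ ∘ₖ Kernel.const Unit ν) () := by
    rw [Kernel.comp_apply, Kernel.const_apply]
  rw [h] at hf ⊢
  rw [Kernel.integral_comp hf, Kernel.const_apply]

/-- The Markov property may be tested on measurable sets or on functions in `C₀`. -/
lemma isMarkovMeasure_iff {n : ℕ} {P : ℝ≥0 → Kernel (Fin n → M) (Fin n → M)}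
    (hP : IsFellerTransition P) {ν : Measure C(ℝ≥0, Fin n → M)} [IsFiniteMeasure ν] :
    IsMarkovMeasure P ν ↔ ∀ (u h : ℝ≥0) (A : Set (Fin n → M)) (B : Set C(ℝ≥0, Fin n → M)),
      MeasurableSet A → MeasurableSet[canonicalSigma M n u] B →
        ν (B ∩ {w | w (u + h) ∈ A}) = ∫⁻ w in B, P h (w u) A ∂ν := by
  have hmk := hP.markov
  have h1 : ∀ (u h : ℝ≥0) (B : Set C(ℝ≥0, Fin n → M)) (A : Set (Fin n → M)), MeasurableSet A →
      ((ν.restrict B).map fun w => w (u + h)) A = ν (B ∩ {w | w (u + h) ∈ A}) := by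
    intro u h B A hA
    rw [Measure.map_apply (measurable_eval_path _) hA,
      Measure.restrict_apply (measurable_eval_path _ hA), inter_comm]
    rfl
  have h2 : ∀ (u h : ℝ≥0) (B : Set C(ℝ≥0, Fin n → M)) (A : Set (Fin n → M)), MeasurableSet A →
      (((ν.restrict B).map fun w => w u).bind (P h)) A = ∫⁻ w in B, P h (w u) A ∂ν := by
    intro u h B A hA
    rw [Measure.bind_apply hA (Kernel.aemeasurable _),
      lintegral_map (Kernel.measurable_coe _ hA) (measurable_eval_path _)]
  have h3 : ∀ (u h : ℝ≥0) (B : Set C(ℝ≥0, Fin n → M)) (F : C₀(Fin n → M, ℝ)),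
      ∫ z, F z ∂((ν.restrict B).map fun w => w (u + h)) = ∫ w in B, F (w (u + h)) ∂ν :=
    fun u h B F => integral_map (measurable_eval_path _).aemeasurable
      F.continuous.measurable.aestronglyMeasurable
  have h4 : ∀ (u h : ℝ≥0) (B : Set C(ℝ≥0, Fin n → M)) (F : C₀(Fin n → M, ℝ)),
      ∫ z, F z ∂(((ν.restrict B).map fun w => w u).bind (P h)) =
        ∫ w in B, ∫ z, F z ∂(P h (w u)) ∂ν := by
    intro u h B F
    rw [integral_bind_kernel (integrable_zeroAtInfty F), integral_map
      (measurable_eval_path _).aemeasurable]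
    have hS : StronglyMeasurable fun x : Fin n → M => ∫ y, F y ∂(P h x) :=
      F.continuous.stronglyMeasurable.integral_kernel
    exact hS.aestronglyMeasurable
  constructor
  · intro hν u h A B hA hB
    rw [← h1 u h B A hA, ← h2 u h B A hA]
    congr 1
    exact measure_ext_zeroAtInfty fun F => by rw [h3, h4, hν u h F B hB]
  · intro hν u h F B hB
    rw [← h3, ← h4]
    congr 1
    exact Measure.ext fun A hA => by rw [h1 _ _ _ _ hA, h2 _ _ _ _ hA, hν u h A B hA hB]

/-- The pair of two paths, restarted at time `r`. -/
def pairPath {M : Type*} [TopologicalSpace M] (f g : PathSpace M) (r : ℝ) : C(ℝ≥0, Fin 2 → M) :=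
  ⟨fun t => ![val f (r + t), val g (r + t)], by
    have h1 := continuous_val_right f
    have h2 := continuous_val_right g
    fun_prop⟩

lemma pairPath_apply {M : Type*} [TopologicalSpace M] (f g : PathSpace M) (r : ℝ) (t : ℝ≥0) :
    pairPath f g r t = ![val f (r + t), val g (r + t)] := rfl

lemma measurable_pairPath {Ω : Type*} {m : MeasurableSpace Ω} {f g : Ω → PathSpace M} {r : Ω → ℝ}
    (hf : Measurable f) (hg : Measurable g) (hr : Measurable r) :
    Measurable fun ω => pairPath (f ω) (g ω) (r ω) := by
  refine measurable_continuousMap_iff.2 fun t => measurable_pi_lambda _ fun i => ?_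
  fin_cases i
  · exact continuous_val_uncurry.measurable.comp (hf.prodMk (hr.add_const _))
  · exact continuous_val_uncurry.measurable.comp (hg.prodMk (hr.add_const _))

variable {Ω : Type*} [MeasurableSpace Ω] {μ : Measure Ω} [IsProbabilityMeasure μ]
  {P : (n : ℕ) → ℝ≥0 → Kernel (Fin n → M) (Fin n → M)} {ψ : ℝ → ℝ → Ω → MeasMap M}
  {ι : Type*} {D : ι → ℝ × M} {Y : ι → Ω → PathSpace M}

omit [ProperSpace M] [BorelSpace M] [MeasurableSpace Ω] in
lemma measurable_pairPath_pastSigma {a b : ι} {r : ℝ} (ha : (D a).1 ≤ r) (hb : (D b).1 ≤ r)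
    {u : ℝ≥0} : Measurable[pastSigma D Y (r + u), canonicalSigma M 2 u]
      fun ω => pairPath (Y a ω) (Y b ω) r := by
  refine measurable_canonicalSigma_iff.2 fun v hv => ?_
  have hv' : r + (v : ℝ) ≤ r + u := by simpa using hv
  refine @measurable_pi_lambda Ω (Fin 2) (fun _ => M) (pastSigma _ _ _) _ _ fun i => ?_
  fin_cases i
  · exact measurable_val_pastSigma (ha.trans (by simp)) hv'
  · exact measurable_val_pastSigma (hb.trans (by simp)) hv'

/-- On an event of the past at time `r`, a pair of trajectories restarted at time `r` is a Markov
process with transition function `P 2`. -/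
lemma isMarkovMeasure_map_pairPath (hψ : IsStochasticFlow P μ ψ)
    (hY : ∀ a, IsVersion μ ψ (D a) (Y a)) {a b : ι} {r : ℝ} (ha : (D a).1 ≤ r) (hb : (D b).1 ≤ r)
    {B : Set Ω} (hB : MeasurableSet[pastSigma D Y r] B) :
    IsMarkovMeasure (P 2) ((μ.restrict B).map fun ω => pairPath (Y a ω) (Y b ω) r) := by
  intro u h F B' hB'
  have hm : Measurable fun ω => pairPath (Y a ω) (Y b ω) r :=
    measurable_pairPath (hY a).measurable (hY b).measurable measurable_const
  have hB'm : MeasurableSet B' := canonicalSigma_le u B' hB'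
  have hpre : MeasurableSet[pastSigma D Y (r + u)]
      ((fun ω => pairPath (Y a ω) (Y b ω) r) ⁻¹' B' ∩ B) :=
    (measurable_pairPath_pastSigma ha hb hB').inter (pastSigma_mono (by simp) _ hB)
  have hmF : Measurable fun w : C(ℝ≥0, Fin 2 → M) => F (w (u + h)) :=
    F.continuous.measurable.comp (measurable_eval_path _)
  have hS : StronglyMeasurable fun x : Fin 2 → M => ∫ y, F y ∂(P 2 h x) :=
    F.continuous.stronglyMeasurable.integral_kernel
  have hmS : Measurable fun w : C(ℝ≥0, Fin 2 → M) => ∫ y, F y ∂(P 2 h (w u)) :=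
    hS.measurable.comp (measurable_eval_path _)
  rw [setIntegral_map hB'm hmF.aestronglyMeasurable hm.aemeasurable,
    setIntegral_map hB'm hmS.aestronglyMeasurable hm.aemeasurable,
    Measure.restrict_restrict (hm hB'm)]
  have key := setIntegral_version_eq hψ hY ![a, b] (v := r + u) h (fun i => by
    fin_cases i
    · exact ha.trans (by simp)
    · exact hb.trans (by simp)) hpre F
  convert key using 3 with ω ω
  · rw [pairPath_apply]
    congr 1
    ext i
    fin_cases i <;> simp [add_assoc]
  · rw [pairPath_apply]
    congr 2
    ext i
    fin_cases i <;> simp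

/-- The law of a pair of trajectories which start at the same time. -/
lemma isMarkovLaw_map_pairPath (hP : IsConsistentCoalescing P) (hψ : IsStochasticFlow P μ ψ) {r : ℝ}
    {x y : M} {Z Z' : Ω → PathSpace M} (hZ : IsVersion μ ψ (r, x) Z)
    (hZ' : IsVersion μ ψ (r, y) Z') :
    IsMarkovLaw (P 2) ![x, y] (μ.map fun ω => pairPath (Z ω) (Z' ω) r) := by
  have hm : Measurable fun ω => pairPath (Z ω) (Z' ω) r :=
    measurable_pairPath hZ.measurable hZ'.measurable measurable_const
  have hprob : IsProbabilityMeasure (μ.map fun ω => pairPath (Z ω) (Z' ω) r) :=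
    Measure.isProbabilityMeasure_map hm.aemeasurable
  have hV : ∀ i : Bool, IsVersion μ ψ ((r, if i then x else y) : ℝ × M) (if i then Z else Z') := by
    rintro (_ | _)
    · exact hZ'
    · exact hZ
  have key := isMarkovMeasure_map_pairPath hψ hV (a := true) (b := false) (r := r) le_rfl le_rfl
    (B := univ) MeasurableSet.univ
  rw [Measure.restrict_univ] at key
  refine ⟨hprob, ?_, fun s t A B hA hB =>
    (isMarkovMeasure_iff (hP.feller 2)).1 key s t A B hA hB⟩
  rw [ae_map_iff hm.aemeasurable (measurableSet_eq_fun (measurable_eval_path 0) measurable_const)]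
  refine Eventually.of_forall fun ω => ?_
  rw [pairPath_apply]
  simp [hZ.val_start ω, hZ'.val_start ω]

lemma IsMarkovLaw.hasFDD {n : ℕ} {P : ℝ≥0 → Kernel (Fin n → M) (Fin n → M)}
    (hP : IsFellerTransition P) {z : Fin n → M} {Q : Measure C(ℝ≥0, Fin n → M)}
    (hQ : IsMarkovLaw P z Q) : HasFDD hP Q :=
  have := hQ.prob
  ((isMarkovMeasure_iff hP).2 fun u h A B hA hB => hQ.markov u h A B hA hB).hasFDD hP

/-- The law which is selected in the definition of `markovLaw` is that of a pair of continuous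
versions. -/
lemma markovLaw_eq_map (hP : IsConsistentCoalescing P) (hψ : IsStochasticFlow P μ ψ) {r : ℝ}
    {x y : M} {Z Z' : Ω → PathSpace M} (hZ : IsVersion μ ψ (r, x) Z)
    (hZ' : IsVersion μ ψ (r, y) Z') :
    markovLaw (P 2) ![x, y] = μ.map fun ω => pairPath (Z ω) (Z' ω) r := by
  have h := isMarkovLaw_map_pairPath hP hψ hZ hZ'
  have hex : ∃ Q, IsMarkovLaw (P 2) ![x, y] Q := ⟨_, h⟩
  rw [markovLaw, dif_pos hex]
  have := h.prob
  have := hex.choose_spec.prob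
  exact HasFDD.ext (hP := hP.feller 2) (hex.choose_spec.hasFDD _) (h.hasFDD _)
    hex.choose_spec.init h.init

omit [ProperSpace M] [BorelSpace M] in
lemma IsMarkovLaw.markovLaw {n : ℕ} {P : ℝ≥0 → Kernel (Fin n → M) (Fin n → M)} {z : Fin n → M}
    {Q : Measure C(ℝ≥0, Fin n → M)} (hQ : IsMarkovLaw P z Q) : IsMarkovLaw P z (markovLaw P z) := by
  have hex : ∃ Q, IsMarkovLaw P z Q := ⟨Q, hQ⟩
  rw [StrongFlow.markovLaw, dif_pos hex]
  exact hex.choose_spec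

end Laws

/-! ### Distances on path space -/

section Metrizes

variable {M : Type*} [MetricSpace M] {d : C(ℝ, M) → C(ℝ, M) → ℝ}

lemma MetrizesPaths.self (hd : MetrizesPaths d) (f : C(ℝ, M)) : d f f = 0 := by
  obtain ⟨m, -, h⟩ := hd
  rw [← h]; exact m.dist_self f

lemma MetrizesPaths.comm (hd : MetrizesPaths d) (f g : C(ℝ, M)) : d f g = d g f := by
  obtain ⟨m, -, h⟩ := hd
  rw [← h, ← h]; exact m.dist_comm f g

lemma MetrizesPaths.triangle (hd : MetrizesPaths d) (f g h : C(ℝ, M)) :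
    d f h ≤ d f g + d g h := by
  obtain ⟨m, -, e⟩ := hd
  rw [← e, ← e, ← e]; exact m.dist_triangle f g h

lemma MetrizesPaths.nonneg (hd : MetrizesPaths d) (f g : C(ℝ, M)) : 0 ≤ d f g := by
  have h1 := hd.triangle f g f
  rw [hd.self, hd.comm g f] at h1
  linarith

lemma MetrizesPaths.continuous (hd : MetrizesPaths d) :
    Continuous fun p : C(ℝ, M) × C(ℝ, M) => d p.1 p.2 := by
  obtain ⟨m, hm, h⟩ := hd
  have h1 : @Continuous _ _ (@instTopologicalSpaceProd _ _ m.toUniformSpace.toTopologicalSpace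
      m.toUniformSpace.toTopologicalSpace) _ fun p : C(ℝ, M) × C(ℝ, M) => m.dist p.1 p.2 :=
    @continuous_dist C(ℝ, M) m.toPseudoMetricSpace
  rw [hm] at h1
  simpa only [h] using h1

lemma MetrizesPaths.tendsto_iff (hd : MetrizesPaths d) {α : Type*} {l : Filter α}
    {u : α → C(ℝ, M)} {f : C(ℝ, M)} :
    Tendsto u l (𝓝 f) ↔ Tendsto (fun a => d (u a) f) l (𝓝 0) := by
  obtain ⟨m, hm, h⟩ := hd
  have h1 := @tendsto_iff_dist_tendsto_zero C(ℝ, M) α m.toPseudoMetricSpace u l f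
  rw [hm] at h1
  simpa only [h] using h1

end Metrizes

section

variable {M Ω : Type*} [MetricSpace M] [ProperSpace M] [MeasurableSpace M] [BorelSpace M]
  [MeasurableSpace Ω] {μ : Measure Ω} [IsProbabilityMeasure μ]
  {P : (n : ℕ) → ℝ≥0 → Kernel (Fin n → M) (Fin n → M)} {ψ : ℝ → ℝ → Ω → MeasMap M}
  {D : ℕ → ℝ × M} {Y : ℕ → Ω → PathSpace M} {d : C(ℝ, M) → C(ℝ, M) → ℝ}

/-- The distance between two paths, as elements of `C(ℝ, M)`. -/
def pathDist {M : Type*} [TopologicalSpace M] (d : C(ℝ, M) → C(ℝ, M) → ℝ) (f g : PathSpace M) :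
    ℝ :=
  d f.1.2 g.1.2

lemma continuous_pathDist {M : Type*} [MetricSpace M] {d : C(ℝ, M) → C(ℝ, M) → ℝ}
    (hd : MetrizesPaths d) : Continuous fun q : PathSpace M × PathSpace M => pathDist d q.1 q.2 :=
  hd.continuous.comp (f := fun q : PathSpace M × PathSpace M => (q.1.1.2, q.2.1.2)) (by fun_prop)

omit [MeasurableSpace M] [BorelSpace M] in
lemma measurable_pathDist (hd : MetrizesPaths d) {f g : Ω → PathSpace M} (hf : Measurable f)
    (hg : Measurable g) : Measurable fun ω => pathDist d (f ω) (g ω) :=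
  (continuous_pathDist hd).measurable.comp (hf.prodMk hg)

lemma tendsto_measureReal_of_ae_tendsto {u : ℕ → Ω → ℝ} (hu : ∀ j, Measurable (u j))
    (h0 : ∀ j ω, 0 ≤ u j ω) (h : ∀ᵐ ω ∂μ, Tendsto (fun j => u j ω) atTop (𝓝 0)) {η : ℝ}
    (hη : 0 < η) : Tendsto (fun j => μ.real {ω | η ≤ u j ω}) atTop (𝓝 0) := by
  have h1 := tendstoInMeasure_of_tendsto_ae (fun j => (hu j).aestronglyMeasurable) h
  have h2 := tendstoInMeasure_iff_measureReal_dist.1 h1 η hη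
  simpa only [Real.dist_0_eq_abs, abs_of_nonneg (h0 _ _)] using h2

omit [ProperSpace M] [MeasurableSpace M] [BorelSpace M] in
lemma tendsto_pathDist_restrict (hd : MetrizesPaths d) {u : ℕ → PathSpace M} {f : PathSpace M}
    (h : Tendsto u atTop (𝓝 f)) : Tendsto (fun j => pathDist d (u j) f) atTop (𝓝 0) :=
  hd.tendsto_iff.1 ((continuous_snd.comp continuous_subtype_val).tendsto f |>.comp h)

/-- The trajectories depend continuously in probability on the starting point, with respect to
uniform convergence on compact sets. -/
lemma tendsto_measureReal_pathDist (hP : IsConsistentCoalescing P) (hψ : IsStochasticFlow P μ ψ)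
    (hD : DenseRange D) (hY : ∀ n, IsVersion μ ψ (D n) (Y n))
    (hsk : ∀ᵐ ω ∂μ, IsSkeleton fun n => Y n ω) (hd : MetrizesPaths d) {s : ℝ} {x : M}
    {V : M → Ω → PathSpace M} (hV : ∀ y, IsVersion μ ψ (s, y) (V y)) {η : ℝ} (hη : 0 < η) :
    Tendsto (fun y => μ.real {ω | η ≤ pathDist d (V y ω) (V x ω)}) (𝓝 x) (𝓝 0) := by
  refine tendsto_of_subseq_tendsto fun ys hys => ?_
  have hmr : ∀ n, Measurable fun ω => restrictFrom (Y n ω) s := fun n =>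
    (continuous_restrictFrom_uncurry.comp (by fun_prop : Continuous fun f : PathSpace M =>
      (f, s))).measurable.comp (hY n).measurable
  -- approximation of the trajectory of `ys j` by a path of the skeleton
  have happ : ∀ j : ℕ, ∃ n, (D n).1 ≤ s ∧
      μ.real {ω | 1 / ((j : ℝ) + 1) ≤ pathDist d (restrictFrom (Y n ω) s) (V (ys j) ω)} <
        1 / ((j : ℝ) + 1) ∧
      μ.real {ω | 1 / ((j : ℝ) + 1) ≤ dist (val (Y n ω) s) (ys j)} < 1 / ((j : ℝ) + 1) := by
    intro j
    obtain ⟨Z, hZ, n, hn, hZn⟩ := exists_version hP hψ hD hY hsk s (ys j)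
    have hj : 0 < 1 / ((j : ℝ) + 1) := by positivity
    have h1 := tendsto_measureReal_of_ae_tendsto (μ := μ)
      (u := fun i ω => pathDist d (restrictFrom (Y (n i) ω) s) (V (ys j) ω))
      (fun i => measurable_pathDist hd (hmr _) (hV _).measurable) (fun _ _ => hd.nonneg _ _) (by
        filter_upwards [hZn, hZ.ae_eq (hV (ys j))] with ω e1 e2
        rw [e2] at e1
        exact tendsto_pathDist_restrict hd e1) hj
    have h2 := tendsto_measureReal_of_ae_tendsto (μ := μ)
      (u := fun i ω => dist (val (Y (n i) ω) s) (ys j))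
      (fun i => ((hY _).measurable_val s).dist measurable_const) (fun _ _ => dist_nonneg) (by
        filter_upwards [hZn] with ω e1
        have e3 := ((continuous_val_left s).tendsto _).comp e1
        rw [hZ.val_start] at e3
        refine tendsto_iff_dist_tendsto_zero.1 ?_
        simpa only [Function.comp_def, val_restrictFrom, max_self] using e3) hj
    obtain ⟨i, hi1, hi2⟩ := ((h1.eventually (gt_mem_nhds hj)).and
      (h2.eventually (gt_mem_nhds hj))).exists
    exact ⟨n i, hn i, hi1, hi2⟩
  choose n hn happ1 happ2 using happ
  have h0 : Tendsto (fun j : ℕ => 1 / ((j : ℝ) + 1)) atTop (𝓝 0) :=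
    tendsto_one_div_add_atTop_nhds_zero_nat
  have hx : TendstoInMeasure μ (fun j ω => val (Y (n j) ω) s) atTop fun _ => x := by
    rw [tendstoInMeasure_iff_measureReal_dist]
    intro r hr
    refine squeeze_zero' (Eventually.of_forall fun _ => measureReal_nonneg) ?_ h0
    filter_upwards [h0.eventually (gt_mem_nhds (half_pos hr)),
      hys.eventually (Metric.ball_mem_nhds x (half_pos hr))] with j hj1 hj2
    refine (measureReal_mono fun ω hω => ?_).trans (happ2 j).le
    have h3 : r ≤ dist (val (Y (n j) ω) s) x := hω
    have h4 : dist (ys j) x < r / 2 := hj2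
    change 1 / ((j : ℝ) + 1) ≤ dist (val (Y (n j) ω) s) (ys j)
    linarith [dist_triangle (val (Y (n j) ω) s) (ys j) x]
  obtain ⟨φ, hφ, Z, hZ, hZφ⟩ := exists_subseq_tendsto_version hP hψ hY hsk hn hx
  -- along the subsequence, both `V x` and `V (ys j)` are close to the same path of the skeleton
  refine ⟨φ, ?_⟩
  have h1 := tendsto_measureReal_of_ae_tendsto (μ := μ)
    (u := fun i ω => pathDist d (restrictFrom (Y (n (φ i)) ω) s) (V x ω))
    (fun i => measurable_pathDist hd (hmr _) (hV _).measurable) (fun _ _ => hd.nonneg _ _) (by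
      filter_upwards [hZφ, hZ.ae_eq (hV x)] with ω e1 e2
      rw [e2] at e1
      exact tendsto_pathDist_restrict hd e1) (half_pos hη)
  have h2 := h1.add (h0.comp hφ.tendsto_atTop)
  rw [add_zero] at h2
  refine squeeze_zero' (Eventually.of_forall fun _ => measureReal_nonneg) ?_ h2
  filter_upwards [(h0.comp hφ.tendsto_atTop).eventually (gt_mem_nhds (half_pos hη))] with j hj
  simp only [Function.comp_def] at hj
  refine (measureReal_mono
    (s₂ := {ω | η / 2 ≤ pathDist d (restrictFrom (Y (n (φ j)) ω) s) (V x ω)} ∪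
    {ω | 1 / ((φ j : ℝ) + 1) ≤ pathDist d (restrictFrom (Y (n (φ j)) ω) s) (V (ys (φ j)) ω)})
    fun ω hω => ?_).trans ((measureReal_union_le _ _).trans (add_le_add le_rfl (happ1 _).le))
  by_contra hcon
  simp only [mem_union, mem_ofPred_eq, not_or, not_le] at hcon hω
  have h3 := hd.triangle (V (ys (φ j)) ω).1.2 (restrictFrom (Y (n (φ j)) ω) s).1.2 (V x ω).1.2
  rw [hd.comm (V (ys (φ j)) ω).1.2 (restrictFrom _ _).1.2] at h3
  simp only [pathDist] at hcon hω
  linarith [hcon.1, hcon.2]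

/-! ### The functions `ε_k` are positive and measurable -/

omit [MeasurableSpace M] [BorelSpace M] in
/-- Upper semicontinuity of `(y, z) ↦ μ(d(V y, V z) ≥ η)`. -/
lemma isClosed_measureReal_pathDist (hd : MetrizesPaths d) {V : M → Ω → PathSpace M}
    (hVm : ∀ y, Measurable (V y))
    (hV : ∀ x, ∀ ε > 0, Tendsto (fun y => μ.real {ω | ε ≤ pathDist d (V y ω) (V x ω)}) (𝓝 x) (𝓝 0))
    (η c : ℝ) :
    IsClosed {q : M × M | c ≤ μ.real {ω | η ≤ pathDist d (V q.1 ω) (V q.2 ω)}} := by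
  refine IsSeqClosed.isClosed ?_
  intro q p hq hqp
  have hq1 : Tendsto (fun j => (q j).1) atTop (𝓝 p.1) := (continuous_fst.tendsto p).comp hqp
  have hq2 : Tendsto (fun j => (q j).2) atTop (𝓝 p.2) := (continuous_snd.tendsto p).comp hqp
  -- the bound passes to the limit at the cost of a loss `2 ε` in the threshold, one `ε` per argument
  have key : ∀ ε > 0, c ≤ μ.real {ω | η - 2 * ε ≤ pathDist d (V p.1 ω) (V p.2 ω)} := by
    intro ε hε
    have h1 := ((hV p.1 ε hε).comp hq1).add ((hV p.2 ε hε).comp hq2)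
    have h2 := h1.const_add (μ.real {ω | η - 2 * ε ≤ pathDist d (V p.1 ω) (V p.2 ω)})
    simp only [add_zero] at h2
    refine ge_of_tendsto h2 (Eventually.of_forall fun j => (hq j).trans ?_)
    refine (measureReal_mono (s₂ := {ω | η - 2 * ε ≤ pathDist d (V p.1 ω) (V p.2 ω)} ∪
      ({ω | ε ≤ pathDist d (V (q j).1 ω) (V p.1 ω)} ∪
        {ω | ε ≤ pathDist d (V (q j).2 ω) (V p.2 ω)})) fun ω hω => ?_).trans
        ((measureReal_union_le _ _).trans (add_le_add le_rfl (measureReal_union_le _ _)))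
    by_contra hcon
    simp only [mem_union, mem_ofPred_eq, not_or, not_le, pathDist] at hcon hω
    have h3 := hd.triangle (V (q j).1 ω).1.2 (V p.1 ω).1.2 (V (q j).2 ω).1.2
    have h4 := hd.triangle (V p.1 ω).1.2 (V p.2 ω).1.2 (V (q j).2 ω).1.2
    rw [hd.comm (V p.2 ω).1.2] at h4
    linarith [hcon.1, hcon.2.1, hcon.2.2]
  have hanti : Antitone fun m : ℕ =>
      {ω | η - 2 * (1 / ((m : ℝ) + 1)) ≤ pathDist d (V p.1 ω) (V p.2 ω)} := by
    intro m m' hmm ω hω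
    have : 1 / ((m' : ℝ) + 1) ≤ 1 / ((m : ℝ) + 1) := by gcongr
    simp only [mem_ofPred_eq] at hω ⊢
    linarith
  have hlim := tendsto_measure_iInter_atTop (μ := μ) (fun m => (measurableSet_le measurable_const
    (measurable_pathDist hd (hVm p.1) (hVm p.2))).nullMeasurableSet) hanti
    ⟨0, measure_ne_top _ _⟩
  have hset : (⋂ m : ℕ, {ω | η - 2 * (1 / ((m : ℝ) + 1)) ≤ pathDist d (V p.1 ω) (V p.2 ω)}) =
      {ω | η ≤ pathDist d (V p.1 ω) (V p.2 ω)} := by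
    ext ω
    simp only [mem_iInter, mem_ofPred_eq]
    constructor
    · intro h
      have h5 : Tendsto (fun m : ℕ => η - 2 * (1 / ((m : ℝ) + 1))) atTop (𝓝 (η - 2 * 0)) :=
        (tendsto_one_div_add_atTop_nhds_zero_nat.const_mul 2).const_sub η
      simpa using le_of_tendsto' h5 h
    · intro h m
      have : 0 < 1 / ((m : ℝ) + 1) := by positivity
      linarith
  rw [hset] at hlim
  have hlim' := (ENNReal.tendsto_toReal (measure_ne_top μ _)).comp hlim
  exact ge_of_tendsto' hlim' fun m => key _ (by positivity)

omit [ProperSpace M] [MeasurableSpace M] [BorelSpace M] in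
lemma MetrizesPaths.continuous_coordExt (hd : MetrizesPaths d) :
    Continuous fun w : C(ℝ≥0, Fin 2 → M) => d (coordExt 0 w) (coordExt 1 w) := by
  have hc : ∀ j : Fin 2, Continuous fun w : C(ℝ≥0, Fin 2 → M) => coordExt j w := fun j =>
    ContinuousMap.continuous_of_continuous_uncurry _
      (by fun_prop : Continuous fun p : C(ℝ≥0, Fin 2 → M) × ℝ => p.1 p.2.toNNReal j)
  exact hd.continuous.comp ((hc 0).prodMk (hc 1))

/-- The probability in the definition of `ε_k`, in terms of a family of continuous versions. -/
lemma markovLaw_dist_eq (hP : IsConsistentCoalescing P) (hψ : IsStochasticFlow P μ ψ)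
    (hd : MetrizesPaths d) {V : M → Ω → PathSpace M} (hV : ∀ y, IsVersion μ ψ (0, y) (V y))
    (η : ℝ) (x y : M) :
    markovLaw (P 2) ![x, y] {w | η ≤ d (coordExt 0 w) (coordExt 1 w)} =
      μ {ω | η ≤ pathDist d (V x ω) (V y ω)} := by
  rw [markovLaw_eq_map hP hψ (hV x) (hV y), Measure.map_apply
    (measurable_pairPath (hV x).measurable (hV y).measurable measurable_const)
    (isClosed_le continuous_const hd.continuous_coordExt).measurableSet]
  have hval : ∀ (x : M) (ω : Ω) (t : ℝ), val (V x ω) (0 + (t.toNNReal : ℝ)) = val (V x ω) t := by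
    intro x ω t
    rw [zero_add, Real.coe_toNNReal']
    rcases le_total 0 t with ht | ht
    · rw [max_eq_left ht]
    · rw [max_eq_right ht, val_of_le_start (V x ω) (t := t) (by rwa [(hV x).start_eq]),
        (hV x).start_eq]
  have e0 : ∀ ω, coordExt 0 (pairPath (V x ω) (V y ω) 0) = (V x ω).1.2 := fun ω =>
    ContinuousMap.ext fun t => hval x ω t
  have e1 : ∀ ω, coordExt 1 (pairPath (V x ω) (V y ω) 0) = (V y ω).1.2 := fun ω =>
    ContinuousMap.ext fun t => hval y ω t
  simp only [preimage_ofPred_eq, e0, e1, pathDist]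

/-- A family of continuous versions started at time `0`, whose trajectories depend continuously in
probability on the starting point. -/
structure IsContinuousFamily (μ : Measure Ω) (ψ : ℝ → ℝ → Ω → MeasMap M)
    (d : C(ℝ, M) → C(ℝ, M) → ℝ) (V : M → Ω → PathSpace M) : Prop where
  version : ∀ x, IsVersion μ ψ (0, x) (V x)
  tendsto : ∀ x, ∀ ε > 0,
    Tendsto (fun y => μ.real {ω | ε ≤ pathDist d (V y ω) (V x ω)}) (𝓝 x) (𝓝 0)

lemma exists_isContinuousFamily (hP : IsConsistentCoalescing P) (hψ : IsStochasticFlow P μ ψ)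
    (hD : DenseRange D) (hY : ∀ n, IsVersion μ ψ (D n) (Y n))
    (hsk : ∀ᵐ ω ∂μ, IsSkeleton fun n => Y n ω) (hd : MetrizesPaths d) :
    ∃ V, IsContinuousFamily μ ψ d V := by
  choose V hV _ using fun x => exists_version hP hψ hD hY hsk 0 x
  exact ⟨V, hV, fun x ε hε => tendsto_measureReal_pathDist hP hψ hD hY hsk hd hV hε⟩

variable {V : M → Ω → PathSpace M}

/-- The probability that two-point motions from `x` and `y` are at distance at least `2⁻ᵏ`. -/
noncomputable def distProb (P : (n : ℕ) → ℝ≥0 → Kernel (Fin n → M) (Fin n → M))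
    (d : C(ℝ, M) → C(ℝ, M) → ℝ) (k : ℕ) (x y : M) : ℝ≥0∞ :=
  markovLaw (P 2) ![x, y] {w | (2 : ℝ)⁻¹ ^ k ≤ d (coordExt 0 w) (coordExt 1 w)}

/-- The infimum in the definition of `ε_k`. -/
noncomputable def epsInf (P : (n : ℕ) → ℝ≥0 → Kernel (Fin n → M) (Fin n → M))
    (d : C(ℝ, M) → C(ℝ, M) → ℝ) (k : ℕ) (x : M) : ℝ≥0∞ :=
  sInf {a : ℝ≥0∞ | ∃ r : ℝ, a = ENNReal.ofReal r ∧ 0 < r ∧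
      (2 : ℝ≥0∞)⁻¹ ^ k < ⨆ y ∈ Metric.closedBall x r, distProb P d k x y}

omit [ProperSpace M] [BorelSpace M] in
lemma eps_eq (k : ℕ) (x : M) :
    eps P d k x = (min ((2 : ℝ≥0∞)⁻¹ ^ k) (epsInf P d k x)).toReal := rfl

omit [ProperSpace M] [BorelSpace M] in
lemma eps_le (k : ℕ) (x : M) : eps P d k x ≤ (2 : ℝ)⁻¹ ^ k := by
  rw [eps_eq]
  have h : ((2 : ℝ≥0∞)⁻¹ ^ k).toReal = (2 : ℝ)⁻¹ ^ k := by simp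
  rw [← h]
  exact ENNReal.toReal_mono (by simp) (min_le_left _ _)

/-- The functions `ε_k` are positive, because two-point motions from nearby points are close. -/
lemma eps_pos (hP : IsConsistentCoalescing P) (hψ : IsStochasticFlow P μ ψ)
    (hd : MetrizesPaths d) (hV : IsContinuousFamily μ ψ d V) (k : ℕ) (x : M) :
    0 < eps P d k x := by
  have h2 : (0 : ℝ) < (2 : ℝ)⁻¹ ^ k := by positivity
  obtain ⟨δ, hδ, h⟩ := Metric.eventually_nhds_iff.1
    ((hV.tendsto x _ h2).eventually (gt_mem_nhds h2))
  have hle : ENNReal.ofReal δ ≤ epsInf P d k x := by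
    refine le_sInf ?_
    rintro _ ⟨r, rfl, hr, hlt⟩
    refine ENNReal.ofReal_le_ofReal (not_lt.1 fun hrδ => hlt.not_ge (iSup₂_le fun y hy => ?_))
    rw [distProb, markovLaw_dist_eq hP hψ hd hV.version]
    have h3 := h ((Metric.mem_closedBall.1 hy).trans_lt hrδ)
    simp only [pathDist, hd.comm (V y _).1.2] at h3 ⊢
    rw [← ENNReal.ofReal_toReal (measure_ne_top μ _)]
    refine (ENNReal.ofReal_le_ofReal h3.le).trans (le_of_eq ?_)
    rw [ENNReal.ofReal_pow (by positivity), ENNReal.ofReal_inv_of_pos two_pos]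
    simp
  rw [eps_eq]
  refine ENNReal.toReal_pos (ne_of_gt (lt_min ?_ ?_)) (ne_top_of_le_ne_top (by simp)
    (min_le_left _ _))
  · exact pos_iff_ne_zero.2 (pow_ne_zero _ (by simp))
  · exact (ENNReal.ofReal_pos.2 hδ).trans_le hle

/-- The defining property of `ε_k`. -/
lemma distProb_le_of_dist_lt (hP : IsConsistentCoalescing P) (hψ : IsStochasticFlow P μ ψ)
    (hd : MetrizesPaths d) (hV : IsContinuousFamily μ ψ d V) {k : ℕ} {x y : M}
    (h : dist y x < eps P d k x) : distProb P d k x y ≤ (2 : ℝ≥0∞)⁻¹ ^ k := by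
  rcases eq_or_ne y x with rfl | hyx
  · rw [distProb, markovLaw_dist_eq hP hψ hd hV.version]
    simp only [pathDist, hd.self]
    have : {_ω : Ω | (2 : ℝ)⁻¹ ^ k ≤ 0} = ∅ :=
      eq_empty_of_forall_notMem fun _ h0 =>
        absurd (show (2 : ℝ)⁻¹ ^ k ≤ 0 from h0) (not_le.2 (by positivity))
    rw [this, measure_empty]
    exact zero_le
  · have hr : 0 < dist y x := dist_pos.2 hyx
    by_contra hcon
    refine h.not_ge ?_
    rw [eps_eq]
    have hle : epsInf P d k x ≤ ENNReal.ofReal (dist y x) := by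
      refine sInf_le ⟨dist y x, rfl, hr, ?_⟩
      exact (not_le.1 hcon).trans_le (le_iSup₂ (f := fun y _ => distProb P d k x y) y
        (Metric.mem_closedBall.2 le_rfl))
    exact (ENNReal.toReal_mono ENNReal.ofReal_ne_top ((min_le_right _ _).trans hle)).trans_eq
      (ENNReal.toReal_ofReal hr.le)

/-- In a σ-compact space, projections of closed sets are countable unions of compact sets. -/
lemma measurableSet_fst_image_of_isClosed {C : Set (M × M)} (hC : IsClosed C) :
    MeasurableSet (Prod.fst '' C) := by
  have h : Prod.fst '' C = ⋃ n, Prod.fst '' (C ∩ compactCovering (M × M) n) := by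
    rw [← image_iUnion, ← inter_iUnion, iUnion_compactCovering, inter_univ]
  rw [h]
  exact MeasurableSet.iUnion fun n =>
    (((isCompact_compactCovering _ n).inter_left hC).image continuous_fst).isClosed.measurableSet

/-- The functions `ε_k` are measurable: their sublevel sets are projections of countable unions of
closed subsets of `M × M`. -/
lemma measurable_eps (hP : IsConsistentCoalescing P) (hψ : IsStochasticFlow P μ ψ)
    (hd : MetrizesPaths d) (hV : IsContinuousFamily μ ψ d V) (k : ℕ) :
    Measurable (eps P d k) := by
  have hinf : Measurable (epsInf P d k) := by
    refine measurable_of_Iio fun c => ?_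
    have hset : epsInf P d k ⁻¹' Iio c = ⋃ (q : ℚ) (j : ℕ) (_ : ENNReal.ofReal q < c),
        Prod.fst '' ({p : M × M | dist p.2 p.1 ≤ q} ∩
          {p : M × M | (2 : ℝ)⁻¹ ^ k + 1 / ((j : ℝ) + 1) ≤ μ.real {ω | (2 : ℝ)⁻¹ ^ k ≤ pathDist d (V p.1 ω) (V p.2 ω)}}) := by
      have htwo : (2 : ℝ≥0∞)⁻¹ ^ k = ENNReal.ofReal ((2 : ℝ)⁻¹ ^ k) := by
        rw [ENNReal.ofReal_pow (by positivity), ENNReal.ofReal_inv_of_pos two_pos]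
        simp
      have hprob : ∀ x y, (2 : ℝ≥0∞)⁻¹ ^ k < distProb P d k x y ↔
          (2 : ℝ)⁻¹ ^ k < μ.real {ω | (2 : ℝ)⁻¹ ^ k ≤ pathDist d (V x ω) (V y ω)} := by
        intro x y
        rw [distProb, markovLaw_dist_eq hP hψ hd hV.version, htwo,
          ENNReal.ofReal_lt_iff_lt_toReal (by positivity) (measure_ne_top _ _)]
        rfl
      ext x
      simp only [mem_preimage, mem_Iio, epsInf, sInf_lt_iff, mem_iUnion, mem_image, mem_inter_iff,
        mem_ofPred_eq, Prod.exists, exists_and_right, exists_eq_right, exists_prop]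
      constructor
      · rintro ⟨_, ⟨r, rfl, hr, hlt⟩, hrc⟩
        obtain ⟨y, hy⟩ := lt_iSup_iff.1 hlt
        obtain ⟨hyr, hy'⟩ := lt_iSup_iff.1 hy
        obtain ⟨a, -, har, hac⟩ := ENNReal.lt_iff_exists_rat_btwn.1 hrc
        obtain ⟨j, hj⟩ := exists_nat_one_div_lt (sub_pos.2 ((hprob x y).1 hy'))
        refine ⟨a, j, hac, y, ?_, by linarith⟩
        refine (Metric.mem_closedBall.1 hyr).trans ?_
        by_contra hcon
        exact har.not_ge (ENNReal.ofReal_le_ofReal (not_le.1 hcon).le)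
      · rintro ⟨a, j, hac, y, hya, hy⟩
        obtain ⟨b, hb0, hab, hbc⟩ := ENNReal.lt_iff_exists_rat_btwn.1 hac
        have hj : 0 < 1 / ((j : ℝ) + 1) := by positivity
        have hab' : (a : ℝ) < b := by
          by_contra hcon
          exact hab.not_ge (ENNReal.ofReal_le_ofReal (not_lt.1 hcon))
        have hb : (0 : ℝ) < b := dist_nonneg.trans_lt (hya.trans_lt hab')
        refine ⟨_, ⟨b, rfl, hb, ?_⟩, hbc⟩
        exact ((hprob x y).2 (by linarith)).trans_le (le_iSup₂ (f := fun y _ =>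
          distProb P d k x y) y (Metric.mem_closedBall.2 (hya.trans hab'.le)))
    rw [hset]
    refine MeasurableSet.iUnion fun q => MeasurableSet.iUnion fun j => MeasurableSet.iUnion fun _ =>
      measurableSet_fst_image_of_isClosed (IsClosed.inter ?_ ?_)
    · exact isClosed_le (by fun_prop) continuous_const
    · exact isClosed_measureReal_pathDist hd (fun y => (hV.version y).measurable) hV.tendsto _ _
  have : eps P d k = fun x => (min ((2 : ℝ≥0∞)⁻¹ ^ k) (epsInf P d k x)).toReal := rfl
  rw [this]
  exact (measurable_const.min hinf).ennreal_toReal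

end

/-! ### The extension of a skeleton -/

section Skeleton

variable {M : Type*} [MetricSpace M] [ProperSpace M] {φ : ℕ → PathSpace M}

/-- The paths of a skeleton which are alive at time `s` are dense in `M` at that time. -/
lemma IsSkeleton.exists_index (hφ : IsSkeleton φ) (s : ℝ) (x : M) {δ : ℝ} (hδ : 0 < δ) :
    ∃ n, start (φ n) ≤ s ∧ dist (val (φ n) s) x < δ := by
  have hex : ∀ j : ℕ, ∃ n, start (φ n) ≤ s ∧ dist (start (φ n)) s ≤ 1 / ((j : ℝ) + 1) ∧
      dist (val (φ n) (start (φ n))) x ≤ 1 / ((j : ℝ) + 1) := by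
    intro j
    have hj : 0 < 1 / ((j : ℝ) + 1) := by positivity
    have ho : IsOpen (Ioo (s - 1 / ((j : ℝ) + 1)) s ×ˢ Metric.ball x (1 / ((j : ℝ) + 1))) :=
      isOpen_Ioo.prod Metric.isOpen_ball
    obtain ⟨n, hn⟩ := hφ.dense.exists_mem_open ho ⟨(s - 1 / ((j : ℝ) + 1) / 2, x),
      ⟨by linarith, by linarith⟩, Metric.mem_ball_self hj⟩
    refine ⟨n, hn.1.2.le, ?_, (Metric.mem_ball.1 hn.2).le⟩
    rw [Real.dist_eq, abs_le]
    constructor <;> linarith [hn.1.1, hn.1.2]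
  choose n hn1 hn2 hn3 using hex
  have h1 : ∀ j : ℕ, 1 / ((j : ℝ) + 1) ≤ 1 := fun j => by
    rw [div_le_one (by positivity)]; simp
  have hK := hφ.relCompact (Metric.closedBall s 1 ×ˢ Metric.closedBall x 1)
    ((isCompact_closedBall s 1).prod (isCompact_closedBall x 1))
  let u : ℕ → PathSpace M := fun j => restrictFrom (φ (n j)) (start (φ (n j)))
  have hu : ∀ j, u j ∈ closure {g : PathSpace M | ∃ (n : ℕ) (r : ℝ), start (φ n) ≤ r ∧
      (r, val (φ n) r) ∈ Metric.closedBall s 1 ×ˢ Metric.closedBall x 1 ∧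
        g = restrictFrom (φ n) r} := fun j =>
    subset_closure ⟨n j, _, le_rfl, ⟨(hn2 j).trans (h1 j), (hn3 j).trans (h1 j)⟩, rfl⟩
  have hu' : ∀ᶠ j in atTop, u j ∈ closure {g : PathSpace M | ∃ (n : ℕ) (r : ℝ), start (φ n) ≤ r ∧
      (r, val (φ n) r) ∈ Metric.closedBall s 1 ×ˢ Metric.closedBall x 1 ∧
        g = restrictFrom (φ n) r} := Eventually.of_forall hu
  obtain ⟨f, -, hf⟩ := hK.exists_mapClusterPt (f := atTop) (u := u)
    (le_principal_iff.2 hu')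
  obtain ⟨U, hU, hUf⟩ := mapClusterPt_iff_ultrafilter.1 hf
  have h0 : Tendsto (fun j : ℕ => 1 / ((j : ℝ) + 1)) U (𝓝 0) :=
    tendsto_one_div_add_atTop_nhds_zero_nat.mono_left hU
  have hs : Tendsto (fun j => start (φ (n j))) U (𝓝 s) :=
    tendsto_iff_dist_tendsto_zero.2 (squeeze_zero (fun _ => dist_nonneg) hn2 h0)
  have hx : Tendsto (fun j => val (φ (n j)) (start (φ (n j)))) U (𝓝 x) :=
    tendsto_iff_dist_tendsto_zero.2 (squeeze_zero (fun _ => dist_nonneg) hn3 h0)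
  have hv1 : Tendsto (fun j => val (u j) (start (φ (n j)))) U (𝓝 (val f s)) :=
    (continuous_val_uncurry.tendsto (f, s)).comp (hUf.prodMk_nhds hs)
  simp only [u, val_restrictFrom, max_self] at hv1
  have hfx := tendsto_nhds_unique hv1 hx
  have hv2 : Tendsto (fun j => val (u j) s) U (𝓝 x) :=
    hfx ▸ ((continuous_val_left s).tendsto f).comp hUf
  simp only [u, val_restrictFrom, max_eq_right (hn1 _)] at hv2
  obtain ⟨j, hj⟩ := (hv2.eventually (Metric.ball_mem_nhds x hδ)).exists
  exact ⟨n j, hn1 j, hj⟩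

variable {ε : ℕ → M → ℝ} {ℓ : (ℕ → PathSpace M) → PathSpace M}

lemma IsSkeleton.approxIndex_spec (hφ : IsSkeleton φ) (hε : ∀ k x, 0 < ε k x) (s : ℝ) (x : M)
    (k : ℕ) : start (φ (approxIndex ε s x φ k)) ≤ s ∧
      dist (val (φ (approxIndex ε s x φ k)) s) x < ε k x :=
  Nat.sInf_mem (hφ.exists_index s x (hε k x))

/-- The selected path `Θ(s, x, φ)` is a limit, along an ultrafilter, of the paths
`φ_{n^{s,x}_k}[s,∞)`. -/
lemma IsSkeleton.exists_ultrafilter (hφ : IsSkeleton φ) (hε : ∀ k x, 0 < ε k x)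
    (hε' : ∀ k x, ε k x ≤ (2 : ℝ)⁻¹ ^ k) (hℓ : IsLimitSelector ℓ) (s : ℝ) (x : M) :
    ∃ U : Ultrafilter ℕ, (U : Filter ℕ) ≤ atTop ∧
      Tendsto (fun k => restrictFrom (φ (approxIndex ε s x φ k)) s) U (𝓝 (bigTheta ℓ ε s x φ)) := by
  have hK := hφ.relCompact ({s} ×ˢ Metric.closedBall x 1)
    (isCompact_singleton.prod (isCompact_closedBall x 1))
  refine mapClusterPt_iff_ultrafilter.1 (hℓ.mapClusterPt _ (hK.of_isClosed_subset isClosed_closure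
    (closure_mono ?_)))
  rintro _ ⟨k, rfl⟩
  have h := hφ.approxIndex_spec hε s x k
  refine ⟨_, s, h.1, ⟨rfl, Metric.mem_closedBall.2 (h.2.le.trans ((hε' k x).trans ?_))⟩, rfl⟩
  exact pow_le_one₀ (by norm_num) (by norm_num)

lemma tendsto_two_inv_pow : Tendsto (fun k : ℕ => (2 : ℝ)⁻¹ ^ k) atTop (𝓝 0) :=
  tendsto_pow_atTop_nhds_zero_of_lt_one (by norm_num) (by norm_num)

lemma IsSkeleton.theta_self (hφ : IsSkeleton φ) (hε : ∀ k x, 0 < ε k x)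
    (hε' : ∀ k x, ε k x ≤ (2 : ℝ)⁻¹ ^ k) (hℓ : IsLimitSelector ℓ) (s : ℝ) (x : M) :
    theta ℓ ε φ s s x = x := by
  obtain ⟨U, hUt, hU⟩ := hφ.exists_ultrafilter hε hε' hℓ s x
  refine tendsto_nhds_unique (((continuous_val_left s).tendsto _).comp hU) ?_
  simp only [Function.comp_def, val_restrictFrom, max_self]
  refine tendsto_iff_dist_tendsto_zero.2 (squeeze_zero (fun _ => dist_nonneg) (fun k => ?_)
    (tendsto_two_inv_pow.mono_left hUt))
  exact ((hφ.approxIndex_spec hε s x k).2.le.trans (hε' k x))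

omit [ProperSpace M] in
lemma continuous_theta (s : ℝ) (x : M) : Continuous fun t => theta ℓ ε φ s t x :=
  continuous_val_right _

omit [ProperSpace M] in
lemma continuous_restrictIcc (t r : ℝ) : Continuous fun f : PathSpace M => restrictIcc f t r :=
  (ContinuousMap.continuous_restrict _).comp (continuous_snd.comp continuous_subtype_val)

/-- From any later time `t` on, the extension `θ` is one of the limit paths which emanate from its
position at time `t`. -/
lemma IsSkeleton.bigTheta_mem_limitPaths (hφ : IsSkeleton φ) (hε : ∀ k x, 0 < ε k x)
    (hε' : ∀ k x, ε k x ≤ (2 : ℝ)⁻¹ ^ k) (hℓ : IsLimitSelector ℓ) {s t : ℝ} (hst : s ≤ t) (r : ℝ)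
    (x : M) : restrictIcc (bigTheta ℓ ε s x φ) t r ∈ limitPaths φ t r (theta ℓ ε φ s t x) := by
  obtain ⟨U, hUt, hU⟩ := hφ.exists_ultrafilter hε hε' hℓ s x
  simp only [limitPaths, mem_iInter]
  intro δ hδ
  refine mem_closure_of_tendsto (((continuous_restrictIcc t r).tendsto _).comp hU) ?_
  have hv := ((continuous_val_left t).tendsto _).comp hU
  filter_upwards [hv.eventually (Metric.ball_mem_nhds _ hδ)] with k hk
  refine ⟨_, ((hφ.approxIndex_spec hε s x k).1).trans hst, ?_, ?_⟩
  · have hk' : val (restrictFrom (φ (approxIndex ε s x φ k)) s) t ∈ Metric.ball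
        (theta ℓ ε φ s t x) δ := hk
    rwa [val_restrictFrom, max_eq_right hst] at hk'
  · ext ⟨u, hu⟩
    change val (restrictFrom _ s) u = val _ u
    rw [val_restrictFrom, max_eq_right (hst.trans hu.1)]

/-- Outside of the set of bifurcation points, paths of the extension which meet stay together for a
positive time. -/
lemma IsSkeleton.exists_eqOn_theta (hφ : IsSkeleton φ) (hε : ∀ k x, 0 < ε k x)
    (hε' : ∀ k x, ε k x ≤ (2 : ℝ)⁻¹ ^ k) (hℓ : IsLimitSelector ℓ) {s s' r : ℝ} (hs : s ≤ r)
    (hs' : s' ≤ r) {x x' : M} (h : theta ℓ ε φ s r x = theta ℓ ε φ s' r x')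
    (hb : (r, theta ℓ ε φ s r x) ∉ bifurcationSet φ) :
    ∃ r' > r, ∀ u ∈ Icc r r', theta ℓ ε φ s u x = theta ℓ ε φ s' u x' := by
  set z := theta ℓ ε φ s r x with hz
  have hlt : (r : EReal) < bifurcationTime φ r z := by
    refine lt_of_le_of_ne (le_sInf ?_) fun h => hb h.symm
    rintro _ ⟨t, rfl, ht, -⟩
    exact EReal.coe_le_coe_iff.2 ht.le
  obtain ⟨r', hr1, hr2⟩ := EReal.lt_iff_exists_real_btwn.1 hlt
  have hrr : r < r' := EReal.coe_lt_coe_iff.1 hr1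
  refine ⟨r', hrr, ?_⟩
  have hcard : ¬ 2 ≤ (limitPaths φ r r' z).encard := fun hcard =>
    hr2.not_ge (sInf_le ⟨r', rfl, hrr, hcard⟩)
  have hsub : (limitPaths φ r r' z).encard ≤ 1 := by
    rw [not_le] at hcard
    exact Order.le_of_lt_add_one (by rwa [one_add_one_eq_two])
  have h1 := hφ.bigTheta_mem_limitPaths hε hε' hℓ hs r' x
  have h2 := hφ.bigTheta_mem_limitPaths hε hε' hℓ hs' r' x'
  rw [← h] at h2
  have heq := encard_le_one_iff.1 hsub _ _ h1 h2
  intro u hu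
  exact DFunLike.congr_fun heq ⟨u, hu⟩

/-- The extension of a skeleton extends it: along a path of the skeleton, `θ` follows this path. -/
lemma IsSkeleton.theta_val (hφ : IsSkeleton φ) (hε : ∀ k x, 0 < ε k x)
    (hε' : ∀ k x, ε k x ≤ (2 : ℝ)⁻¹ ^ k) (hℓ : IsLimitSelector ℓ) {n : ℕ} {t u : ℝ}
    (hn : start (φ n) ≤ t) (htu : t ≤ u) :
    theta ℓ ε φ t u (val (φ n) t) = val (φ n) u := by
  set y := val (φ n) t with hy
  obtain ⟨U, hUt, hU⟩ := hφ.exists_ultrafilter hε hε' hℓ t y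
  have hle : ∀ k, approxIndex ε t y φ k ≤ n := fun k =>
    Nat.sInf_le ⟨hn, by rw [← hy, dist_self]; exact hε k y⟩
  -- only finitely many indices occur, so that the positions at time `t` are eventually equal to `y`
  have hev : ∀ᶠ k in atTop, ∀ m ∈ Finset.range (n + 1),
      dist (val (φ m) t) y < (2 : ℝ)⁻¹ ^ k → val (φ m) t = y := by
    refine (Finset.range (n + 1)).eventually_all.2 fun m _ => ?_
    by_cases hm : val (φ m) t = y
    · exact Eventually.of_forall fun _ _ => hm
    · filter_upwards [tendsto_two_inv_pow.eventually (gt_mem_nhds (dist_pos.2 hm))] with k hk hk'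
      exact absurd hk hk'.not_gt
  refine tendsto_nhds_unique (((continuous_val_left u).tendsto _).comp hU) ?_
  refine tendsto_const_nhds.congr' ?_
  filter_upwards [hUt hev] with k hk
  have hs := hφ.approxIndex_spec hε t y k
  have hk' := hk _ (by have := hle k; simp; omega) (hs.2.trans_le (hε' k y))
  rw [Function.comp_apply, val_restrictFrom, max_eq_right htu]
  exact hφ.coalescence t _ _ hn hs.1 hk'.symm u htu

end Skeleton

/-! ### Hitting times and restarting -/

section HitTimes

variable {M : Type*}

/-- The first time strictly after `a` at which the graph of `γ` meets `F`, with `⊤` if there is no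
such time. -/
noncomputable def nextTime (F : Set (ℝ × M)) (γ : ℝ → M) (a : ℝ) : EReal :=
  sInf {r : EReal | ∃ t : ℝ, r = t ∧ (a : EReal) < t ∧ (t, γ t) ∈ F}

variable {F : Set (ℝ × M)} {γ γ' : ℝ → M} {a b t : ℝ}

lemma le_nextTime : (a : EReal) ≤ nextTime F γ a :=
  le_sInf (by rintro _ ⟨t, rfl, ht, -⟩; exact ht.le)

lemma nextTime_le (h : a < t) (ht : (t, γ t) ∈ F) : nextTime F γ a ≤ t :=
  sInf_le ⟨t, rfl, EReal.coe_lt_coe_iff.2 h, ht⟩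

lemma notMem_of_lt_nextTime (h : a < t) (ht : (t : EReal) < nextTime F γ a) : (t, γ t) ∉ F :=
  fun hF => ht.not_ge (nextTime_le h hF)

lemma nextTime_eq_of_lt_nextTime (hab : a ≤ b) (hb : (b : EReal) < nextTime F γ a) :
    nextTime F γ b = nextTime F γ a := by
  refine le_antisymm (le_sInf ?_) (le_sInf ?_)
  · rintro _ ⟨t, rfl, ht, htF⟩
    refine nextTime_le (EReal.coe_lt_coe_iff.1 (hb.trans_le ?_)) htF
    exact nextTime_le (EReal.coe_lt_coe_iff.1 ht) htF
  · rintro _ ⟨t, rfl, ht, htF⟩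
    exact nextTime_le (hab.trans_lt (EReal.coe_lt_coe_iff.1 ht)) htF

lemma coe_mem_of_nextTime_eq [TopologicalSpace M] (hF : IsClosed F) (hγ : Continuous γ)
    (h : nextTime F γ a = b) : (b, γ b) ∈ F := by
  have hcl : IsClosed {t : ℝ | (t, γ t) ∈ F} := hF.preimage (continuous_id.prodMk hγ)
  refine hcl.closure_subset (Metric.mem_closure_iff.2 fun δ hδ => ?_)
  have hlt : nextTime F γ a < ((b + δ : ℝ) : EReal) := by
    rw [h, EReal.coe_lt_coe_iff]; linarith
  obtain ⟨_, ⟨t, rfl, ht, htF⟩, htb⟩ := sInf_lt_iff.1 hlt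
  have hbt : b ≤ t := EReal.coe_le_coe_iff.1 (h ▸ nextTime_le (EReal.coe_lt_coe_iff.1 ht) htF)
  refine ⟨t, htF, ?_⟩
  rw [dist_comm, Real.dist_eq, abs_of_nonneg (by linarith)]
  linarith [EReal.coe_lt_coe_iff.1 htb]

/-- The hitting time only depends on the path up to this time. -/
lemma nextTime_congr [TopologicalSpace M] (hF : IsClosed F) (hγ : Continuous γ)
    (ha : (a : EReal) < nextTime F γ a)
    (h : ∀ t : ℝ, a < t → (t : EReal) ≤ nextTime F γ a → γ' t = γ t) :
    nextTime F γ' a = nextTime F γ a := by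
  refine le_antisymm ?_ (le_sInf ?_)
  · induction hT : nextTime F γ a with
    | bot => exact absurd (hT ▸ ha) (not_lt_bot)
    | top => exact le_top
    | coe b =>
      have hab : a < b := EReal.coe_lt_coe_iff.1 (hT ▸ ha)
      refine nextTime_le hab ?_
      rw [h b hab hT.ge]
      exact coe_mem_of_nextTime_eq hF hγ hT
  · rintro _ ⟨t, rfl, ht, htF⟩
    have hat := EReal.coe_lt_coe_iff.1 ht
    by_contra hlt
    rw [not_le] at hlt
    rw [h t hat hlt.le] at htF
    exact hlt.not_ge (nextTime_le hat htF)

variable {θ : ℝ → ℝ → M → M} {s : ℝ} {x : M} {j k : ℕ}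

lemma hitTime_zero : hitTime θ F s x 0 = s := rfl

lemma hitPoint_zero : hitPoint θ F s x 0 = x := rfl

lemma hitTime_succ_top (h : hitTime θ F s x k = ⊤) : hitTime θ F s x (k + 1) = ⊤ := by
  simp only [hitTime, hit] at h ⊢
  rw [if_pos h]

lemma hitTime_succ (h : hitTime θ F s x k = a) :
    hitTime θ F s x (k + 1) = nextTime F (fun t => θ a t (hitPoint θ F s x k)) a := by
  simp only [hitTime, hitPoint, hit, nextTime] at h ⊢
  simp only [h, EReal.coe_ne_top, if_false, EReal.toReal_coe]

lemma hitPoint_succ (h : hitTime θ F s x k = a) (h' : hitTime θ F s x (k + 1) = b) :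
    hitPoint θ F s x (k + 1) = θ a b (hitPoint θ F s x k) := by
  simp only [hitTime, hitPoint, hit] at h h' ⊢
  simp only [h, EReal.coe_ne_top, if_false, EReal.toReal_coe] at h' ⊢
  simp only [h', EReal.coe_ne_top, if_false, EReal.toReal_coe]

lemma hitTime_eq_top_or : hitTime θ F s x k = ⊤ ∨ ∃ a : ℝ, s ≤ a ∧ hitTime θ F s x k = a := by
  induction k with
  | zero => exact Or.inr ⟨s, le_rfl, rfl⟩
  | succ k ih =>
    rcases ih with h | ⟨a, ha, h⟩
    · exact Or.inl (hitTime_succ_top h)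
    · have hle : (a : EReal) ≤ hitTime θ F s x (k + 1) := hitTime_succ h ▸ le_nextTime
      induction hT : hitTime θ F s x (k + 1) with
      | bot => rw [hT] at hle; exact absurd hle (EReal.bot_lt_coe a).not_ge
      | top => exact Or.inl rfl
      | coe b => exact Or.inr ⟨b, ha.trans (EReal.coe_le_coe_iff.1 (hT ▸ hle)), rfl⟩

lemma exists_hitTime_eq (h : hitTime θ F s x k ≤ (t : EReal)) :
    ∃ a : ℝ, s ≤ a ∧ a ≤ t ∧ hitTime θ F s x k = a := by
  rcases hitTime_eq_top_or (θ := θ) (F := F) (s := s) (x := x) (k := k) with h' | ⟨a, ha, h'⟩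
  · exact absurd (top_le_iff.1 (h' ▸ h)) (EReal.coe_ne_top t)
  · exact ⟨a, ha, EReal.coe_le_coe_iff.1 (h' ▸ h), h'⟩

lemma monotone_hitTime : Monotone (hitTime θ F s x) := by
  refine monotone_nat_of_le_succ fun k => ?_
  rcases hitTime_eq_top_or (θ := θ) (F := F) (s := s) (x := x) (k := k) with h | ⟨a, -, h⟩
  · rw [hitTime_succ_top h]; exact le_top
  · rw [hitTime_succ h, h]; exact le_nextTime

/-- The construction starts afresh at each of the hitting times. -/
lemma hitTime_add (h : hitTime θ F s x k = a) (j : ℕ) :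
    hitTime θ F a (hitPoint θ F s x k) j = hitTime θ F s x (k + j) ∧
      (hitTime θ F s x (k + j) ≠ ⊤ →
        hitPoint θ F a (hitPoint θ F s x k) j = hitPoint θ F s x (k + j)) := by
  induction j with
  | zero => exact ⟨h.symm, fun _ => rfl⟩
  | succ j ih =>
    rw [← add_assoc]
    rcases hitTime_eq_top_or (θ := θ) (F := F) (s := s) (x := x) (k := k + j) with
      h1 | ⟨b, -, h1⟩
    · rw [hitTime_succ_top h1, hitTime_succ_top (ih.1.trans h1)]
      exact ⟨rfl, fun h => absurd rfl h⟩
    · have hp := ih.2 (by rw [h1]; exact EReal.coe_ne_top b)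
      have ht : hitTime θ F a (hitPoint θ F s x k) (j + 1) = hitTime θ F s x (k + j + 1) := by
        rw [hitTime_succ h1, hitTime_succ (ih.1.trans h1), hp]
      refine ⟨ht, fun hne => ?_⟩
      rcases hitTime_eq_top_or (θ := θ) (F := F) (s := s) (x := x) (k := k + j + 1) with
        h2 | ⟨c, -, h2⟩
      · exact absurd h2 hne
      · rw [hitPoint_succ h1 h2, hitPoint_succ (ih.1.trans h1) (ht.trans h2), hp]

lemma exists_of_hitCount_lt_top (h : hitCount θ F s x < ⊤) :
    hitTime θ F s x (hitCount θ F s x).toNat = hitTime θ F s x ((hitCount θ F s x).toNat + 1) := by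
  have hne : {j : ℕ∞ | ∃ k : ℕ, j = k ∧ hitTime θ F s x k = hitTime θ F s x (k + 1)}.Nonempty := by
    by_contra hne
    rw [not_nonempty_iff_eq_empty] at hne
    rw [hitCount, hne, sInf_empty] at h
    exact lt_irrefl _ h
  obtain ⟨k, hk, hk'⟩ := csInf_mem hne
  have : (hitCount θ F s x).toNat = k := by rw [hitCount, hk]; exact ENat.toNat_natCast k
  rwa [this]

lemma hitCount_le (h : hitTime θ F s x k = hitTime θ F s x (k + 1)) : hitCount θ F s x ≤ k :=
  sInf_le ⟨k, rfl, h⟩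

section Self

variable (hself : ∀ s x, θ s s x = x)
include hself

/-- Once two consecutive hitting times coincide, the sequence is constant. -/
lemma hit_add_of_hitTime_succ_eq (h : hitTime θ F s x k = a) (h' : hitTime θ F s x (k + 1) = a)
    (j : ℕ) : hitTime θ F s x (k + j) = a ∧ hitPoint θ F s x (k + j) = hitPoint θ F s x k := by
  induction j with
  | zero => exact ⟨h, rfl⟩
  | succ j ih =>
    have h1 : hitTime θ F s x (k + j + 1) = a := by
      rw [hitTime_succ ih.1, ih.2, ← hitTime_succ h, h']
    exact ⟨h1, by rw [← add_assoc, hitPoint_succ ih.1 h1, hself, ih.2]⟩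

/-- On the `k`-th piece, `restart` is the `k`-th path of `θ`. The last piece, after which the hitting
times are constant, extends to infinity. -/
lemma restart_eq (h : hitTime θ F s x k = a) (hat : a ≤ t)
    (h' : (t : EReal) < hitTime θ F s x (k + 1) ∨ hitTime θ F s x (k + 1) = a) :
    restart θ F s t x = θ a t (hitPoint θ F s x k) := by
  rcases h' with h' | h'
  · have hlim : (t : EReal) < hitTimeLimit θ F s x := h'.trans_le (le_iSup _ (k + 1))
    have hset : {j : ℕ | hitTime θ F s x j ≤ (t : EReal) ∧ (t : EReal) < hitTime θ F s x (j + 1)}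
        = {k} := by
      ext j
      simp only [mem_ofPred_eq, mem_singleton_iff]
      constructor
      · rintro ⟨h1, h2⟩
        have h3 : k < j + 1 := monotone_hitTime.reflect_lt
          ((h.trans_le (EReal.coe_le_coe_iff.2 hat)).trans_lt h2)
        have h4 : j < k + 1 := monotone_hitTime.reflect_lt (h1.trans_lt h')
        omega
      · rintro rfl
        exact ⟨h.trans_le (EReal.coe_le_coe_iff.2 hat), h'⟩
    simp only [restart, if_pos hlim, hset, csInf_singleton, h, EReal.toReal_coe]
  -- the index `hitCount` may be smaller than `k`, but the sequence is constant in between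
  · have hlim : hitTimeLimit θ F s x = a := by
      refine le_antisymm (iSup_le fun j => ?_) (h ▸ le_iSup _ k)
      rw [← (hit_add_of_hitTime_succ_eq hself h h' j).1]
      exact monotone_hitTime (by omega)
    have hnot : ¬ (t : EReal) < hitTimeLimit θ F s x := by
      rw [hlim, not_lt]; exact EReal.coe_le_coe_iff.2 hat
    have hc := hitCount_le (h.trans h'.symm)
    have hc' : hitCount θ F s x < ⊤ := hc.trans_lt (ENat.natCast_lt_top k)
    set m := (hitCount θ F s x).toNat with hm
    have hmk : m ≤ k := ENat.toNat_le_of_le_natCast hc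
    have hmm := exists_of_hitCount_lt_top hc'
    rw [← hm] at hmm
    obtain ⟨b, -, -, hb⟩ := exists_hitTime_eq (t := a) ((monotone_hitTime hmk).trans h.le)
    obtain ⟨i, rfl⟩ := Nat.exists_eq_add_of_le hmk
    have hi := hit_add_of_hitTime_succ_eq hself hb (hmm.symm.trans hb) i
    have hab : a = b := EReal.coe_eq_coe_iff.1 (h.symm.trans hi.1)
    simp only [restart, if_neg hnot, if_pos hc', ← hm, hb, EReal.toReal_coe, hi.2, hab]

lemma restart_self : restart θ F s s x = x := by
  rw [restart_eq hself (k := 0) hitTime_zero le_rfl, hself, hitPoint_zero]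
  rcases (monotone_hitTime (θ := θ) (F := F) (s := s) (x := x) (Nat.zero_le 1)).lt_or_eq with h | h
  · exact Or.inl h
  · exact Or.inr h.symm

omit hself in
/-- The index of the piece of the concatenated path which covers the time `t`, with the piece closed
on the left. -/
lemma exists_hitTime_le_lt (hc : hitCount θ F s x < ⊤) (hst : s ≤ t) :
    ∃ (k : ℕ) (a : ℝ), s ≤ a ∧ a ≤ t ∧ hitTime θ F s x k = a ∧
      ((t : EReal) < hitTime θ F s x (k + 1) ∨ hitTime θ F s x (k + 1) = a) := by
  set m := (hitCount θ F s x).toNat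
  have hm := exists_of_hitCount_lt_top hc
  by_cases hmt : hitTime θ F s x m ≤ (t : EReal)
  · obtain ⟨a, h1, h2, h3⟩ := exists_hitTime_eq hmt
    exact ⟨m, a, h1, h2, h3, Or.inr (hm.symm.trans h3)⟩
  · classical
    have hex : ∃ k, (t : EReal) < hitTime θ F s x (k + 1) := ⟨m, hm ▸ not_le.1 hmt⟩
    have hle : hitTime θ F s x (Nat.find hex) ≤ (t : EReal) := by
      rcases Nat.eq_zero_or_pos (Nat.find hex) with h0 | h0
      · rw [h0, hitTime_zero]; exact EReal.coe_le_coe_iff.2 hst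
      · have := Nat.find_min hex (Nat.sub_lt h0 one_pos)
        rwa [not_lt, Nat.sub_add_cancel (Nat.one_le_iff_ne_zero.2 h0.ne')] at this
    obtain ⟨a, h1, h2, h3⟩ := exists_hitTime_eq hle
    exact ⟨_, a, h1, h2, h3, Or.inl (Nat.find_spec hex)⟩

omit hself in
/-- The index of the piece of the concatenated path which covers the time `t`, with the piece closed
on the right. -/
lemma exists_hitTime_lt_le (hc : hitCount θ F s x < ⊤) (hst : s < t) :
    ∃ (k : ℕ) (a : ℝ), s ≤ a ∧ a < t ∧ hitTime θ F s x k = a ∧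
      ((t : EReal) ≤ hitTime θ F s x (k + 1) ∨ hitTime θ F s x (k + 1) = a) := by
  set m := (hitCount θ F s x).toNat
  have hm := exists_of_hitCount_lt_top hc
  by_cases hmt : hitTime θ F s x m < (t : EReal)
  · obtain ⟨a, h1, h2, h3⟩ := exists_hitTime_eq hmt.le
    exact ⟨m, a, h1, EReal.coe_lt_coe_iff.1 (h3 ▸ hmt), h3, Or.inr (hm.symm.trans h3)⟩
  · classical
    have hex : ∃ k, (t : EReal) ≤ hitTime θ F s x (k + 1) := ⟨m, hm ▸ not_lt.1 hmt⟩
    have hlt : hitTime θ F s x (Nat.find hex) < (t : EReal) := by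
      rcases Nat.eq_zero_or_pos (Nat.find hex) with h0 | h0
      · rw [h0, hitTime_zero]; exact EReal.coe_lt_coe_iff.2 hst
      · have := Nat.find_min hex (Nat.sub_lt h0 one_pos)
        rwa [not_le, Nat.sub_add_cancel (Nat.one_le_iff_ne_zero.2 h0.ne')] at this
    obtain ⟨a, h1, h2, h3⟩ := exists_hitTime_eq hlt.le
    exact ⟨_, a, h1, EReal.coe_lt_coe_iff.1 (h3 ▸ hlt), h3, Or.inl (Nat.find_spec hex)⟩

/-- The flow property at the hitting times of `F`. -/
lemma restart_hitTime (hc : ∀ s x, hitCount θ F s x < ⊤) (h : hitTime θ F s x k = a)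
    (hat : a ≤ t) : restart θ F s t x = restart θ F a t (hitPoint θ F s x k) := by
  obtain ⟨j, b, hab, hbt, hj, hj'⟩ := exists_hitTime_le_lt (hc a (hitPoint θ F s x k)) hat
  have h1 := hitTime_add h j
  have h2 := hitTime_add h (j + 1)
  rw [restart_eq hself hj hbt hj']
  rw [h1.1] at hj
  rw [h2.1] at hj'
  rw [restart_eq hself hj hbt hj', h1.2 (by rw [hj]; exact EReal.coe_ne_top b)]

end Self

/-! ### Restarting along a given path -/

/-- The successive hitting times of `F` by the graph of the path `γ` which starts at time `s`. -/
noncomputable def pathHit (F : Set (ℝ × M)) (γ : ℝ → M) (s : ℝ) : ℕ → EReal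
  | 0 => s
  | k + 1 =>
    open Classical in
    if pathHit F γ s k = ⊤ then ⊤ else nextTime F γ (pathHit F γ s k).toReal

lemma hit_eq_pathHit (hγ : ∀ (k : ℕ) (a : ℝ), pathHit F γ s k = a → ∀ u, a ≤ u →
    θ a u (γ a) = γ u) (k : ℕ) : hitTime θ F s (γ s) k = pathHit F γ s k ∧
      ∀ a : ℝ, pathHit F γ s k = a → hitPoint θ F s (γ s) k = γ a := by
  induction k with
  | zero =>
    refine ⟨rfl, fun a ha => ?_⟩
    rw [pathHit, EReal.coe_eq_coe_iff] at ha
    rw [hitPoint_zero, ha]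
  | succ k ih =>
    rcases hitTime_eq_top_or (θ := θ) (F := F) (s := s) (x := γ s) (k := k) with h | ⟨a, ha, h⟩
    · have hp := ih.1.symm.trans h
      have h1 : pathHit F γ s (k + 1) = ⊤ := by rw [pathHit, if_pos hp]
      rw [hitTime_succ_top h, h1]
      exact ⟨rfl, fun a ha => absurd ha.symm (EReal.coe_ne_top a)⟩
    · have hp := ih.1.symm.trans h
      have hz := ih.2 a hp
      have hθ := hγ k a hp
      have h1 : hitTime θ F s (γ s) (k + 1) = pathHit F γ s (k + 1) := by
        rw [hitTime_succ h, pathHit, hp, if_neg (EReal.coe_ne_top a), EReal.toReal_coe, hz]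
        unfold nextTime
        congr 1
        ext r
        constructor
        · rintro ⟨t, rfl, ht, htF⟩
          exact ⟨t, rfl, ht, (hθ t (EReal.coe_lt_coe_iff.1 ht).le) ▸ htF⟩
        · rintro ⟨t, rfl, ht, htF⟩
          exact ⟨t, rfl, ht,
            (congrArg (Prod.mk t) (hθ t (EReal.coe_lt_coe_iff.1 ht).le)).symm ▸ htF⟩
      refine ⟨h1, fun b hb => ?_⟩
      have hab : a ≤ b := EReal.coe_le_coe_iff.1
        (by rw [← h, ← hb, ← h1]; exact monotone_hitTime (Nat.le_succ k))
      rw [hitPoint_succ h (h1.trans hb), hz, hθ b hab]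

/-- If `θ` follows the path `γ` from each of the hitting times of `F` by `γ` on, then so does the
restarted family. -/
lemma restart_eq_of_pathHit (hself : ∀ s x, θ s s x = x)
    (hγ : ∀ (k : ℕ) (a : ℝ), pathHit F γ s k = a → ∀ u, a ≤ u → θ a u (γ a) = γ u)
    (hc : hitCount θ F s (γ s) < ⊤) (hst : s ≤ t) : restart θ F s t (γ s) = γ t := by
  obtain ⟨k, a, -, hat, hk, hk'⟩ := exists_hitTime_le_lt hc hst
  have h := hit_eq_pathHit hγ k
  have hp := h.1.symm.trans hk
  rw [restart_eq hself hk hat hk', h.2 a hp, hγ k a hp t hat]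

lemma pathHit_eq_top_or : pathHit F γ s k = ⊤ ∨ ∃ a : ℝ, s ≤ a ∧ pathHit F γ s k = a := by
  induction k with
  | zero => exact Or.inr ⟨s, le_rfl, rfl⟩
  | succ k ih =>
    rcases ih with h | ⟨a, ha, h⟩
    · left; rw [pathHit, if_pos h]
    · rw [pathHit, h, if_neg (EReal.coe_ne_top a), EReal.toReal_coe]
      have hle : (a : EReal) ≤ nextTime F γ a := le_nextTime
      induction hT : nextTime F γ a with
      | bot => rw [hT] at hle; exact absurd hle (EReal.bot_lt_coe a).not_ge
      | top => exact Or.inl rfl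
      | coe b => exact Or.inr ⟨b, ha.trans (EReal.coe_le_coe_iff.1 (hT ▸ hle)), rfl⟩

end HitTimes

section Flow

variable {M : Type*} [TopologicalSpace M]

/-- The pathwise properties of the extension `θ` of a skeleton which make the family obtained by
restarting `θ` at the hitting times of `F` a continuous flow. -/
structure IsRestartable (θ : ℝ → ℝ → M → M) (F : Set (ℝ × M)) : Prop where
  isClosed : IsClosed F
  self : ∀ s x, θ s s x = x
  continuous : ∀ s x, Continuous fun t => θ s t x
  eqOn : ∀ {s s' r : ℝ} {x x' : M}, s ≤ r → s' ≤ r → θ s r x = θ s' r x' → (r, θ s r x) ∉ F →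
    ∃ r' > r, ∀ u ∈ Icc r r', θ s u x = θ s' u x'
  hitCount_lt_top : ∀ s x, hitCount θ F s x < ⊤
  exists_path : ∀ {s t : ℝ} {x : M}, hitCount θ F s x = 0 → s < t →
    ∃ γ : ℝ → M, (∀ r u, t ≤ r → r ≤ u → θ r u (γ r) = γ u) ∧ ∀ u, t ≤ u → θ s u x = γ u

namespace IsRestartable

variable {θ : ℝ → ℝ → M → M} {F : Set (ℝ × M)} {a s t u v : ℝ} {x z : M}

/-- Before the next hitting time of `F`, the family `θ` has the flow property. -/
lemma theta_theta [T2Space M] (h : IsRestartable θ F) (hat : a < t) (htv : t ≤ v)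
    (hv : (v : EReal) ≤ nextTime F (fun r => θ a r z) a) : θ t v (θ a t z) = θ a v z := by
  have hcl : IsClosed {r : ℝ | θ t r (θ a t z) = θ a r z} :=
    isClosed_eq (h.continuous _ _) (h.continuous _ _)
  refine (hcl.inter isClosed_Icc).Icc_subset_of_forall_exists_gt (a := t) (b := v)
    (h.self t _) ?_ (right_mem_Icc.2 htv)
  rintro r ⟨hr, htr, hrv⟩ y hy
  have hF : (r, θ a r z) ∉ F := notMem_of_lt_nextTime (γ := fun r => θ a r z) (hat.trans_le htr)
    ((EReal.coe_lt_coe_iff.2 hrv).trans_le hv)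
  obtain ⟨r', hr', he⟩ := h.eqOn (hat.le.trans htr) htr (Eq.symm hr) hF
  exact ⟨min r' y, (he _ ⟨le_min hr'.le (le_of_lt hy), min_le_left _ _⟩).symm, lt_min hr' hy,
    min_le_right _ _⟩

/-- The flow property at a time `t` of the first piece. If the piece ends after `t`, then the path of
`θ` restarted at time `t` has the same next hitting time and the same position there; if it extends
to infinity, then `θ` follows at time `t` a path along which restarting is harmless. -/
lemma restart_theta [T2Space M] (h : IsRestartable θ F) (hat : a ≤ t) (htu : t ≤ u)
    (ht : (t : EReal) < hitTime θ F a z 1 ∨ hitTime θ F a z 1 = a) :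
    restart θ F a u z = restart θ F t u (θ a t z) := by
  rcases hat.eq_or_lt with rfl | hat'
  · rw [h.self]
  rcases ht with ht | ht
  · have h1 : hitTime θ F a z 1 = nextTime F (fun r => θ a r z) a := hitTime_succ hitTime_zero
    have hn : nextTime F (fun r => θ a r z) t = nextTime F (fun r => θ a r z) a :=
      nextTime_eq_of_lt_nextTime hat (h1 ▸ ht)
    have h2 : hitTime θ F t (θ a t z) 1 = hitTime θ F a z 1 := by
      rw [h1, ← hn]
      refine (hitTime_succ hitTime_zero).trans (nextTime_congr h.isClosed (h.continuous a z) ?_ ?_)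
      · rw [hn, ← h1]; exact ht
      · intro r htr hr
        exact h.theta_theta hat' htr.le (hn ▸ hr)
    by_cases hu : (u : EReal) < hitTime θ F a z 1
    · rw [restart_eq h.self (k := 0) hitTime_zero (hat.trans htu) (Or.inl hu),
        restart_eq h.self (k := 0) hitTime_zero htu (Or.inl (h2 ▸ hu))]
      exact (h.theta_theta hat' htu (h1 ▸ hu.le)).symm
    · obtain ⟨b, -, hbu, hb⟩ := exists_hitTime_eq (not_lt.1 hu)
      have htb : t < b := EReal.coe_lt_coe_iff.1 (hb ▸ ht)
      rw [restart_hitTime h.self h.hitCount_lt_top hb hbu,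
        restart_hitTime h.self h.hitCount_lt_top (h2.trans hb) hbu,
        hitPoint_succ hitTime_zero hb, hitPoint_succ hitTime_zero (h2.trans hb), hitPoint_zero,
        hitPoint_zero, h.theta_theta hat' htb.le (h1 ▸ hb.ge)]
  · have hc : hitCount θ F a z = 0 :=
      le_antisymm (by simpa using hitCount_le (k := 0) (hitTime_zero.trans ht.symm)) (zero_le)
    obtain ⟨γ, hγ, hγ'⟩ := h.exists_path hc hat'
    rw [restart_eq h.self (k := 0) hitTime_zero (hat.trans htu) (Or.inr ht), hitPoint_zero,
      hγ' u htu, hγ' t le_rfl]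
    refine (restart_eq_of_pathHit h.self (fun k b hb v hbv => ?_) (h.hitCount_lt_top _ _)
      htu).symm
    rcases pathHit_eq_top_or (F := F) (γ := γ) (s := t) (k := k) with h' | ⟨c, hc, h'⟩
    · exact absurd (hb.symm.trans h') (EReal.coe_ne_top b)
    · rw [EReal.coe_eq_coe_iff.1 (hb.symm.trans h')] at hbv ⊢
      exact hγ c v hc hbv

theorem restart_restart [T2Space M] (h : IsRestartable θ F) (hst : s ≤ t) (htu : t ≤ u) :
    restart θ F s u x = restart θ F t u (restart θ F s t x) := by
  obtain ⟨k, a, -, hat, hk, hk'⟩ := exists_hitTime_le_lt (h.hitCount_lt_top s x) hst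
  rw [restart_hitTime h.self h.hitCount_lt_top hk (hat.trans htu), restart_eq h.self hk hat hk']
  refine h.restart_theta hat htu ?_
  rwa [(hitTime_add hk 1).1]

/-- The formula for `restart` on the `k`-th piece, including the right end point of the piece. -/
lemma restart_eq_of_le (h : IsRestartable θ F) {k : ℕ} (hk : hitTime θ F s x k = a) (hat : a ≤ t)
    (h' : (t : EReal) ≤ hitTime θ F s x (k + 1) ∨ hitTime θ F s x (k + 1) = a) :
    restart θ F s t x = θ a t (hitPoint θ F s x k) := by
  rcases h' with h' | h'
  · rcases h'.lt_or_eq with h' | h'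
    · exact restart_eq h.self hk hat (Or.inl h')
    · rw [restart_hitTime h.self h.hitCount_lt_top h'.symm le_rfl, restart_self h.self,
        hitPoint_succ hk h'.symm]
  · exact restart_eq h.self hk hat (Or.inr h')

/-- The pieces are closed on both sides, which gives left continuity; right continuity at a time
`t` reduces to the starting time, by the flow property at time `t`. -/
theorem continuousOn_restart [T2Space M] (h : IsRestartable θ F) (s : ℝ) (x : M) :
    ContinuousOn (fun t => restart θ F s t x) (Ici s) := by
  intro t hst
  rw [← Icc_union_Ici_eq_Ici hst]
  refine ContinuousWithinAt.union ?_ ?_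
  · rcases (mem_Ici.1 hst).eq_or_lt with rfl | hst'
    · rw [Icc_self]; exact continuousWithinAt_singleton
    obtain ⟨k, a, -, hat, hk, hk'⟩ := exists_hitTime_lt_le (h.hitCount_lt_top s x) hst'
    have he : ∀ r ∈ Icc a t, restart θ F s r x = θ a r (hitPoint θ F s x k) := fun r hr =>
      h.restart_eq_of_le hk hr.1 (hk'.imp_left (EReal.coe_le_coe_iff.2 hr.2).trans)
    have hc : ContinuousWithinAt (fun t => restart θ F s t x) (Icc a t) t :=
      (h.continuous a _).continuousWithinAt.congr he (he t (right_mem_Icc.2 hat.le))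
    refine hc.mono_of_mem_nhdsWithin ?_
    filter_upwards [self_mem_nhdsWithin, mem_nhdsWithin_of_mem_nhds (Ici_mem_nhds hat)] with r h1 h2
    exact ⟨h2, h1.2⟩
  · set y := restart θ F s t x with hy
    have he : ∀ r ∈ Ici t, restart θ F s r x = restart θ F t r y := fun r hr =>
      h.restart_restart hst hr
    refine ContinuousWithinAt.congr (f := fun r => restart θ F t r y) ?_ he (he t self_mem_Ici)
    have h1 : (t : EReal) < hitTime θ F t y 1 ∨ hitTime θ F t y 1 = t :=
      (monotone_hitTime (Nat.zero_le 1) : hitTime θ F t y 0 ≤ _).lt_or_eq.imp id Eq.symm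
    have he' : (fun r => restart θ F t r y) =ᶠ[𝓝[Ici t] t] fun r => θ t r y := by
      rcases h1 with h1 | h1
      · obtain ⟨b, htb, hb⟩ := EReal.lt_iff_exists_real_btwn.1 h1
        filter_upwards [self_mem_nhdsWithin, mem_nhdsWithin_of_mem_nhds
          (Iio_mem_nhds (EReal.coe_lt_coe_iff.1 htb))] with r hr hrb
        exact restart_eq h.self (k := 0) hitTime_zero hr
          (Or.inl ((EReal.coe_lt_coe_iff.2 hrb).trans hb))
      · filter_upwards [self_mem_nhdsWithin] with r hr
        exact restart_eq h.self (k := 0) hitTime_zero hr (Or.inr h1)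
    refine (h.continuous t y).continuousWithinAt.congr_of_eventuallyEq he' ?_
    rw [restart_self h.self, h.self]

end IsRestartable

end Flow

/-! ### Measurability of hitting times and of the restarted family -/

section Measurability

variable {M : Type*} [MetricSpace M] {F : Set (ℝ × M)}

/-- A continuous path meets the closed set `F` during a compact interval if and only if it comes
arbitrarily close to `F` at rational times. -/
lemma exists_mem_Icc_iff (hF : IsClosed F) {γ : ℝ → M} (hγ : Continuous γ) {p q : ℝ} (hpq : p < q) :
    (∃ t ∈ Icc p q, (t, γ t) ∈ F) ↔ ∀ n : ℕ, ∃ r : ℚ, (r : ℝ) ∈ Icc p q ∧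
      Metric.infEDist ((r : ℝ), γ r) F < ((n : ℝ≥0∞) + 1)⁻¹ := by
  have hg : Continuous fun t => Metric.infEDist (t, γ t) F :=
    Metric.continuous_infEDist.comp (continuous_id.prodMk hγ)
  constructor
  · rintro ⟨t, ht, htF⟩ n
    have hU : IsOpen {u | Metric.infEDist (u, γ u) F < ((n : ℝ≥0∞) + 1)⁻¹} :=
      isOpen_lt hg continuous_const
    have ht' : t ∈ closure (Ioo p q) := by rwa [closure_Ioo hpq.ne]
    have htU : t ∈ {u | Metric.infEDist (u, γ u) F < ((n : ℝ≥0∞) + 1)⁻¹} := by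
      rw [mem_ofPred_eq, (Metric.mem_iff_infEDist_zero_of_closed hF).1 htF]
      exact ENNReal.inv_pos.2 (ENNReal.add_ne_top.2 ⟨ENNReal.natCast_ne_top n, ENNReal.one_ne_top⟩)
    obtain ⟨r, h1, h2⟩ := Rat.denseRange_cast.exists_mem_open (hU.inter isOpen_Ioo)
      (mem_closure_iff.1 ht' _ hU htU)
    exact ⟨r, Ioo_subset_Icc_self h2, h1⟩
  · intro h
    obtain ⟨t, ht, hmin⟩ := isCompact_Icc.exists_isMinOn (nonempty_Icc.2 hpq.le) hg.continuousOn
    refine ⟨t, ht, (Metric.mem_iff_infEDist_zero_of_closed hF).2 ?_⟩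
    by_contra hne
    obtain ⟨n, hn⟩ := ENNReal.exists_inv_nat_lt hne
    obtain ⟨r, hr, hr'⟩ := h n
    refine absurd (isMinOn_iff.1 hmin r hr) (not_le.2 (hr'.trans (lt_of_le_of_lt ?_ hn)))
    exact ENNReal.inv_le_inv.2 (le_self_add)

omit [MetricSpace M] in
lemma nextTime_lt_iff {γ : ℝ → M} {a : ℝ} {c : EReal} :
    nextTime F γ a < c ↔ ∃ p q : ℚ, p < q ∧ a < p ∧ ((q : ℝ) : EReal) < c ∧
      ∃ t ∈ Icc (p : ℝ) q, (t, γ t) ∈ F := by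
  constructor
  · intro h
    obtain ⟨_, ⟨t, rfl, ht, htF⟩, htc⟩ := sInf_lt_iff.1 h
    obtain ⟨p, hp, hpt⟩ := EReal.lt_iff_exists_rat_btwn.1 ht
    obtain ⟨q, hq, hqc⟩ := EReal.lt_iff_exists_rat_btwn.1 htc
    have h1 : (p : ℝ) < t := EReal.coe_lt_coe_iff.1 hpt
    have h2 : t < (q : ℝ) := EReal.coe_lt_coe_iff.1 hq
    exact ⟨p, q, by exact_mod_cast h1.trans h2, EReal.coe_lt_coe_iff.1 hp, hqc, t, ⟨h1.le, h2.le⟩,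
      htF⟩
  · rintro ⟨p, q, -, hap, hqc, t, ht, htF⟩
    exact ((nextTime_le (hap.trans_le ht.1) htF).trans (EReal.coe_le_coe_iff.2 ht.2)).trans_lt hqc

variable [ProperSpace M] [MeasurableSpace M] [BorelSpace M]

lemma measurableSet_exists_mem_Icc {A : Type*} [MeasurableSpace A] (hF : IsClosed F)
    {γ : A → ℝ → M} (hγ : ∀ a, Continuous (γ a)) {p q : ℝ} (hpq : p < q)
    (hm : ∀ t ∈ Icc p q, Measurable fun a => γ a t) :
    MeasurableSet {a | ∃ t ∈ Icc p q, (t, γ a t) ∈ F} := by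
  simp_rw [exists_mem_Icc_iff hF (hγ _) hpq, ofPred_forall, ofPred_exists]
  refine .iInter fun n => .iUnion fun r => ?_
  by_cases hr : (r : ℝ) ∈ Icc p q
  · simp only [hr, true_and]
    exact measurableSet_lt (Metric.continuous_infEDist.measurable.comp
      (measurable_const.prodMk (hm r hr))) measurable_const
  · simp [hr]

lemma measurable_nextTime {A : Type*} [MeasurableSpace A] (hF : IsClosed F)
    {γ : A → ℝ → M} (hγ : ∀ a, Continuous (γ a)) (hm : ∀ t, Measurable fun a => γ a t)
    {τ : A → ℝ} (hτ : Measurable τ) : Measurable fun a => nextTime F (γ a) (τ a) := by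
  refine measurable_of_Iio fun c => ?_
  change MeasurableSet {a | nextTime F (γ a) (τ a) < c}
  simp_rw [nextTime_lt_iff, ofPred_exists]
  refine .iUnion fun p => .iUnion fun q => ?_
  by_cases hpq : p < q
  · simp only [hpq, true_and]
    refine .inter (measurableSet_lt hτ measurable_const) (.inter (.const _) ?_)
    exact measurableSet_exists_mem_Icc hF hγ (by exact_mod_cast hpq) fun t _ => hm t
  · simp [hpq]

omit [MetricSpace M] [ProperSpace M] [MeasurableSpace M] [BorelSpace M] in
lemma measurable_sInf_nat {A : Type*} [MeasurableSpace A] {S : ℕ → A → Prop}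
    (hS : ∀ n, MeasurableSet {a | S n a}) : Measurable fun a => sInf {n | S n a} := by
  refine measurable_to_countable' fun n => ?_
  have h : (fun a => sInf {n | S n a}) ⁻¹' {n} = {a | (S n a ∧ ∀ m < n, ¬ S m a) ∨
      (n = 0 ∧ ∀ m, ¬ S m a)} := by
    ext a
    simp only [mem_preimage, mem_singleton_iff, mem_ofPred_eq]
    constructor
    · rintro rfl
      rcases eq_empty_or_nonempty {n | S n a} with h | h
      · right
        refine ⟨by rw [h]; exact Nat.sInf_empty, fun m hm => ?_⟩
        exact notMem_empty m (h ▸ hm)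
      · exact Or.inl ⟨Nat.sInf_mem h, fun m hm => Nat.notMem_of_lt_sInf hm⟩
    · rintro (⟨h1, h2⟩ | ⟨rfl, h⟩)
      · refine le_antisymm (Nat.sInf_le h1) (le_csInf ⟨n, h1⟩ fun m hm => ?_)
        by_contra hlt
        exact h2 m (not_le.1 hlt) hm
      · rw [show {n | S n a} = ∅ from eq_empty_of_forall_notMem h]
        exact Nat.sInf_empty
  rw [h]
  refine .union (.inter (hS n) ?_) (.inter (.const _) ?_)
  · exact .congr (.iInter fun m => .iInter fun _ : m < n => (hS m).compl) (by ext; simp; rfl)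
  · exact .congr (.iInter fun m => (hS m).compl) (by ext; simp; rfl)

variable {Ω : Type*} [MeasurableSpace Ω] {Φ : ℕ → Ω → PathSpace M} {ε : ℕ → M → ℝ}
  {ℓ : (ℕ → PathSpace M) → PathSpace M}

lemma measurable_approxIndex (hΦ : ∀ n, Measurable (Φ n)) (hε : ∀ k, Measurable (ε k)) (k : ℕ) :
    Measurable fun q : ℝ × M × Ω => approxIndex ε q.1 q.2.1 (fun n => Φ n q.2.2) k := by
  refine measurable_sInf_nat fun n => ?_
  have h1 : Measurable fun q : ℝ × M × Ω => Φ n q.2.2 :=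
    (hΦ n).comp (measurable_snd.comp measurable_snd)
  have h2 : Measurable fun q : ℝ × M × Ω => q.2.1 := measurable_fst.comp measurable_snd
  refine .inter (measurableSet_le (continuous_start.measurable.comp h1) measurable_fst)
    (measurableSet_lt (.dist ?_ h2) ((hε k).comp h2))
  exact continuous_val_uncurry.measurable.comp (h1.prodMk measurable_fst)

lemma measurable_bigTheta (hΦ : ∀ n, Measurable (Φ n)) (hε : ∀ k, Measurable (ε k))
    (hℓ : Measurable ℓ) :
    Measurable fun q : ℝ × M × Ω => bigTheta ℓ ε q.1 q.2.1 (fun n => Φ n q.2.2) := by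
  refine hℓ.comp (measurable_pi_iff.2 fun k => ?_)
  have h : Measurable fun p : ℕ × ℝ × M × Ω => restrictFrom (Φ p.1 p.2.2.2) p.2.1 :=
    measurable_from_prod_countable_right fun n => continuous_restrictFrom_uncurry.measurable.comp
      (((hΦ n).comp (measurable_snd.comp measurable_snd)).prodMk measurable_fst)
  exact h.comp ((measurable_approxIndex hΦ hε k).prodMk measurable_id)

variable {θ : Ω → ℝ → ℝ → M → M} {Θ : ℝ × M × Ω → PathSpace M}

/-- The hitting times and the hitting points depend measurably on `(s, x, ω)`, if `θ` is given by a
measurable family `Θ` of paths. -/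
lemma measurable_hit (hF : IsClosed F) (hΘ : Measurable Θ)
    (hθ : ∀ ω s t x, θ ω s t x = val (Θ (s, x, ω)) t) (k : ℕ) :
    Measurable fun q : ℝ × M × Ω => hit (θ q.2.2) F q.1 q.2.1 k := by
  induction k with
  | zero =>
    exact (measurable_coe_real_ereal.comp measurable_fst).prodMk (measurable_fst.comp measurable_snd)
  | succ k ih =>
    have hT : Measurable fun q : ℝ × M × Ω => hitTime (θ q.2.2) F q.1 q.2.1 k :=
      measurable_fst.comp ih
    have hT' : Measurable fun q : ℝ × M × Ω => (hitTime (θ q.2.2) F q.1 q.2.1 k).toReal :=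
      hT.ereal_toReal
    have hz : Measurable fun q : ℝ × M × Ω => hitPoint (θ q.2.2) F q.1 q.2.1 k :=
      measurable_snd.comp ih
    have hf : Measurable fun q : ℝ × M × Ω => Θ ((hitTime (θ q.2.2) F q.1 q.2.1 k).toReal,
        hitPoint (θ q.2.2) F q.1 q.2.1 k, q.2.2) :=
      hΘ.comp (hT'.prodMk (hz.prodMk (measurable_snd.comp measurable_snd)))
    have hσ : Measurable fun q : ℝ × M × Ω => hitTime (θ q.2.2) F q.1 q.2.1 (k + 1) := by
      have heq : (fun q : ℝ × M × Ω => hitTime (θ q.2.2) F q.1 q.2.1 (k + 1)) = fun q =>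
          open Classical in if hitTime (θ q.2.2) F q.1 q.2.1 k = ⊤ then ⊤ else
          nextTime F (val (Θ ((hitTime (θ q.2.2) F q.1 q.2.1 k).toReal,
            hitPoint (θ q.2.2) F q.1 q.2.1 k, q.2.2))) (hitTime (θ q.2.2) F q.1 q.2.1 k).toReal := by
        funext q
        split_ifs with h
        · exact hitTime_succ_top h
        · rcases hitTime_eq_top_or (θ := θ q.2.2) (F := F) (s := q.1) (x := q.2.1) (k := k) with
            h' | ⟨a, -, h'⟩
          · exact absurd h' h
          · rw [hitTime_succ h', h', EReal.toReal_coe]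
            simp only [hθ]
      rw [heq]
      exact Measurable.ite (measurableSet_eq_fun hT measurable_const) measurable_const
        (measurable_nextTime hF (fun q => continuous_val_right _)
          (fun t => (continuous_val_left t).measurable.comp hf) hT')
    refine hσ.prodMk (?_ : Measurable fun q : ℝ × M × Ω => hitPoint (θ q.2.2) F q.1 q.2.1 (k + 1))
    have heq : (fun q : ℝ × M × Ω => hitPoint (θ q.2.2) F q.1 q.2.1 (k + 1)) = fun q =>
        open Classical in if hitTime (θ q.2.2) F q.1 q.2.1 (k + 1) = ⊤ then q.2.1 else
        val (Θ ((hitTime (θ q.2.2) F q.1 q.2.1 k).toReal,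
          hitPoint (θ q.2.2) F q.1 q.2.1 k, q.2.2))
          (hitTime (θ q.2.2) F q.1 q.2.1 (k + 1)).toReal := by
      funext q
      rw [← hθ]
      rfl
    rw [heq]
    exact Measurable.ite (measurableSet_eq_fun hσ measurable_const)
      (measurable_fst.comp measurable_snd)
      (continuous_val_uncurry.measurable.comp (hf.prodMk hσ.ereal_toReal))

omit [MetricSpace M] [ProperSpace M] [MeasurableSpace M] [BorelSpace M] in
lemma hitCount_lt_top_iff {θ : ℝ → ℝ → M → M} {F : Set (ℝ × M)} {s : ℝ} {x : M} :
    hitCount θ F s x < ⊤ ↔ ∃ k, hitTime θ F s x k = hitTime θ F s x (k + 1) :=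
  ⟨fun h => ⟨_, exists_of_hitCount_lt_top h⟩,
    fun ⟨k, hk⟩ => (hitCount_le hk).trans_lt (ENat.natCast_lt_top k)⟩

omit [MetricSpace M] [ProperSpace M] [MeasurableSpace M] [BorelSpace M] in
lemma toNat_hitCount {θ : ℝ → ℝ → M → M} {F : Set (ℝ × M)} {s : ℝ} {x : M}
    (h : hitCount θ F s x < ⊤) : (hitCount θ F s x).toNat =
      sInf {k | hitTime θ F s x k = hitTime θ F s x (k + 1)} := by
  have hk := exists_of_hitCount_lt_top h
  refine le_antisymm ?_ (Nat.sInf_le hk)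
  exact ENat.toNat_le_of_le_natCast (hitCount_le (Nat.sInf_mem (s :=
    {k | hitTime θ F s x k = hitTime θ F s x (k + 1)}) ⟨_, hk⟩))

lemma measurable_restart (hF : IsClosed F) (hΘ : Measurable Θ)
    (hθ : ∀ ω s t x, θ ω s t x = val (Θ (s, x, ω)) t) :
    Measurable fun q : ℝ × ℝ × M × Ω => restart (θ q.2.2.2) F q.1 q.2.1 q.2.2.1 := by
  have hπ : Measurable fun q : ℝ × ℝ × M × Ω => (q.1, q.2.2.1, q.2.2.2) :=
    measurable_fst.prodMk (measurable_snd.comp measurable_snd)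
  have hω : Measurable fun q : ℝ × ℝ × M × Ω => q.2.2.2 :=
    measurable_snd.comp (measurable_snd.comp measurable_snd)
  have ht : Measurable fun q : ℝ × ℝ × M × Ω => q.2.1 := measurable_fst.comp measurable_snd
  have ht' : Measurable fun q : ℝ × ℝ × M × Ω => (q.2.1 : EReal) :=
    measurable_coe_real_ereal.comp ht
  have hT : ∀ k, Measurable fun q : ℝ × ℝ × M × Ω => hitTime (θ q.2.2.2) F q.1 q.2.2.1 k :=
    fun k => measurable_fst.comp ((measurable_hit hF hΘ hθ k).comp hπ)
  have hz : ∀ k, Measurable fun q : ℝ × ℝ × M × Ω => hitPoint (θ q.2.2.2) F q.1 q.2.2.1 k :=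
    fun k => measurable_snd.comp ((measurable_hit hF hΘ hθ k).comp hπ)
  -- the pieces of the concatenated path, jointly with their index
  have hpiece : Measurable fun p : ℕ × ℝ × ℝ × M × Ω =>
      θ p.2.2.2.2 (hitTime (θ p.2.2.2.2) F p.2.1 p.2.2.2.1 p.1).toReal p.2.2.1
        (hitPoint (θ p.2.2.2.2) F p.2.1 p.2.2.2.1 p.1) := by
    refine measurable_from_prod_countable_right fun k => ?_
    simp only [hθ _ _ _ _]
    exact continuous_val_uncurry.measurable.comp
      ((hΘ.comp ((hT k).ereal_toReal.prodMk ((hz k).prodMk hω))).prodMk ht)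
  have hindex : Measurable fun q : ℝ × ℝ × M × Ω => sInf {k : ℕ |
      hitTime (θ q.2.2.2) F q.1 q.2.2.1 k ≤ (q.2.1 : EReal) ∧
        (q.2.1 : EReal) < hitTime (θ q.2.2.2) F q.1 q.2.2.1 (k + 1)} :=
    measurable_sInf_nat fun k => .inter (measurableSet_le (hT k) ht')
      (measurableSet_lt ht' (hT (k + 1)))
  have hEq : ∀ k, MeasurableSet {q : ℝ × ℝ × M × Ω |
      hitTime (θ q.2.2.2) F q.1 q.2.2.1 k = hitTime (θ q.2.2.2) F q.1 q.2.2.1 (k + 1)} :=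
    fun k => measurableSet_eq_fun (hT k) (hT (k + 1))
  have hindex' := measurable_sInf_nat hEq
  refine Measurable.ite (measurableSet_lt ht' (.iSup hT))
    (hpiece.comp (hindex.prodMk measurable_id)) ?_
  have heq : (fun q : ℝ × ℝ × M × Ω => open Classical in
      if hitCount (θ q.2.2.2) F q.1 q.2.2.1 < ⊤ then
        let k := (hitCount (θ q.2.2.2) F q.1 q.2.2.1).toNat
        θ q.2.2.2 (hitTime (θ q.2.2.2) F q.1 q.2.2.1 k).toReal q.2.1
          (hitPoint (θ q.2.2.2) F q.1 q.2.2.1 k)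
      else q.2.2.1) = fun q => open Classical in
      if ∃ k, hitTime (θ q.2.2.2) F q.1 q.2.2.1 k = hitTime (θ q.2.2.2) F q.1 q.2.2.1 (k + 1) then
        let k := sInf {k | hitTime (θ q.2.2.2) F q.1 q.2.2.1 k =
          hitTime (θ q.2.2.2) F q.1 q.2.2.1 (k + 1)}
        θ q.2.2.2 (hitTime (θ q.2.2.2) F q.1 q.2.2.1 k).toReal q.2.1
          (hitPoint (θ q.2.2.2) F q.1 q.2.2.1 k)
      else q.2.2.1 := by
    funext q
    by_cases h : hitCount (θ q.2.2.2) F q.1 q.2.2.1 < ⊤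
    · rw [if_pos h, if_pos (hitCount_lt_top_iff.1 h), toNat_hitCount h]
    · rw [if_neg h, if_neg (mt hitCount_lt_top_iff.2 h)]
  rw [heq]
  refine Measurable.ite ?_ (hpiece.comp (hindex'.prodMk measurable_id))
    (measurable_fst.comp (measurable_snd.comp measurable_snd))
  rw [ofPred_exists]
  exact .iUnion hEq

end Measurability

/-! ### The strong Markov property at optional times -/

section OptionalTimes

/-- Passage from deterministic times to optional times, by approximation from the right with
discrete times: if a continuous process `X` is such that `X r` has integral zero over all events of
the past at time `r`, then so has `X σ` over the events of the past at an optional time `σ`. -/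
lemma setIntegral_optional_eq_zero {Ω : Type*} [mΩ : MeasurableSpace Ω] {μ : Measure Ω}
    [IsFiniteMeasure μ] {𝓕 : ℝ → MeasurableSpace Ω} (h𝓕 : ∀ r, 𝓕 r ≤ mΩ) (hmono : Monotone 𝓕)
    {X : ℝ → Ω → ℝ} (hXm : ∀ r, Measurable (X r)) (hXc : ∀ ω, Continuous fun r => X r ω)
    {C : ℝ} (hXb : ∀ r ω, |X r ω| ≤ C) {r₀ : ℝ}
    (hX : ∀ r, r₀ ≤ r → ∀ B, MeasurableSet[𝓕 r] B → ∫ ω in B, X r ω ∂μ = 0)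
    {B : Set Ω} {σ : Ω → ℝ} (hσ : Measurable σ) (hr₀ : ∀ ω ∈ B, r₀ ≤ σ ω)
    (hB : ∀ q, MeasurableSet[𝓕 q] (B ∩ {ω | σ ω < q})) : ∫ ω in B, X (σ ω) ω ∂μ = 0 := by
  have hXu : Measurable fun p : ℝ × Ω => X p.1 p.2 :=
    measurable_uncurry_of_continuous_of_measurable hXc hXm
  -- the discrete approximation of `σ` on the grid of mesh `1 / (m + 1)`
  let ρ : ℕ → Ω → ℤ := fun m ω => ⌊σ ω * (m + 1)⌋ + 1
  have hρm : ∀ m, Measurable (ρ m) := fun m =>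
    (measurable_of_countable (fun j : ℤ => j + 1)).comp
      (Int.measurable_floor.comp (hσ.mul_const _))
  let τ : ℕ → Ω → ℝ := fun m ω => ρ m ω / (m + 1)
  have hτm : ∀ m, Measurable (τ m) := fun m =>
    ((measurable_of_countable (fun j : ℤ => (j : ℝ))).comp (hρm m)).div_const _
  have hpos : ∀ m : ℕ, (0 : ℝ) < m + 1 := fun m => by positivity
  have hρ : ∀ m ω (j : ℤ), ρ m ω = j ↔ σ ω < j / (m + 1) ∧ ¬ σ ω < (j - 1 : ℤ) / (m + 1) := by
    intro m ω j
    have h1 : ρ m ω = j ↔ ⌊σ ω * (m + 1)⌋ = j - 1 := by simp only [ρ]; omega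
    rw [h1, Int.floor_eq_iff, lt_div_iff₀ (hpos m), not_lt, div_le_iff₀ (hpos m)]
    push_cast
    rw [sub_add_cancel, and_comm]
  have hτσ : ∀ m ω, σ ω < τ m ω ∧ τ m ω ≤ σ ω + 1 / (m + 1) := by
    intro m ω
    refine ⟨((hρ m ω _).1 rfl).1, ?_⟩
    have h := not_lt.1 ((hρ m ω _).1 rfl).2
    push_cast at h
    rw [sub_div] at h
    linarith
  have hBm : MeasurableSet B := by
    have : B = ⋃ q : ℕ, B ∩ {ω | σ ω < q} := by
      rw [← inter_iUnion, eq_comm, inter_eq_left]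
      intro ω _
      obtain ⟨q, hq⟩ := exists_nat_gt (σ ω)
      exact mem_iUnion.2 ⟨q, hq⟩
    rw [this]
    exact .iUnion fun q => h𝓕 _ _ (hB q)
  have hint : ∀ τ : Ω → ℝ, Measurable τ → Integrable (fun ω => X (τ ω) ω) μ := fun τ hτ =>
    Integrable.of_bound (C := C) (hXu.comp (hτ.prodMk measurable_id)).aestronglyMeasurable
      (Eventually.of_forall fun ω => (Real.norm_eq_abs _).trans_le (hXb _ ω))
  have hzero : ∀ m, ∫ ω in B, X (τ m ω) ω ∂μ = 0 := by
    intro m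
    have hU : B = ⋃ j : ℤ, B ∩ ρ m ⁻¹' {j} := by
      rw [← inter_iUnion, ← preimage_iUnion, iUnion_of_singleton, preimage_univ, inter_univ]
    have hdisj : Pairwise (Function.onFun Disjoint fun j : ℤ => B ∩ ρ m ⁻¹' {j}) := by
      intro i j hij
      refine disjoint_left.2 fun ω h1 h2 => hij ?_
      exact (h1.2 : ρ m ω = i).symm.trans h2.2
    rw [hU, integral_iUnion (fun j => hBm.inter (hρm m (measurableSet_singleton j))) hdisj
      (hint _ (hτm m)).integrableOn]
    refine (tsum_congr fun j => ?_).trans tsum_zero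
    rcases eq_empty_or_nonempty (B ∩ ρ m ⁻¹' {j}) with he | ⟨ω₀, hω₀, hj⟩
    · rw [he, setIntegral_empty]
    have hBj : MeasurableSet[𝓕 (j / (m + 1))] (B ∩ ρ m ⁻¹' {j}) := by
      have : B ∩ ρ m ⁻¹' {j} = (B ∩ {ω | σ ω < j / (m + 1)}) \
          (B ∩ {ω | σ ω < (j - 1 : ℤ) / (m + 1)}) := by
        ext ω
        have := hρ m ω j
        simp only [mem_inter_iff, mem_preimage, mem_singleton_iff, Set.mem_sdiff, mem_ofPred_eq, this]
        tauto
      rw [this]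
      refine MeasurableSet.diff (hB _) (hmono ?_ _ (hB _))
      exact div_le_div_of_nonneg_right (by push_cast; linarith) (hpos m).le
    have hr : r₀ ≤ (j : ℝ) / (m + 1) :=
      (hr₀ ω₀ hω₀).trans ((hρ m ω₀ j).1 hj).1.le
    rw [← hX _ hr _ hBj]
    refine setIntegral_congr_fun (h𝓕 _ _ hBj) fun ω hω => ?_
    have : ρ m ω = j := hω.2
    simp only [τ, this]
  have hlim : Tendsto (fun m => ∫ ω in B, X (τ m ω) ω ∂μ) atTop (𝓝 (∫ ω in B, X (σ ω) ω ∂μ)) := by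
    refine tendsto_integral_of_dominated_convergence (fun _ => C)
      (fun m => (hint _ (hτm m)).aestronglyMeasurable.restrict) (integrable_const _)
      (fun m => Eventually.of_forall fun ω => (Real.norm_eq_abs _).trans_le (hXb _ ω))
      (Eventually.of_forall fun ω => ((hXc ω).tendsto _).comp ?_)
    have h1 : Tendsto (fun m : ℕ => σ ω + 1 / ((m : ℝ) + 1)) atTop (𝓝 (σ ω)) := by
      simpa using tendsto_const_nhds.add (tendsto_one_div_add_atTop_nhds_zero_nat (𝕜 := ℝ))
    exact tendsto_of_tendsto_of_tendsto_of_le_of_le tendsto_const_nhds h1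
      (fun m => (hτσ m ω).1.le) (fun m => (hτσ m ω).2)
  exact tendsto_nhds_unique hlim (by simp only [hzero]; exact tendsto_const_nhds)

variable {M : Type*} [MetricSpace M] [ProperSpace M] [MeasurableSpace M] [BorelSpace M]
  {Ω : Type*} [MeasurableSpace Ω] {μ : Measure Ω} [IsProbabilityMeasure μ]
  {P : (n : ℕ) → ℝ≥0 → Kernel (Fin n → M) (Fin n → M)} {ψ : ℝ → ℝ → Ω → MeasMap M}
  {ι : Type*} {D : ι → ℝ × M} {Y : ι → Ω → PathSpace M}

/-- The strong Markov property of a pair of trajectories at an optional time `σ`, on an event of the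
past at time `σ`. -/
lemma hasFDD_map_pairPath_optional (hP : IsConsistentCoalescing P) (hψ : IsStochasticFlow P μ ψ)
    (hY : ∀ a, IsVersion μ ψ (D a) (Y a)) {a b : ι} {B : Set Ω} {σ : Ω → ℝ} (hσ : Measurable σ)
    (ha : ∀ ω ∈ B, (D a).1 ≤ σ ω) (hb : ∀ ω ∈ B, (D b).1 ≤ σ ω)
    (hB : ∀ q, MeasurableSet[pastSigma D Y q] (B ∩ {ω | σ ω < q})) :
    HasFDD (hP.feller 2) ((μ.restrict B).map fun ω => pairPath (Y a ω) (Y b ω) (σ ω)) := by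
  intro I f
  obtain ⟨C, hC⟩ := exists_abs_fdd_le (hP.feller 2) I f
  have hc1 : Continuous fun w : C(ℝ≥0, Fin 2 → M) => ∏ t ∈ I, f t (w t) :=
    continuous_finsetProd _ fun t _ => (f t).continuous.comp (continuous_eval_const t)
  have hc2 : Continuous fun w : C(ℝ≥0, Fin 2 → M) => fdd (hP.feller 2) I f (w 0) :=
    (continuous_fdd _ I f).comp (continuous_eval_const 0)
  have hb1 : ∀ w : C(ℝ≥0, Fin 2 → M), |∏ t ∈ I, f t (w t)| ≤ ∏ t ∈ I, ‖(f t).toBCF‖ := fun w => by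
    rw [Finset.abs_prod]
    exact Finset.prod_le_prod (fun _ _ => abs_nonneg _) fun t _ => abs_zeroAtInfty_le _ _
  have hi1 : ∀ (ν : Measure C(ℝ≥0, Fin 2 → M)) [IsFiniteMeasure ν],
      Integrable (fun w => ∏ t ∈ I, f t (w t)) ν := fun ν _ =>
    Integrable.of_bound hc1.measurable.aestronglyMeasurable _
      (Eventually.of_forall fun w => (Real.norm_eq_abs _).trans_le (hb1 w))
  have hi2 : ∀ (ν : Measure C(ℝ≥0, Fin 2 → M)) [IsFiniteMeasure ν],
      Integrable (fun w => fdd (hP.feller 2) I f (w 0)) ν := fun ν _ =>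
    Integrable.of_bound hc2.measurable.aestronglyMeasurable _
      (Eventually.of_forall fun w => (Real.norm_eq_abs _).trans_le (hC _))
  have hcont : ∀ ω, Continuous fun r => pairPath (Y a ω) (Y b ω) r := fun ω =>
    ContinuousMap.continuous_of_continuous_uncurry _ (by
      have h1 := continuous_val_right (Y a ω)
      have h2 := continuous_val_right (Y b ω)
      change Continuous fun p : ℝ × ℝ≥0 => ![val (Y a ω) (p.1 + p.2), val (Y b ω) (p.1 + p.2)]
      fun_prop)
  -- the defect in the identity of finite-dimensional distributions, after the time `r`
  let X : ℝ → Ω → ℝ := fun r ω => ∏ t ∈ I, f t (pairPath (Y a ω) (Y b ω) r t) -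
    fdd (hP.feller 2) I f (pairPath (Y a ω) (Y b ω) r 0)
  have hm : ∀ σ : Ω → ℝ, Measurable σ → Measurable fun ω => pairPath (Y a ω) (Y b ω) (σ ω) :=
    fun σ hσ => measurable_pairPath (hY a).measurable (hY b).measurable hσ
  have hX : ∀ (σ : Ω → ℝ), Measurable σ → ∀ B : Set Ω, ∫ ω in B, X (σ ω) ω ∂μ =
      ∫ w, ∏ t ∈ I, f t (w t) ∂((μ.restrict B).map fun ω => pairPath (Y a ω) (Y b ω) (σ ω)) -
      ∫ w, fdd (hP.feller 2) I f (w 0)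
        ∂((μ.restrict B).map fun ω => pairPath (Y a ω) (Y b ω) (σ ω)) := by
    intro σ hσ B
    rw [← integral_sub (hi1 _) (hi2 _)]
    exact (integral_map (hm σ hσ).aemeasurable
      (hc1.sub hc2).measurable.aestronglyMeasurable).symm
  rw [← sub_eq_zero, ← hX σ hσ B]
  refine setIntegral_optional_eq_zero (𝓕 := pastSigma D Y) (X := X) (pastSigma_le hY)
    (fun _ _ h => pastSigma_mono h)
    (fun r => (hc1.sub hc2).measurable.comp (hm (fun _ => r) measurable_const))
    (fun ω => (hc1.sub hc2).comp (hcont ω)) (C := ∏ t ∈ I, ‖(f t).toBCF‖ + C)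
    (fun r ω => (abs_sub _ _).trans (add_le_add (hb1 _) (hC _)))
    (r₀ := max (D a).1 (D b).1) (fun r hr B hB => ?_) hσ
    (fun ω hω => max_le (ha ω hω) (hb ω hω)) hB
  rw [hX (fun _ => r) measurable_const, sub_eq_zero]
  exact (isMarkovMeasure_map_pairPath hψ hY ((le_max_left _ _).trans hr)
    ((le_max_right _ _).trans hr) hB).hasFDD (hP.feller 2) I f

omit [ProperSpace M] [IsProbabilityMeasure μ] in
/-- The position at the time `τ ∧ q` belongs to the past at time `q`, if `τ` does. Before its starting
time a path is constant, so that no lower bound for `τ` is needed. -/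
lemma measurable_val_min (hY : ∀ a, IsVersion μ ψ (D a) (Y a)) (a : ι) {q : ℝ} {τ : Ω → ℝ}
    (hτ : Measurable[pastSigma D Y q] τ) :
    Measurable[pastSigma D Y q] fun ω => val (Y a ω) (min (τ ω) q) := by
  have hconst : ∀ u, u ≤ (D a).1 → (fun ω => val (Y a ω) u) = fun _ => (D a).2 := fun u h => by
    funext ω
    rw [val_of_le_start _ (h.trans_eq ((hY a).start_eq ω).symm), (hY a).start_eq, (hY a).val_start]
  let := pastSigma D Y q
  have hm : ∀ u, Measurable fun ω => val (Y a ω) (min u q) := by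
    intro u
    rcases le_total (D a).1 (min u q) with h | h
    · exact measurable_val_pastSigma h (min_le_right _ _)
    · rw [hconst _ h]
      exact measurable_const
  have hu : Measurable fun p : ℝ × Ω => val (Y a p.2) (min p.1 q) :=
    measurable_uncurry_of_continuous_of_measurable
      (fun ω => (continuous_val_right (Y a ω)).comp (continuous_id.min continuous_const)) hm
  exact hu.comp (hτ.prodMk measurable_id)

end OptionalTimes

/-! ### The extension of the skeleton follows the trajectories of the flow -/

section Follow

lemma measurable_min_optional {Ω : Type*} {𝓕 : ℝ → MeasurableSpace Ω} (hmono : Monotone 𝓕)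
    {T : Ω → EReal} (hT : ∀ q : ℝ, MeasurableSet[𝓕 q] {ω | T ω < q}) (q : ℝ) :
    Measurable[𝓕 q] fun ω => min (T ω) (q : EReal) := by
  let := 𝓕 q
  refine measurable_of_Iio fun c => ?_
  rcases lt_or_ge (q : EReal) c with h | h
  · convert MeasurableSet.univ
    ext ω
    simp [h]
  · have he : (fun ω => min (T ω) (q : EReal)) ⁻¹' Iio c = {ω | T ω < c} := by
      ext ω
      simp [h.not_gt]
    rw [he]
    induction c with
    | bot => simp
    | top => exact absurd (top_le_iff.1 h) (EReal.coe_ne_top q)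
    | coe c => exact hmono (EReal.coe_le_coe_iff.1 h) _ (hT c)

lemma measurable_of_optional {Ω : Type*} [mΩ : MeasurableSpace Ω] {𝓕 : ℝ → MeasurableSpace Ω}
    (h𝓕 : ∀ r, 𝓕 r ≤ mΩ) {T : Ω → EReal} (hT : ∀ q : ℝ, MeasurableSet[𝓕 q] {ω | T ω < q}) :
    Measurable T := by
  refine measurable_of_Iio fun c => ?_
  have h : T ⁻¹' Iio c = ⋃ (q : ℚ) (_ : ((q : ℝ) : EReal) ≤ c), {ω | T ω < (q : ℝ)} := by
    ext ω
    simp only [mem_preimage, mem_Iio, mem_iUnion, mem_ofPred_eq, exists_prop]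
    constructor
    · intro h
      obtain ⟨q, h1, h2⟩ := EReal.lt_iff_exists_rat_btwn.1 h
      exact ⟨q, h2.le, h1⟩
    · rintro ⟨q, h1, h2⟩
      exact h2.trans_le h1
  rw [h]
  exact .iUnion fun q => .iUnion fun _ => h𝓕 _ _ (hT q)

variable {M : Type*} [MetricSpace M] [ProperSpace M] [MeasurableSpace M] [BorelSpace M]
  {Ω : Type*} [MeasurableSpace Ω] {μ : Measure Ω} [IsProbabilityMeasure μ]
  {P : (n : ℕ) → ℝ≥0 → Kernel (Fin n → M) (Fin n → M)} {ψ : ℝ → ℝ → Ω → MeasMap M}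
  {ι : Type*} {D : ι → ℝ × M} {Y : ι → Ω → PathSpace M} {d : C(ℝ, M) → C(ℝ, M) → ℝ}
  {V : M → Ω → PathSpace M} {a : ι} {b : ℕ → ι} {T : Ω → EReal}

lemma isMarkovLaw_markovLaw (hP : IsConsistentCoalescing P) (hψ : IsStochasticFlow P μ ψ)
    (hV : ∀ y, IsVersion μ ψ (0, y) (V y)) (z : Fin 2 → M) :
    IsMarkovLaw (P 2) z (markovLaw (P 2) z) := by
  have h : z = ![z 0, z 1] := by ext i; fin_cases i <;> rfl
  rw [h]
  exact (isMarkovLaw_map_pairPath hP hψ (hV (z 0)) (hV (z 1))).markovLaw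

/-- The trajectory `b n` is at time `σ` within distance `ε_k` of the trajectory `a`. -/
def IsNear (P : (n : ℕ) → ℝ≥0 → Kernel (Fin n → M) (Fin n → M)) (d : C(ℝ, M) → C(ℝ, M) → ℝ)
    (D : ι → ℝ × M) (Y : ι → Ω → PathSpace M) (a : ι) (b : ℕ → ι) (k n : ℕ) (σ : ℝ) (ω : Ω) : Prop :=
  (D (b n)).1 ≤ σ ∧ dist (val (Y (b n) ω) σ) (val (Y a ω) σ) < eps P d k (val (Y a ω) σ)

/-- The event that `n` is the index which the extension of the skeleton `b` uses at the stage `k` of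
the approximation of the trajectory `a` after the time `T`. -/
def indexEvent (P : (n : ℕ) → ℝ≥0 → Kernel (Fin n → M) (Fin n → M)) (d : C(ℝ, M) → C(ℝ, M) → ℝ)
    (D : ι → ℝ × M) (Y : ι → Ω → PathSpace M) (a : ι) (b : ℕ → ι) (T : Ω → EReal) (k n : ℕ) : Set Ω :=
  {ω | T ω < ⊤ ∧ IsNear P d D Y a b k n (T ω).toReal ω ∧
    ∀ m < n, ¬ IsNear P d D Y a b k m (T ω).toReal ω}

omit [IsProbabilityMeasure μ] in
lemma measurableSet_indexEvent_inter (hY : ∀ a, IsVersion μ ψ (D a) (Y a))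
    (hε : ∀ k, Measurable (eps P d k))
    (hT : ∀ q : ℝ, MeasurableSet[pastSigma D Y q] {ω | T ω < q}) (hTa : ∀ ω, ((D a).1 : EReal) ≤ T ω)
    (k n : ℕ) (q : ℝ) : MeasurableSet[pastSigma D Y q]
      (indexEvent P d D Y a b T k n ∩ {ω | (T ω).toReal < q}) := by
  -- on `{T < q}`, the time `T` may be replaced by `T ∧ q`, which belongs to the past at time `q`
  let σ : Ω → ℝ := fun ω => (min (T ω) (q : EReal)).toReal
  have hval : ∀ c, Measurable[pastSigma D Y q] fun ω => val (Y c ω) (min (σ ω) q) := fun c =>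
    measurable_val_min hY c (@Measurable.ereal_toReal _ (pastSigma D Y q) _
      (measurable_min_optional (fun _ _ h => pastSigma_mono h) hT q))
  let := pastSigma D Y q
  have hσ : Measurable σ := (measurable_min_optional (fun _ _ h => pastSigma_mono h) hT q).ereal_toReal
  have hσq : ∀ ω, T ω < q → min (σ ω) q = (T ω).toReal := by
    intro ω h
    have h1 : σ ω = (T ω).toReal := by simp only [σ, min_eq_left h.le]
    rw [h1]
    have h2 : T ω ≠ ⊥ := ne_bot_of_gt ((EReal.bot_lt_coe _).trans_le (hTa ω))
    exact min_eq_left (EReal.coe_le_coe_iff.1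
      ((EReal.coe_toReal (h.trans (EReal.coe_lt_top q)).ne h2).trans_le h.le))
  have hnear : ∀ m, MeasurableSet {ω | IsNear P d D Y a b k m (min (σ ω) q) ω} := fun m =>
    (measurableSet_le measurable_const (hσ.min measurable_const)).inter
      (measurableSet_lt ((hval (b m)).dist (hval a)) ((hε k).comp (hval a)))
  have he : indexEvent P d D Y a b T k n ∩ {ω | (T ω).toReal < q} = {ω | T ω < q} ∩
      ({ω | IsNear P d D Y a b k n (min (σ ω) q) ω} ∩
        ⋂ m, ⋂ _ : m < n, {ω | IsNear P d D Y a b k m (min (σ ω) q) ω}ᶜ) := by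
    ext ω
    have hiff : T ω < ⊤ → ((T ω).toReal < q ↔ T ω < q) := by
      intro h
      have h2 : T ω ≠ ⊥ := ne_bot_of_gt ((EReal.bot_lt_coe _).trans_le (hTa ω))
      rw [← EReal.coe_lt_coe_iff, EReal.coe_toReal h.ne h2]
    simp only [indexEvent, mem_inter_iff, mem_ofPred_eq, mem_iInter, mem_compl_iff]
    constructor
    · rintro ⟨⟨h1, h2, h3⟩, h4⟩
      have h5 := (hiff h1).1 h4
      rw [hσq ω h5]
      exact ⟨h5, h2, h3⟩
    · rintro ⟨h1, h2⟩
      rw [hσq ω h1] at h2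
      have h3 : T ω < ⊤ := h1.trans (EReal.coe_lt_top q)
      exact ⟨⟨h3, h2⟩, (hiff h3).2 h1⟩
  rw [he]
  exact (hT q).inter ((hnear n).inter (.iInter fun m => .iInter fun _ => (hnear m).compl))

/-- By the strong Markov property and the choice of `ε_k`, the approximating path with index `n` is
far from the trajectory `a` after the time `T` with conditional probability at most `2⁻ᵏ`. -/
lemma measure_indexEvent_inter_le (hP : IsConsistentCoalescing P) (hψ : IsStochasticFlow P μ ψ)
    (hd : MetrizesPaths d) (hV : IsContinuousFamily μ ψ d V)
    (hY : ∀ a, IsVersion μ ψ (D a) (Y a))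
    (hT : ∀ q : ℝ, MeasurableSet[pastSigma D Y q] {ω | T ω < q}) (hTa : ∀ ω, ((D a).1 : EReal) ≤ T ω)
    (k n : ℕ) : MeasurableSet (indexEvent P d D Y a b T k n) ∧
      μ (indexEvent P d D Y a b T k n ∩ {ω | (2 : ℝ)⁻¹ ^ k ≤
        d (coordExt 0 (pairPath (Y a ω) (Y (b n) ω) (T ω).toReal))
          (coordExt 1 (pairPath (Y a ω) (Y (b n) ω) (T ω).toReal))}) ≤
      (2 : ℝ≥0∞)⁻¹ ^ k * μ (indexEvent P d D Y a b T k n) := by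
  set B := indexEvent P d D Y a b T k n with hBdef
  have hσ : Measurable fun ω => (T ω).toReal := (measurable_of_optional (pastSigma_le hY) hT).ereal_toReal
  have hB := measurableSet_indexEvent_inter hY (fun k => measurable_eps hP hψ hd hV k) hT hTa
    (b := b) k n
  rw [← hBdef] at hB
  have hBm : MeasurableSet B := by
    have : B = ⋃ q : ℕ, B ∩ {ω | (T ω).toReal < q} := by
      rw [← inter_iUnion, eq_comm, inter_eq_left]
      intro ω _
      obtain ⟨q, hq⟩ := exists_nat_gt (T ω).toReal
      exact mem_iUnion.2 ⟨q, hq⟩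
    rw [this]
    exact .iUnion fun q => pastSigma_le hY _ _ (hB q)
  refine ⟨hBm, ?_⟩
  have ha : ∀ ω ∈ B, (D a).1 ≤ (T ω).toReal := by
    intro ω hω
    have h2 : T ω ≠ ⊥ := ne_bot_of_gt ((EReal.bot_lt_coe _).trans_le (hTa ω))
    exact EReal.coe_le_coe_iff.1 ((hTa ω).trans_eq (EReal.coe_toReal hω.1.ne h2).symm)
  have hfdd := hasFDD_map_pairPath_optional hP hψ hY (a := a) (b := b n) hσ ha
    (fun ω hω => hω.2.1.1) hB
  have hw : Measurable fun ω => pairPath (Y a ω) (Y (b n) ω) (T ω).toReal :=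
    measurable_pairPath (hY a).measurable (hY (b n)).measurable hσ
  set S : Set C(ℝ≥0, Fin 2 → M) := {w | (2 : ℝ)⁻¹ ^ k ≤ d (coordExt 0 w) (coordExt 1 w)} with hSdef
  have hS : MeasurableSet S := (isClosed_le continuous_const hd.continuous_coordExt).measurableSet
  have hQ := isMarkovLaw_markovLaw hP hψ hV.version
  have hQp : ∀ z, IsProbabilityMeasure (markovLaw (P 2) z) := fun z => (hQ z).prob
  have hQf := fun z => (hQ z).hasFDD (hP.feller 2)
  have hQm : Measurable fun w : C(ℝ≥0, Fin 2 → M) => markovLaw (P 2) (w 0) S :=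
    (Measure.measurable_coe hS).comp ((measurable_of_hasFDD hQp hQf fun z => (hQ z).init).comp
      (measurable_eval_path 0))
  have key := hfdd.measure_eq_lintegral hQp hQf (fun z => (hQ z).init) hS
  rw [Measure.map_apply hw hS, Measure.restrict_apply (hw hS), lintegral_map hQm hw,
    inter_comm] at key
  refine key.trans_le ?_
  refine (setLIntegral_mono measurable_const fun ω hω => ?_).trans_eq (setLIntegral_const _ _)
  have h0 : pairPath (Y a ω) (Y (b n) ω) (T ω).toReal 0 =
      ![val (Y a ω) (T ω).toReal, val (Y (b n) ω) (T ω).toReal] := by simp [pairPath_apply]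
  rw [h0]
  exact distProb_le_of_dist_lt hP hψ hd hV hω.2.1.2

/-- From an optional time `T` on, the extension of the skeleton almost surely follows each of the
trajectories of the flow. -/
theorem ae_theta_eq_of_optional (hP : IsConsistentCoalescing P) (hψ : IsStochasticFlow P μ ψ)
    (hd : MetrizesPaths d) (hV : IsContinuousFamily μ ψ d V)
    (hY : ∀ a, IsVersion μ ψ (D a) (Y a)) (hsk : ∀ᵐ ω ∂μ, IsSkeleton fun n => Y (b n) ω)
    {ℓ : (ℕ → PathSpace M) → PathSpace M} (hℓ : IsLimitSelector ℓ)
    (hT : ∀ q : ℝ, MeasurableSet[pastSigma D Y q] {ω | T ω < q})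
    (hTa : ∀ ω, ((D a).1 : EReal) ≤ T ω) :
    ∀ᵐ ω ∂μ, ∀ r : ℝ, T ω = r → ∀ u, r ≤ u →
      theta ℓ (eps P d) (fun n => Y (b n) ω) r u (val (Y a ω) r) = val (Y a ω) u := by
  let B := fun k n => indexEvent P d D Y a b T k n
  let A : ℕ → Set Ω := fun k => ⋃ n, B k n ∩ {ω | (2 : ℝ)⁻¹ ^ k ≤
        d (coordExt 0 (pairPath (Y a ω) (Y (b n) ω) (T ω).toReal))
          (coordExt 1 (pairPath (Y a ω) (Y (b n) ω) (T ω).toReal))}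
  have hB := fun k n => measure_indexEvent_inter_le (b := b) hP hψ hd hV hY hT hTa k n
  have hdisj : ∀ k, Pairwise (Function.onFun Disjoint (B k)) := by
    intro k m n hmn
    refine disjoint_left.2 fun ω hm hn => ?_
    rcases hmn.lt_or_gt with h | h
    · exact hn.2.2 m h hm.2.1
    · exact hm.2.2 n h hn.2.1
  have hA : ∀ k, μ (A k) ≤ (2 : ℝ≥0∞)⁻¹ ^ k := fun k =>
    calc μ (A k) ≤ ∑' n, (2 : ℝ≥0∞)⁻¹ ^ k * μ (B k n) :=
          (measure_iUnion_le _).trans (ENNReal.tsum_le_tsum fun n => (hB k n).2)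
      _ = (2 : ℝ≥0∞)⁻¹ ^ k * μ (⋃ n, B k n) := by
          rw [ENNReal.tsum_mul_left, measure_iUnion (hdisj k) fun n => (hB k n).1]
      _ ≤ (2 : ℝ≥0∞)⁻¹ ^ k := mul_le_of_le_one_right' prob_le_one
  have hsum : ∑' k, μ (A k) ≠ ⊤ := by
    refine ne_top_of_le_ne_top ?_ (ENNReal.tsum_le_tsum hA)
    rw [ENNReal.tsum_geometric, ENNReal.one_sub_inv_two, inv_inv]
    exact ENNReal.ofNat_ne_top
  filter_upwards [hsk, ae_eventually_notMem hsum] with ω hω hA r hr u hu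
  set φ : ℕ → PathSpace M := fun n => Y (b n) ω
  set z := val (Y a ω) r
  have hε : ∀ k x, 0 < eps P d k x := eps_pos hP hψ hd hV
  obtain ⟨U, hUt, hU⟩ := hω.exists_ultrafilter hε eps_le hℓ r z
  have hTr : (T ω).toReal = r := by rw [hr, EReal.toReal_coe]
  let w : ℕ → C(ℝ≥0, Fin 2 → M) := fun k => pairPath (Y a ω) (φ (approxIndex (eps P d) r z φ k)) r
  -- outside of `A k`, the path with the index used at stage `k` is close to the trajectory `a`
  have hclose : ∀ᶠ k in atTop, d (coordExt 0 (w k)) (coordExt 1 (w k)) < (2 : ℝ)⁻¹ ^ k := by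
    filter_upwards [hA] with k hk
    by_contra hcon
    refine hk (mem_iUnion.2 ⟨approxIndex (eps P d) r z φ k, ⟨?_, ?_, ?_⟩, ?_⟩)
    · rw [hr]; exact EReal.coe_lt_top r
    · have h := hω.approxIndex_spec hε r z k
      rw [hTr]
      exact ⟨((hY _).start_eq ω).symm.trans_le h.1, h.2⟩
    · intro m hm hnear
      rw [hTr] at hnear
      exact Nat.notMem_of_lt_sInf hm ⟨((hY _).start_eq ω).trans_le hnear.1, hnear.2⟩
    · rw [mem_ofPred_eq, hTr]
      exact not_lt.1 hcon
  have hlim : Tendsto (fun k => coordExt 1 (w k)) U (𝓝 (coordExt 0 (pairPath (Y a ω) (Y a ω) r))) := by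
    rw [hd.tendsto_iff]
    refine squeeze_zero' (Eventually.of_forall fun k => hd.nonneg _ _) ?_
      (tendsto_two_inv_pow.mono_left hUt)
    filter_upwards [hUt hclose] with k hk
    rw [hd.comm]
    exact hk.le
  have h1 : Tendsto (fun k => coordExt 1 (w k) (u - r)) U
      (𝓝 (coordExt 0 (pairPath (Y a ω) (Y a ω) r) (u - r))) :=
    ((continuous_eval_const (u - r)).tendsto _).comp hlim
  have h2 := ((continuous_val_left u).tendsto _).comp hU
  have hur : r + ((u - r).toNNReal : ℝ) = u := by
    rw [Real.coe_toNNReal _ (by linarith)]; ring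
  have e1 : ∀ k, coordExt 1 (w k) (u - r) =
      val (restrictFrom (φ (approxIndex (eps P d) r z φ k)) r) u := by
    intro k
    rw [val_restrictFrom, max_eq_right hu]
    exact congrArg (val (φ (approxIndex (eps P d) r z φ k))) hur
  have e2 : coordExt 0 (pairPath (Y a ω) (Y a ω) r) (u - r) = val (Y a ω) u :=
    congrArg (val (Y a ω)) hur
  rw [e2] at h1
  exact tendsto_nhds_unique (h2.congr fun k => (e1 k).symm) h1

omit [IsProbabilityMeasure μ] in
/-- The hitting times of a closed set by a trajectory are optional times. -/
lemma measurableSet_pathHit_lt (hY : ∀ a, IsVersion μ ψ (D a) (Y a)) {F : Set (ℝ × M)}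
    (hF : IsClosed F) (a : ι) (s : ℝ) (k : ℕ) (q : ℝ) :
    MeasurableSet[pastSigma D Y q] {ω | pathHit F (val (Y a ω)) s k < q} := by
  induction k generalizing q with
  | zero => exact @MeasurableSet.const _ (pastSigma D Y q) ((s : EReal) < q)
  | succ k ih =>
    have he : {ω | pathHit F (val (Y a ω)) s (k + 1) < q} = ⋃ (p : ℚ) (q' : ℚ) (_ : p < q')
        (_ : (q' : ℝ) < q), {ω | pathHit F (val (Y a ω)) s k < ((p : ℝ) : EReal)} ∩
          {ω | ∃ t ∈ Icc (p : ℝ) q', (t, val (Y a ω) t) ∈ F} := by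
      ext ω
      simp only [mem_ofPred_eq, mem_iUnion, mem_inter_iff, exists_prop]
      rcases pathHit_eq_top_or (F := F) (γ := val (Y a ω)) (s := s) (k := k) with h | ⟨c, -, h⟩
      · rw [pathHit, if_pos h, h]
        simp
      · rw [pathHit, h, if_neg (EReal.coe_ne_top c), EReal.toReal_coe, nextTime_lt_iff]
        simp only [EReal.coe_lt_coe_iff]
        grind
    rw [he]
    refine .iUnion fun p => .iUnion fun q' => .iUnion fun hpq => .iUnion fun hq => ?_
    have hpq' : (p : ℝ) < q' := by exact_mod_cast hpq
    refine (pastSigma_mono (hpq'.trans hq).le _ (ih p)).inter ?_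
    have hval : ∀ t ∈ Icc (p : ℝ) q', Measurable[pastSigma D Y q] fun ω => val (Y a ω) t := by
      intro t ht
      have := measurable_val_min hY a (q := q) (τ := fun _ => t)
        (@measurable_const _ _ _ (pastSigma D Y q) t)
      simpa only [min_eq_left (ht.2.trans hq.le)] using this
    exact @measurableSet_exists_mem_Icc M _ F _ _ _ Ω (pastSigma D Y q) hF _
      (fun ω => continuous_val_right (Y a ω)) _ _ hpq' hval

end Follow

/-! ### The restarted family is a modification of the flow -/

section Modification

variable {M : Type*} [MetricSpace M] [ProperSpace M] {F : Set (ℝ × M)}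

/-- The realizations of the skeleton for which the hypotheses on `F` hold satisfy the pathwise
assumptions under which restarting produces a flow. -/
lemma IsSkeleton.isRestartable {φ : ℕ → PathSpace M} {ε : ℕ → M → ℝ}
    {ℓ : (ℕ → PathSpace M) → PathSpace M} (hφ : IsSkeleton φ) (hε : ∀ k x, 0 < ε k x)
    (hε' : ∀ k x, ε k x ≤ (2 : ℝ)⁻¹ ^ k) (hℓ : IsLimitSelector ℓ) (hF : IsClosed F)
    (hshell : bifurcationSet φ ⊆ F) (hk : ∀ s x, hitCount (theta ℓ ε φ) F s x < ⊤)
    (hk0 : ∀ (s : ℝ) (x : M), hitCount (theta ℓ ε φ) F s x = 0 → ∀ t : ℝ, s < t →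
      ∃ n : ℕ, start (φ n) ≤ t ∧ ∀ u : ℝ, t ≤ u → theta ℓ ε φ s u x = val (φ n) u) :
    IsRestartable (theta ℓ ε φ) F where
  isClosed := hF
  self := hφ.theta_self hε hε' hℓ
  continuous := continuous_theta
  eqOn hs hs' h hb := hφ.exists_eqOn_theta hε hε' hℓ hs hs' h fun hmem => hb (hshell hmem)
  hitCount_lt_top := hk
  exists_path {s t x} h hst := by
    obtain ⟨n, hn, hu⟩ := hk0 s x h t hst
    exact ⟨val (φ n), fun r u htr hru => hφ.theta_val hε hε' hℓ (hn.trans htr) hru, hu⟩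

variable [MeasurableSpace M] [BorelSpace M]
  {Ω : Type*} [MeasurableSpace Ω] {μ : Measure Ω} [IsProbabilityMeasure μ]
  {P : (n : ℕ) → ℝ≥0 → Kernel (Fin n → M) (Fin n → M)} {ψ : ℝ → ℝ → Ω → MeasMap M}
  {D : ℕ → ℝ × M} {Φ : ℕ → Ω → PathSpace M} {d : C(ℝ, M) → C(ℝ, M) → ℝ}
  {V : M → Ω → PathSpace M}

/-- Almost surely, `θ` follows the continuous version of the flow from `(s, x)` after each of its
hitting times of `F`; hence so does the restarted family. -/
lemma ae_restart_eq (hP : IsConsistentCoalescing P) (hψ : IsStochasticFlow P μ ψ)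
    (hD : DenseRange D) (hΦ : ∀ n, IsVersion μ ψ (D n) (Φ n)) (hd : MetrizesPaths d)
    (hV : IsContinuousFamily μ ψ d V) (hsk : ∀ᵐ ω ∂μ, IsSkeleton fun n => Φ n ω)
    {ℓ : (ℕ → PathSpace M) → PathSpace M} (hℓ : IsLimitSelector ℓ) (hF : IsClosed F)
    (hk : ∀ᵐ ω ∂μ, ∀ s x, hitCount (theta ℓ (eps P d) fun n => Φ n ω) F s x < ⊤)
    {s t : ℝ} (hst : s ≤ t) (x : M) :
    ∀ᵐ ω ∂μ, restart (theta ℓ (eps P d) fun n => Φ n ω) F s t x = (ψ s t ω).1 x := by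
  obtain ⟨Z, hZ, -⟩ := exists_version hP hψ hD hΦ hsk s x
  -- the version `Z` is adjoined to the family `Φ`, with the index `none`
  let D' : Option ℕ → ℝ × M := fun o => o.elim (s, x) D
  let Y : Option ℕ → Ω → PathSpace M := fun o => o.elim Z Φ
  have hY : ∀ o, IsVersion μ ψ (D' o) (Y o) := by
    rintro (_ | n)
    · exact hZ
    · exact hΦ n
  have hfollow : ∀ᵐ ω ∂μ, ∀ (k : ℕ) (r : ℝ), pathHit F (val (Z ω)) s k = r → ∀ u, r ≤ u →
      theta ℓ (eps P d) (fun n => Φ n ω) r u (val (Z ω) r) = val (Z ω) u :=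
    ae_all_iff.2 fun k => ae_theta_eq_of_optional (a := none) (b := some) hP hψ hd hV hY hsk hℓ
      (fun q => measurableSet_pathHit_lt hY hF none s k q) fun ω => by
        rcases pathHit_eq_top_or (F := F) (γ := val (Z ω)) (s := s) (k := k) with h | ⟨c, hc, h⟩
        · exact le_top.trans_eq h.symm
        · exact (EReal.coe_le_coe_iff.2 hc).trans_eq h.symm
  filter_upwards [hsk, hk, hfollow, hZ.modification t hst] with ω h1 h2 h3 h4
  have hx : val (Z ω) s = x := hZ.val_start ω
  have key := restart_eq_of_pathHit (h1.theta_self (eps_pos hP hψ hd hV) eps_le hℓ) h3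
    (h2 s (val (Z ω) s)) hst
  rw [hx] at key
  exact key.trans h4

end Modification

end StrongFlow

theorem mainTheorem1 {M : Type*} [MetricSpace M] [ProperSpace M] [MeasurableSpace M] [BorelSpace M]
    {Ω : Type*} [MeasurableSpace Ω] (μ : Measure Ω) [IsProbabilityMeasure μ]
    (P : (n : ℕ) → ℝ≥0 → Kernel (Fin n → M) (Fin n → M))
    (hP : IsConsistentCoalescing P) (hTF3 : HasContinuousTrajectories P)
    (ψ₀ : ℝ → ℝ → Ω → MeasMap M) (hψ₀ : IsStochasticFlow P μ ψ₀)
    (D : ℕ → ℝ × M) (hD : DenseRange D)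
    (Φ : ℕ → Ω → PathSpace M) (hΦ : IsContinuousVersion μ ψ₀ D Φ)
    (hTF4 : ∀ᵐ ω ∂μ, IsSkeleton (fun n => Φ n ω))
    (d : C(ℝ, M) → C(ℝ, M) → ℝ) (hd : MetrizesPaths d)
    (ℓ : (ℕ → PathSpace M) → PathSpace M) (hℓ : IsLimitSelector ℓ)
    (θ : Ω → ℝ → ℝ → M → M) (hθ : ∀ ω, θ ω = theta ℓ (eps P d) (fun n => Φ n ω))
    (F : Set (ℝ × M)) (hF : IsClosed F)
    (hshell : ∀ᵐ ω ∂μ, bifurcationSet (fun n => Φ n ω) ⊆ F)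
    (hk : ∀ᵐ ω ∂μ, ∀ (s : ℝ) (x : M), hitCount (θ ω) F s x < ⊤)
    (hk0 : ∀ᵐ ω ∂μ, ∀ (s : ℝ) (x : M), hitCount (θ ω) F s x = 0 → ∀ t : ℝ, s < t →
      ∃ n : ℕ, start (Φ n ω) ≤ t ∧ ∀ u : ℝ, t ≤ u → θ ω s u x = val (Φ n ω) u) :
    ∃ Ω₀ : Set Ω, MeasurableSet Ω₀ ∧ μ Ω₀ = 1 ∧
      IsStrongMeasurableContinuousModification μ
        (fun s t ω x => open Classical in if ω ∈ Ω₀ then restart (θ ω) F s t x else x) ψ₀ := by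
  obtain rfl : θ = fun ω => theta ℓ (eps P d) fun n => Φ n ω := funext hθ
  have hV : ∀ n, IsVersion μ ψ₀ (D n) (Φ n) := fun n =>
    ⟨hΦ.measurable n, hΦ.start_eq n, hΦ.val_start n, hΦ.modification n⟩
  obtain ⟨V, hVc⟩ := exists_isContinuousFamily hP hψ₀ hD hV hTF4 hd
  have hgood : ∀ᵐ ω ∂μ, IsRestartable (theta ℓ (eps P d) fun n => Φ n ω) F := by
    filter_upwards [hTF4, hshell, hk, hk0] with ω h1 h2 h3 h4
    exact h1.isRestartable (eps_pos hP hψ₀ hd hVc) eps_le hℓ hF h2 h3 h4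
  -- the set of good realizations need not be measurable, but it contains an event of full measure
  obtain ⟨Ω₀, hsub, hm, hμ⟩ : ∃ Ω₀ ⊆ {ω | IsRestartable (theta ℓ (eps P d) fun n => Φ n ω) F},
      MeasurableSet Ω₀ ∧ μ Ω₀ = 1 := by
    refine ⟨(toMeasurable μ {ω | IsRestartable (theta ℓ (eps P d) fun n => Φ n ω) F}ᶜ)ᶜ,
      compl_subset_comm.1 (subset_toMeasurable _ _), (measurableSet_toMeasurable _ _).compl, ?_⟩
    rw [prob_compl_eq_one_iff (measurableSet_toMeasurable _ _), measure_toMeasurable]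
    exact hgood
  have hrestart := measurable_restart (Θ := fun q : ℝ × M × Ω =>
    bigTheta ℓ (eps P d) q.1 q.2.1 fun n => Φ n q.2.2) hF
    (measurable_bigTheta hΦ.measurable (measurable_eps hP hψ₀ hd hVc) hℓ.measurable)
    (θ := fun ω => theta ℓ (eps P d) fun n => Φ n ω) (fun ω s t x => rfl)
  refine ⟨Ω₀, hm, hμ, ?_, fun s ω x => ?_, fun s t hst x => ?_, fun s ω x => ?_,
    fun s t u hst htu ω x => ?_⟩
  · have h1 : Measurable fun q : {p : ℝ × ℝ // p.1 ≤ p.2} × M × Ω => q.2.2 :=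
      measurable_snd.comp measurable_snd
    have h2 : Measurable fun q : {p : ℝ × ℝ // p.1 ≤ p.2} × M × Ω => (q.1.1.1, q.1.1.2, q.2) :=
      (measurable_fst.comp (measurable_subtype_coe.comp measurable_fst)).prodMk
        ((measurable_snd.comp (measurable_subtype_coe.comp measurable_fst)).prodMk measurable_snd)
    exact Measurable.ite (h1 hm) (hrestart.comp h2) (measurable_fst.comp measurable_snd)
  · dsimp only
    split_ifs with h
    · exact restart_self (hsub h).self
    · rfl
  · have hΩ₀ : ∀ᵐ ω ∂μ, ω ∈ Ω₀ := by
      rw [← prob_compl_eq_zero_iff hm] at hμ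
      exact hμ
    filter_upwards [hΩ₀, ae_restart_eq hP hψ₀ hD hV hd hVc hTF4 hℓ hF hk hst x] with ω h1 h2
    rw [if_pos h1]
    exact h2
  · by_cases h : ω ∈ Ω₀
    · simp only [if_pos h]
      exact (hsub h).continuousOn_restart s x
    · simp only [if_neg h]
      exact continuousOn_const
  · dsimp only
    split_ifs with h
    · exact (hsub h).restart_restart hst htu
    · rfl
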